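/- Let $a,b\in\mathbf C$ with $ab(a-1)(b-1)(a-b)\neq 0$, and let $\mathrm{dP}_4$ be the quartic del Pezzo surface obtained by blowing up $\mathbf P^2$ at the five points in general position $p_1=[1:0:0]$, $p_2=[0:1:0]$, $p_3=[0:0:1]$, $p_4=[1:1:1]$, $p_5=[a:b:1]$. (Every smooth quartic del Pezzo surface over $\mathbf C$ is of this form.) Let $\mathbf{Pic}=\mathbf Zh\oplus\bigoplus_{i=1}^5\mathbf Z\ell_i$ be its Picard lattice, with intersection form of signature $(1,5)$ and canonical class $K=-3h+\sum_i\ell_i$. Let $W=W(D_5)$ be the Weyl group generated by the reflections $d\mapsto d+(d,\rho)\rho$ in the roots $\rho=\ell_i-\ell_{i+1}$ $(1\le i\le 4)$ and $\rho=h-\ell_1-\ell_2-\ell_3$. It permutes the classes of the 16 lines of $\mathrm{dP}_4$ and the 10 conic classes $h-\ell_i$ and $2h-\sum_{j\ne i}\ell_j$ $(1\le i\le 5)$. Let $\mathcal W_{\mathrm{dP}_4}$ be the 10-web on $\mathrm{dP}_4$ defined by the pencils of conics $U_{\mathfrak c}:\mathrm{dP}_4\to\mathbf P^1$, one for each conic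 class $\mathfrak c$. In the affine coordinates $[x:y:1]$ the ten pencils are given by $$x,\quad \frac1y,\quad \frac yx,\quad \frac{x-y}{x-1},\quad \frac{b(a-x)}{ay-bx},\quad \frac{(1-x)b+x+(a-1)y-a}{(x-1)(y-b)},$$ $$\frac{(x-y)(y-b)}{y(ay-bx-a+b+x-y)},\quad \frac{-x(x(b-1)+(1-y)a-b+y)}{(x-y)(x-a)},\quad \frac{y(x-a)}{x(y-b)},\quad \frac{x(y-1)}{y(x-1)},$$ where the set of values of the reducible fibres of the $i$-th function is $\{0,1,r_i,\infty\}$, $r_i$ being the $i$-th component of $$\Big(a,\ \tfrac1b,\ \tfrac ba,\ \tfrac{a-b}{a-1},\ \tfrac{b(a-1)}{a-b},\ \tfrac{b-a}{b},\ \tfrac1{1-a},\ 1-b,\ \tfrac{a-1}{b-1},\ \tfrac{a(b-1)}{b(a-1)}\Big).$$ Write $r_{\mathfrak c}$ for the value $r_i$ attached to the pencil $\mathfrak c$. Let $\mathbf H_{\mathfrak c}$ be the complex vector space of rational 1-forms spanned by $\frac{dU_{\mathfrak c}}{U_{\mathfrak c}}$, $\frac{dU_{\mathfrak c}}{U_{\mathfrak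 c}-1}$, $\frac{dU_{\mathfrak c}}{U_{\mathfrak c}-r_{\mathfrak c}}$, and let $\mathbf H=\sum_{\mathfrak c}\mathbf H_{\mathfrak c}$. For each weight $\nu$ let $$\mathbf{HLogAR}^\nu=\ker\Big(\bigoplus_{\mathfrak c}\mathbf H_{\mathfrak c}^{\otimes\nu}\to\mathbf H^{\otimes\nu},\ (\Omega_{\mathfrak c})\mapsto\sum_{\mathfrak c}\Omega_{\mathfrak c}\Big)$$ be the space of symbolic hyperlogarithmic abelian relations of weight $\nu$. Let $\mathbf{HLogAR}^2_{\rm sym}$ and $\mathbf{HLogAR}^2_{\rm asym}$ be the subspaces of $\mathbf{HLogAR}^2$ of tuples with all components symmetric, respectively antisymmetric, and let $$\mathbf{HLog}^3=\Big(\frac{dU_{\mathfrak c}}{U_{\mathfrak c}}\wedge\frac{dU_{\mathfrak c}}{U_{\mathfrak c}-1}\wedge\frac{dU_{\mathfrak c}}{U_{\mathfrak c}-r_{\mathfrak c}}\Big)_{\mathfrak c},$$ where $\wedge$ denotes the antisymmetrised tensor product. Then the following hold. 1. *The Weyl group acts naturally.* Every $\omega\in\mathbf H$ has a well-defined constant residue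 $\mathrm{Res}_\ell(\omega)$ along each line $\ell$ of $\mathrm{dP}_4$. There is a unique linear action of $W$ on $\mathbf H$ such that $\mathrm{Res}_{w\ell}(w\cdot\omega)=\mathrm{Res}_\ell(\omega)$ for all $w\in W$, all lines $\ell$ and all $\omega\in\mathbf H$. For each $\nu$ there is a unique linear action of $W$ on $\bigoplus_{\mathfrak c}\mathbf H_{\mathfrak c}^{\otimes\nu}$ such that, inside $\mathbf H^{\otimes\nu}$, the component of index $w\mathfrak c$ of $w\bullet\Omega$ is $w\cdot\Omega_{\mathfrak c}$. The subspaces $\mathbf{HLogAR}^\nu$, $\mathbf{HLogAR}^2_{\rm sym}$ and $\mathbf{HLogAR}^2_{\rm asym}$ are stable under it. 2. *Structure as $W(D_5)$-modules.* Let $V_{[\alpha.\beta]}$ be the $W(D_5)$-module attached to the bipartition $(\alpha,\beta)$ of $5$, that is, the restriction to $W(D_5)$ of the irreducible $W(B_5)$-module with that label. A superscript denotes the dimension. There are isomorphisms of $W$-modules $$\mathbf{HLogAR}^1\simeq V^{20}_{[2.21]},\qquad \mathbf{HLogAR}^2_{\rm asym}\simeq V^{10}_{[11.111]},\qquad \mathbf{HLogAR}^2_{\rm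 sym}\simeq V^{5}_{[.221]},$$ $$\mathbf{HLogAR}^3=\langle\mathbf{HLog}^3\rangle\simeq V^1_{[.1^5]}\simeq\mathbf{sign}_{D_5},$$ and all these $W$-modules are irreducible. -/

import Mathlib

open scoped TensorProduct

noncomputable section

namespace DP4

/-! ### The Picard lattice of a quartic del Pezzo surface and its Weyl group -/

/-- The Picard lattice of the blow-up of the projective plane at five points: `ℤ h ⊕ ⨁ ℤ ℓ_i`,
the coordinate `0` being that of `h` and the coordinate `i + 1` that of `ℓ_{i+1}` (`i : Fin 5`). -/
abbrev Pic : Type := Fin 6 → ℤ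

/-- The class `h` of a general line of the plane. -/
def hCls : Pic := Pi.single 0 1

/-- The class of the exceptional divisor over the `i`-th blown-up point (`i = 0, …, 4` stand for
the points `p₁, …, p₅`). -/
def eCls (i : Fin 5) : Pic := Pi.single i.succ 1

/-- The intersection pairing, of signature `(1, 5)`. -/
def inter (v w : Pic) : ℤ := v 0 * w 0 - ∑ i : Fin 5, v i.succ * w i.succ

/-- The canonical class `-3h + ∑ ℓ_i`. -/
def canCls : Pic := -(3 • hCls) + ∑ i : Fin 5, eCls i

lemma inter_add_left (u v w : Pic) : inter (u + v) w = inter u w + inter v w := by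
  simp [inter, Fin.sum_univ_five]; ring

lemma inter_smul_left (c : ℤ) (v w : Pic) : inter (c • v) w = c * inter v w := by
  simp [inter, Fin.sum_univ_five]; ring

lemma inter_comm (v w : Pic) : inter v w = inter w v := by
  simp [inter, Fin.sum_univ_five]; ring

lemma inter_add_right (u v w : Pic) : inter u (v + w) = inter u v + inter u w := by
  rw [inter_comm, inter_add_left, inter_comm v, inter_comm w]

lemma inter_smul_right (c : ℤ) (v w : Pic) : inter v (c • w) = c * inter v w := by
  rw [inter_comm, inter_smul_left, inter_comm]

/-- The reflection `d ↦ d + (d, ρ) ρ` in a class `ρ` with `ρ² = -2`. -/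
def reflect (ρ : Pic) (hρ : inter ρ ρ = -2) : Pic ≃ₗ[ℤ] Pic :=
  LinearEquiv.ofInvolutive
    { toFun := fun d => d + inter d ρ • ρ
      map_add' := fun u v => by rw [inter_add_left, add_smul]; abel
      map_smul' := fun c v => by
        rw [inter_smul_left, mul_smul, RingHom.id_apply, smul_add] }
    (fun d => by
      change d + inter d ρ • ρ + inter (d + inter d ρ • ρ) ρ • ρ = d
      rw [inter_add_left, inter_smul_left, hρ, add_assoc, ← add_smul]
      have : inter d ρ + (inter d ρ + inter d ρ * -2) = 0 := by ring
      rw [this, zero_smul, add_zero])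

lemma reflect_apply (ρ : Pic) (hρ : inter ρ ρ = -2) (d : Pic) :
    reflect ρ hρ d = d + inter d ρ • ρ := rfl

/-- The fundamental roots `ℓ₁ - ℓ₂, ℓ₂ - ℓ₃, ℓ₃ - ℓ₄, ℓ₄ - ℓ₅, h - ℓ₁ - ℓ₂ - ℓ₃`. -/
def root : Fin 5 → Pic :=
  ![eCls 0 - eCls 1, eCls 1 - eCls 2, eCls 2 - eCls 3, eCls 3 - eCls 4,
    hCls - eCls 0 - eCls 1 - eCls 2]

lemma inter_root (i : Fin 5) : inter (root i) (root i) = -2 := by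
  fin_cases i <;> decide

/-- The Weyl group `W(D₅)`, generated by the reflections in the five fundamental roots. -/
def W : Subgroup (Pic ≃ₗ[ℤ] Pic) :=
  Subgroup.closure (Set.range fun i => reflect (root i) (inter_root i))

/-- The signature character of `W(D₅)`: the determinant (every reflection is sent to `-1`). -/
def signRep : Representation ℂ W ℂ where
  toFun w := (((LinearEquiv.det (w : Pic ≃ₗ[ℤ] Pic) : ℤˣ) : ℤ) : ℂ) • LinearMap.id
  map_one' := by ext; simp
  map_mul' u v := by ext; simp [mul_comm]

lemma inter_W (w : W) (u v : Pic) : inter ((w : Pic ≃ₗ[ℤ] Pic) u) ((w : Pic ≃ₗ[ℤ] Pic) v)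
    = inter u v := by
  obtain ⟨w, hw⟩ := w
  change inter (w u) (w v) = inter u v
  induction hw using Subgroup.closure_induction generalizing u v with
  | mem x hx =>
    obtain ⟨i, rfl⟩ := hx
    have h2 := inter_root i
    simp only [reflect_apply, inter_add_left, inter_add_right, inter_smul_left, inter_smul_right,
      h2, inter_comm (root i) v]
    ring
  | one => rfl
  | mul x y _ _ hx hy => rw [LinearEquiv.mul_apply, LinearEquiv.mul_apply, hx, hy]
  | inv x _ hx =>
    rw [← hx]
    rw [← LinearEquiv.mul_apply, ← LinearEquiv.mul_apply, mul_inv_cancel]; rfl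

lemma W_canCls (w : W) : (w : Pic ≃ₗ[ℤ] Pic) canCls = canCls := by
  obtain ⟨w, hw⟩ := w
  change w canCls = canCls
  induction hw using Subgroup.closure_induction with
  | mem x hx =>
    obtain ⟨i, rfl⟩ := hx
    have : inter canCls (root i) = 0 := by fin_cases i <;> decide
    simp only [reflect_apply, this, zero_smul, add_zero]
  | one => rfl
  | mul x y _ _ hx hy => rw [LinearEquiv.mul_apply, hy, hx]
  | inv x _ hx =>
    conv_lhs => rw [← hx]
    rw [← LinearEquiv.mul_apply, inv_mul_cancel]; rfl

/-! ### The irreducible `W(D₅)`-modules attached to bipartitions of `5`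

The vectors `ε_i = (h - ℓ_i) + K/2` (`i = 1, …, 5`) form an orthonormal basis of `K^⊥ ⊗ ℚ` for the
form `-( , )`. On it `W` acts by the signed permutations with an even number of signs, so that
`W ≅ W(D₅) ⊂ W(B₅)`. The irreducible `W(B₅)`-module with label `(α, β)` (the one induced from the
module `S^α ⊠ (S^β ⊗ δ)` of `W(B_k) × W(B_{5-k})`, where `δ` is `-1` on the sign changes and `1` on
the permutations) is realised in `ℂ[ε₁, …, ε₅]` as the span of the Specht polynomials of all
bitableaux of shape `(α, β)`; the `W(D₅)`-module `[α.β]` is its restriction. -/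

/-- The coefficient of `ε_j` in `w ε_i`. -/
def signedCoeff (w : W) (i j : Fin 5) : ℤ :=
  1 - inter ((w : Pic ≃ₗ[ℤ] Pic) (hCls - eCls i)) (hCls - eCls j)

/-- The action of `w` on `ℂ[ε₁, …, ε₅]` by linear substitutions. -/
def polyAct (w : W) : MvPolynomial (Fin 5) ℂ →ₐ[ℂ] MvPolynomial (Fin 5) ℂ :=
  MvPolynomial.aeval fun i => ∑ j, signedCoeff w i j • MvPolynomial.X j

lemma two_smul_add_canCls (v : Pic) (hv : inter v canCls = -2) :
    (2 : ℤ) • v + canCls =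
      ∑ j : Fin 5, (1 - inter v (hCls - eCls j)) • ((2 : ℤ) • (hCls - eCls j) + canCls) := by
  have c0 : ∀ j : Fin 5, (hCls - eCls j) 0 = 1 := by decide
  have c1 : ∀ j k : Fin 5, (hCls - eCls j) k.succ = if j = k then -1 else 0 := by decide
  have k0 : canCls 0 = -3 := by decide
  have k1 : ∀ k : Fin 5, canCls k.succ = 1 := by decide
  have key : ∀ j : Fin 5, inter v (hCls - eCls j) = v 0 + v j.succ := by
    intro j
    simp [inter, c0, c1]
  have hv' : v 0 * (-3) - ∑ k : Fin 5, v k.succ = -2 := by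
    simpa [inter, k0, k1] using hv
  simp only [key]
  funext k
  refine Fin.cases ?_ (fun m => ?_) k
  · simp only [Pi.add_apply, Pi.smul_apply, Finset.sum_apply, c0, k0, smul_eq_mul]
    simp only [Fin.sum_univ_five] at hv' ⊢
    linarith
  · simp only [Pi.add_apply, Pi.smul_apply, Finset.sum_apply, c1, k1, smul_eq_mul]
    simp only [Fin.sum_univ_five] at hv' ⊢
    fin_cases m <;> simp at hv' ⊢ <;> linarith

lemma signedCoeff_mul (u w : W) (i k : Fin 5) :
    signedCoeff (u * w) i k = ∑ j, signedCoeff w i j * signedCoeff u j k := by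
  have hK : ∀ j : Fin 5, inter (hCls - eCls j) canCls = -2 := by
    intro j; fin_cases j <;> decide
  have hw : inter ((w : Pic ≃ₗ[ℤ] Pic) (hCls - eCls i)) canCls = -2 := by
    rw [← W_canCls w, inter_W, hK]
  have h := congrArg (fun d => inter ((u : Pic ≃ₗ[ℤ] Pic) d) (hCls - eCls k))
    (two_smul_add_canCls _ hw)
  simp only [Fin.sum_univ_five, map_add, map_smul, W_canCls, inter_add_left, inter_smul_left,
    inter_comm canCls, hK] at h
  simp only [signedCoeff, Fin.sum_univ_five, Subgroup.coe_mul, LinearEquiv.mul_apply]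
  linarith

/-- The representation of `W` on `ℂ[ε₁, …, ε₅]`. -/
def polyRep : Representation ℂ W (MvPolynomial (Fin 5) ℂ) where
  toFun w := (polyAct w).toLinearMap
  map_one' := by
    have : polyAct 1 = AlgHom.id ℂ _ := by
      apply MvPolynomial.algHom_ext
      intro i
      have h : ∀ j, signedCoeff 1 i j = if i = j then 1 else 0 := by
        intro j
        change 1 - inter (hCls - eCls i) (hCls - eCls j) = _
        revert i j; decide
      simp [polyAct, h]
    rw [this]; rfl
  map_mul' u w := by
    have : polyAct (u * w) = (polyAct u).comp (polyAct w) := by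
      apply MvPolynomial.algHom_ext
      intro i
      simp only [polyAct, MvPolynomial.aeval_X, AlgHom.comp_apply, map_sum, map_zsmul,
        signedCoeff_mul, Finset.smul_sum, Finset.sum_smul, mul_smul]
      rw [Finset.sum_comm]
    rw [this]; rfl

/-- The product over the columns of `μ` of the Vandermonde products of the squares of the
variables in the column. -/
def columnProduct (μ : YoungDiagram) (x : μ.cells → MvPolynomial (Fin 5) ℂ) :
    MvPolynomial (Fin 5) ℂ :=
  ∏ c : μ.cells, ∏ d : μ.cells,
    if c.1.2 = d.1.2 ∧ c.1.1 < d.1.1 then x c ^ 2 - x d ^ 2 else 1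

/-- The Specht polynomial of a bitableau `T` of shape `(α, β)`. -/
def spechtPoly (α β : YoungDiagram) (T : α.cells ⊕ β.cells ≃ Fin 5) : MvPolynomial (Fin 5) ℂ :=
  columnProduct α (fun c => MvPolynomial.X (T (Sum.inl c))) *
    columnProduct β (fun c => MvPolynomial.X (T (Sum.inr c))) *
    ∏ c : β.cells, MvPolynomial.X (T (Sum.inr c))

/-- `w ∈ W` acts on the variables by a signed permutation. -/
lemma polyAct_X (w : W) : ∃ (σ : Equiv.Perm (Fin 5)) (s : Fin 5 → ℤˣ), ∀ i,
    polyRep w (MvPolynomial.X i) = s i • MvPolynomial.X (σ i) := by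
  obtain ⟨w, hw⟩ := w
  induction hw using Subgroup.closure_induction with
  | mem x hx =>
    obtain ⟨k, rfl⟩ := hx
    have gen : ∀ k : Fin 5, ∃ (σ : Equiv.Perm (Fin 5)) (s : Fin 5 → ℤˣ), ∀ i j,
        1 - inter ((hCls - eCls i) + inter (hCls - eCls i) (root k) • root k) (hCls - eCls j)
          = if σ i = j then (s i : ℤ) else 0 := by
      intro k
      refine ⟨![Equiv.swap 0 1, Equiv.swap 1 2, Equiv.swap 2 3, Equiv.swap 3 4,
        Equiv.swap 3 4] k, ![fun _ => 1, fun _ => 1, fun _ => 1, fun _ => 1,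
        ![1, 1, 1, -1, -1]] k, ?_⟩
      fin_cases k <;> decide
    obtain ⟨σ, s, h⟩ := gen k
    refine ⟨σ, s, fun i => ?_⟩
    have h' : ∀ j, signedCoeff ⟨reflect (root k) (inter_root k),
        Subgroup.subset_closure ⟨k, rfl⟩⟩ i j = if σ i = j then (s i : ℤ) else 0 := h i
    change MvPolynomial.aeval _ (MvPolynomial.X i) = _
    rw [MvPolynomial.aeval_X]
    simp only [h', ite_smul, zero_smul, Finset.sum_ite_eq, Finset.mem_univ, if_true]
    rfl
  | one =>
    refine ⟨1, 1, fun i => ?_⟩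
    change polyRep 1 _ = _
    rw [map_one]; simp
  | mul x y hx hy ihx ihy =>
    obtain ⟨σ, s, h⟩ := ihx
    obtain ⟨τ, t, h'⟩ := ihy
    refine ⟨σ * τ, fun i => t i * s (τ i), fun i => ?_⟩
    change polyRep ((⟨x, hx⟩ : W) * ⟨y, hy⟩) _ = _
    rw [map_mul, Module.End.mul_apply, h', Units.smul_def, map_zsmul, h, mul_smul]
    rfl
  | inv x hx ih =>
    obtain ⟨σ, s, h⟩ := ih
    refine ⟨σ⁻¹, fun i => s (σ⁻¹ i), fun i => ?_⟩
    change polyRep ((⟨x, hx⟩ : W)⁻¹) _ = _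
    have h1 := h (σ⁻¹ i)
    rw [← Equiv.Perm.mul_apply, mul_inv_cancel, Equiv.Perm.one_apply] at h1
    have h2 : (MvPolynomial.X i : MvPolynomial (Fin 5) ℂ) =
        s (σ⁻¹ i) • polyRep (⟨x, hx⟩ : W) (MvPolynomial.X (σ⁻¹ i)) := by
      rw [h1, smul_smul, Int.units_mul_self, one_smul]
    rw [h2, Units.smul_def, map_zsmul, ← Module.End.mul_apply, ← map_mul, inv_mul_cancel, map_one]
    rfl

lemma polyRep_columnProduct (w : W) (μ : YoungDiagram) (x y : μ.cells → MvPolynomial (Fin 5) ℂ)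
    (hxy : ∀ c, polyRep w (x c) ^ 2 = y c ^ 2) :
    polyRep w (columnProduct μ x) = columnProduct μ y := by
  change polyAct w _ = _
  change ∀ c, polyAct w (x c) ^ 2 = y c ^ 2 at hxy
  simp only [columnProduct, map_prod]
  refine Finset.prod_congr rfl fun c _ => Finset.prod_congr rfl fun d _ => ?_
  split_ifs
  · rw [map_sub, map_pow, map_pow, hxy, hxy]
  · exact map_one _

lemma polyRep_spechtPoly (w : W) (α β : YoungDiagram) (T : α.cells ⊕ β.cells ≃ Fin 5) :
    ∃ (T' : α.cells ⊕ β.cells ≃ Fin 5) (e : ℤˣ),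
      polyRep w (spechtPoly α β T) = e • spechtPoly α β T' := by
  obtain ⟨σ, s, h⟩ := polyAct_X w
  have hsq : ∀ i, polyRep w (MvPolynomial.X i) ^ 2 = (MvPolynomial.X (σ i)) ^ 2 := by
    intro i
    rw [h, Units.smul_def]
    rcases Int.units_eq_one_or (s i) with hs | hs <;> simp [hs]
  refine ⟨T.trans σ, ∏ c : β.cells, s (T (Sum.inr c)), ?_⟩
  have hα := polyRep_columnProduct w α (fun c => MvPolynomial.X (T (Sum.inl c)))
    (fun c => MvPolynomial.X ((T.trans σ) (Sum.inl c))) (fun c => hsq _)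
  have hβ := polyRep_columnProduct w β (fun c => MvPolynomial.X (T (Sum.inr c)))
    (fun c => MvPolynomial.X ((T.trans σ) (Sum.inr c))) (fun c => hsq _)
  have hX : polyRep w (∏ c : β.cells, MvPolynomial.X (T (Sum.inr c))) =
      (∏ c : β.cells, s (T (Sum.inr c))) •
        ∏ c : β.cells, MvPolynomial.X ((T.trans σ) (Sum.inr c)) := by
    change polyAct w _ = _
    rw [map_prod, Units.smul_def, zsmul_eq_mul]
    push_cast
    rw [← Finset.prod_mul_distrib]
    refine Finset.prod_congr rfl fun c _ => ?_
    rw [← zsmul_eq_mul]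
    exact h _
  change polyAct w _ = _ at hα hβ hX
  change polyAct w _ = _
  rw [spechtPoly, map_mul, map_mul, hα, hβ, hX, Units.smul_def, Units.smul_def, mul_smul_comm]
  rfl

/-- The span of the Specht polynomials of all bitableaux of shape `(α, β)`, as a `W`-module. -/
def spechtSub (α β : YoungDiagram) : Subrepresentation polyRep where
  toSubmodule := Submodule.span ℂ (Set.range (spechtPoly α β))
  apply_mem_toSubmodule w v hv := by
    induction hv using Submodule.span_induction with
    | mem x hx =>
      obtain ⟨T, rfl⟩ := hx
      obtain ⟨T', e, h⟩ := polyRep_spechtPoly w α β T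
      rw [h, Units.smul_def]
      exact zsmul_mem (Submodule.subset_span (Set.mem_range_self T')) _
    | zero => rw [map_zero]; exact zero_mem _
    | add x y _ _ hx hy => rw [map_add]; exact add_mem hx hy
    | smul c x _ hx => rw [map_smul]; exact Submodule.smul_mem _ c hx

/-- The `W(D₅)`-module `V_[α.β]` attached to a bipartition `(α, β)` of `5`. -/
def bipartRep (α β : YoungDiagram) : Representation ℂ W (spechtSub α β).toSubmodule :=
  (spechtSub α β).toRepresentation

/-- The Young diagram with given row lengths `r₀ ≥ r₁ ≥ …`. -/
abbrev yd (r : List ℕ) (hr : r.SortedGE := by decide) : YoungDiagram := YoungDiagram.ofRowLens r hr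

/-- Inside the representation `τ` of `W`, the subspace `S` is a subrepresentation which is
irreducible, of dimension `n`, and isomorphic to `V_[α.β]`. -/
def IsIrrep {M : Type*} [AddCommGroup M] [Module ℂ M] (τ : Representation ℂ W M)
    (S : Submodule ℂ M) (n : ℕ) (α β : YoungDiagram) : Prop :=
  ∃ σ : Subrepresentation τ, σ.toSubmodule = S ∧
    σ.toRepresentation.IsIrreducible ∧ Module.finrank ℂ S = n ∧
    Nonempty (σ.toRepresentation.Equiv (bipartRep α β))

/-! ### Rational forms on the surface and the web by conics

`X` is the blow-up of `ℙ²` at `p₁ = [1:0:0]`, `p₂ = [0:1:0]`, `p₃ = [0:0:1]`, `p₄ = [1:1:1]` and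
`p₅ = [a:b:1]`, and `x, y` are the affine coordinates `(x, y) ↦ [x:y:1]`. -/

/-- The field `ℂ(x, y)` of rational functions on the surface. -/
abbrev K : Type := FractionRing (MvPolynomial (Fin 2) ℂ)

def x : K := algebraMap (MvPolynomial (Fin 2) ℂ) K (MvPolynomial.X 0)

def y : K := algebraMap (MvPolynomial (Fin 2) ℂ) K (MvPolynomial.X 1)

/-- A complex number, as a constant function. -/
abbrev cst (c : ℂ) : K := algebraMap ℂ K c

/-- The space of rational `1`-forms on the surface. -/
abbrev Forms : Type := Ω[K⁄ℂ]

/-- The logarithmic form `df / f`. -/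
def dlog (f : K) : Forms := f⁻¹ • KaehlerDifferential.D ℂ K f

/-- The ten rational functions whose level sets are the ten pencils of conics. -/
def U (a b : ℂ) : Fin 10 → K :=
  ![x,
    1 / y,
    y / x,
    (x - y) / (x - 1),
    cst b * (cst a - x) / (cst a * y - cst b * x),
    ((1 - x) * cst b + x + (cst a - 1) * y - cst a) / ((x - 1) * (y - cst b)),
    (x - y) * (y - cst b) / (y * (cst a * y - cst b * x - cst a + cst b + x - y)),
    -x * (x * (cst b - 1) + (1 - y) * cst a - cst b + y) / ((x - y) * (x - cst a)),
    y * (x - cst a) / (x * (y - cst b)),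
    x * (y - 1) / (y * (x - 1))]

/-- The conic class `𝔠` of the pencil given by `U i`. -/
def conicCls : Fin 10 → Pic :=
  ![hCls - eCls 1, hCls - eCls 0, hCls - eCls 2, hCls - eCls 3, hCls - eCls 4,
    2 • hCls - eCls 0 - eCls 1 - eCls 3 - eCls 4,
    2 • hCls - eCls 0 - eCls 2 - eCls 3 - eCls 4,
    2 • hCls - eCls 1 - eCls 2 - eCls 3 - eCls 4,
    2 • hCls - eCls 0 - eCls 1 - eCls 2 - eCls 4,
    2 • hCls - eCls 0 - eCls 1 - eCls 2 - eCls 3]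

/-- The spectrum of `U i` (the values of its reducible fibres) is `{0, 1, r i, ∞}`. -/
def r (a b : ℂ) : Fin 10 → ℂ :=
  ![a, 1 / b, b / a, (a - b) / (a - 1), b * (a - 1) / (a - b), (b - a) / b, 1 / (1 - a), 1 - b,
    (a - 1) / (b - 1), a * (b - 1) / (b * (a - 1))]

/-- The logarithmic forms `d(U i - σ) / (U i - σ)` for `σ = 0, 1, r i`. -/
def η (a b : ℂ) (i : Fin 10) : Fin 3 → Forms :=
  ![dlog (U a b i), dlog (U a b i - 1), dlog (U a b i - cst (r a b i))]

/-- The space `H_i`: the pull-back under `U i` of the forms on `ℙ¹` with at most logarithmic poles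
on the spectrum. -/
def Hc (a b : ℂ) (i : Fin 10) : Submodule ℂ Forms := Submodule.span ℂ (Set.range (η a b i))

/-- The space `H = ∑ H_i`. -/
def H (a b : ℂ) : Submodule ℂ Forms := ⨆ i, Hc a b i

/-! ### Residues along the lines of the surface -/

/-- The classes of the sixteen lines of the surface. -/
def lineCls : Fin 16 → Pic :=
  ![eCls 0, eCls 1, eCls 2, eCls 3, eCls 4,
    hCls - eCls 0 - eCls 1, hCls - eCls 0 - eCls 2, hCls - eCls 0 - eCls 3, hCls - eCls 0 - eCls 4,
    hCls - eCls 1 - eCls 2, hCls - eCls 1 - eCls 3, hCls - eCls 1 - eCls 4,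
    hCls - eCls 2 - eCls 3, hCls - eCls 2 - eCls 4, hCls - eCls 3 - eCls 4,
    2 • hCls - eCls 0 - eCls 1 - eCls 2 - eCls 3 - eCls 4]

/-- Rational functions `t` and `u` that are local coordinates of the surface at the generic point
of each line `ℓ`, with `t = 0` the local equation of `ℓ`, and that generate `ℂ(x, y)`. In order: the
exceptional divisors over `p₁, …, p₅`, the strict transforms of the ten lines through two of these
points (beginning with the line at infinity, which joins `p₁` and `p₂`), and that of the conic
through all of them. -/
def lineCoord (a b : ℂ) : Fin 16 → Fin 2 → K :=
  ![![1 / x, y],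
    ![1 / y, x],
    ![x, y / x],
    ![x - 1, (y - 1) / (x - 1)],
    ![x - cst a, (y - cst b) / (x - cst a)],
    ![1 / x, y / x],
    ![y, x],
    ![y - 1, x],
    ![y - cst b, x],
    ![x, y],
    ![x - 1, y],
    ![x - cst a, y],
    ![x - y, x],
    ![cst b * x - cst a * y, x],
    ![cst b * (x - 1) - cst a * (y - 1) + y - x, x],
    ![cst b * ((x - y) * cst a + x * (y - 1)) - cst a * y * (x - 1), x]]

/-- The local ring of the surface at the generic point of the line `l`: the fractions
`P(t, u) / Q(t, u)` whose denominator `Q` is not divisible by `t`. -/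
def localRing (a b : ℂ) (l : Fin 16) : Set K :=
  {f | ∃ P Q : MvPolynomial (Fin 2) ℂ, ¬ MvPolynomial.X 0 ∣ Q ∧
    f = MvPolynomial.aeval (lineCoord a b l) P / MvPolynomial.aeval (lineCoord a b l) Q}

/-- The rational `1`-forms that are regular at the generic point of the line `l`. -/
def regularForms (a b : ℂ) (l : Fin 16) : Submodule ℂ Forms :=
  Submodule.span ℂ {ω | ∃ f ∈ localRing a b l, ∃ g ∈ localRing a b l,
    ω = f • KaehlerDifferential.D ℂ K g}

/-- The form `ω` has a logarithmic pole (or none) along the line `l`, with constant residue `c`: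
`ω = c dt/t + (a regular form)`. -/
def IsResidue (a b : ℂ) (l : Fin 16) (ω : Forms) (c : ℂ) : Prop :=
  ω - c • dlog (lineCoord a b l 0) ∈ regularForms a b l

/-- The action of `W` on `H` is induced, through the residues, by the permutation action of `W` on
the set of lines: `Res_{w ℓ} (w · ω) = Res_ℓ ω`. -/
def IsResidueAction (a b : ℂ) (ρ : Representation ℂ W (H a b)) : Prop :=
  ∀ (w : W) (l l' : Fin 16), (w : Pic ≃ₗ[ℤ] Pic) (lineCls l) = lineCls l' →
    ∀ (ω : H a b) (c : ℂ), IsResidue a b l ω c → IsResidue a b l' (ρ w ω) c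

/-! ### Symbolic hyperlogarithmic abelian relations -/

/-- The direct sum of the tensor powers `H_i^{⊗ν}` over the ten pencils of conics. -/
abbrev Symbols (a b : ℂ) (ν : ℕ) : Type := (i : Fin 10) → ⨂[ℂ]^ν (Hc a b i)

/-- The inclusion of `H_i^{⊗ν}` in `H^{⊗ν}`. -/
def incl (a b : ℂ) (ν : ℕ) (i : Fin 10) : ⨂[ℂ]^ν (Hc a b i) →ₗ[ℂ] ⨂[ℂ]^ν (H a b) :=
  PiTensorProduct.map fun _ => Submodule.inclusion (le_iSup (Hc a b) i)

/-- The map `(Ω_i)_i ↦ ∑ Ω_i`. -/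
def Φ (a b : ℂ) (ν : ℕ) : Symbols a b ν →ₗ[ℂ] ⨂[ℂ]^ν (H a b) :=
  ∑ i, incl a b ν i ∘ₗ LinearMap.proj i

/-- The space of symbolic hyperlogarithmic abelian relations of weight `ν`. -/
def HLogAR (a b : ℂ) (ν : ℕ) : Submodule ℂ (Symbols a b ν) := LinearMap.ker (Φ a b ν)

/-- The exchange of the two factors of a tensor of weight two. -/
def swap₂ (M : Type*) [AddCommGroup M] [Module ℂ M] : ⨂[ℂ]^2 M →ₗ[ℂ] ⨂[ℂ]^2 M :=
  (PiTensorProduct.reindex ℂ (fun _ => M) (Equiv.swap (0 : Fin 2) 1)).toLinearMap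

/-- Symmetric abelian relations of weight two. -/
def HLogARsym (a b : ℂ) : Submodule ℂ (Symbols a b 2) :=
  HLogAR a b 2 ⊓ ⨅ i, LinearMap.ker ((swap₂ (Hc a b i) - LinearMap.id) ∘ₗ LinearMap.proj i)

/-- Antisymmetric abelian relations of weight two. -/
def HLogARasym (a b : ℂ) : Submodule ℂ (Symbols a b 2) :=
  HLogAR a b 2 ⊓ ⨅ i, LinearMap.ker ((swap₂ (Hc a b i) + LinearMap.id) ∘ₗ LinearMap.proj i)

/-- The forms `η` as elements of `H_i`. -/
def ηH (a b : ℂ) (i : Fin 10) (s : Fin 3) : Hc a b i :=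
  ⟨η a b i s, Submodule.subset_span ⟨s, rfl⟩⟩

/-- The tuple `HLog³`, with components the antisymmetrised tensors
`dU_i / U_i ∧ dU_i / (U_i - 1) ∧ dU_i / (U_i - r_i)`. -/
def HLog3 (a b : ℂ) : Symbols a b 3 := fun i =>
  (1 / 6 : ℂ) • ∑ σ : Equiv.Perm (Fin 3),
    (Equiv.Perm.sign σ : ℤ) • PiTensorProduct.tprod ℂ (fun k => ηH a b i (σ k))

/-- The action of `W` on the tuples of symbols that is compatible with the action `ρ` on `H` and
with the permutation action on the conic classes: for `w 𝔠 = 𝔠'`, the `𝔠'`-component of `w • Ω` is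
the tensor `w · Ω_𝔠`, both being seen in `H^{⊗ν}`. -/
def IsBulletAction (a b : ℂ) (ν : ℕ) (ρ : Representation ℂ W (H a b))
    (τ : Representation ℂ W (Symbols a b ν)) : Prop :=
  ∀ (w : W) (i j : Fin 10), (w : Pic ≃ₗ[ℤ] Pic) (conicCls i) = conicCls j →
    ∀ Ω : Symbols a b ν,
      incl a b ν j (τ w Ω j) = PiTensorProduct.map (fun _ => ρ w) (incl a b ν i (Ω i))

end DP4

end

noncomputable section

namespace DP4

/-! ### Charts of the surface -/

/-! Residues turn the problem into combinatorics of sign vectors. In coordinates `(t, u)` along each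
line, every equation of an affine boundary curve is a power of `t` times a factor prime to `t`, so
its logarithmic derivative has an explicit integral residue (`isResidue_bdry`). The residue vectors
of `H` are exactly the `v` on the sixteen lines with `∑ v_ℓ [ℓ] = 0` in `Pic ⊗ ℂ`
(`resid_injective`, `sum_resid`, `exists_resid_eq`). This condition is stable under `W`, which gives
the action on `H`. Since `H_𝔠` is also described by residues and intersection numbers alone
(`mem_Hc_iff`), the action extends to tuples of symbols.

Next, `W` acts on the vectors `ε_i` by permutations with an even number of sign changes. The lines
are the sign vectors of product `-1`, and the conic classes are the vectors `±ε_d`. The Fourier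
coefficients of a residue vector in degrees 0 and 1 vanish, so a form is determined by coefficients
`χ_{jk}`, one for each pair of indices. On the space of the conic class `e ε_d`, the coefficients
with an index `d` vanish and those of complementary pairs in the remaining four indices differ by
the factor `-e` (`chi_conicDir`, `chi_partner`). A relation thus becomes a system of linear
equations on coordinates indexed by a conic class and a list of pairs. Adding the two classes `±ε_d`
leaves functions on the symmetric group `S₅`, one for each pattern of pairs (`model`). Covering
patterns give zero, and the others reduce to a single pattern in each case: an edge in weight 1, a
wedge or a double edge for the antisymmetric or symmetric part in weight 2, a triangle in weight 3.

The resulting function spaces are treated uniformly. Averaging over a set of left translations,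
after restriction by sign changes where needed, sends any function of the space to a multiple of one
fixed kernel `e`, and convolution with `e` is, up to a scalar, a projection onto the space. Hence
every non-zero stable subspace is the whole space, and the dimension is a trace
(`IsKernel.eq_of_stable`, `IsKernel.finrank_eq`). In weight 3 the function space is simply the line
of the sign character.

Thanks to this minimality, one explicit non-zero relation in each case shows that the model map is
onto (`IsModel.map_eq`). An equivariant map to polynomials, `permPoly`, that reaches one Specht
polynomial then identifies the module (`IsMinimal.nonempty_equiv`). In weight 3, `HLog³` itself
supplies the non-zero relation. -/

/-- Derivations of `ℂ(x, y)` with prescribed values on the coordinates. -/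
lemma exists_partial (i : Fin 2) : ∃ d : Derivation ℂ K K,
    d x = (if i = 0 then 1 else 0) ∧ d y = (if i = 1 then 1 else 0) := by
  -- A localization is formally étale, so the differentials of `K` are the base change of the free
  -- module on `dx, dy`. The coordinate forms composed with `d` are the partial derivatives.
  have : Algebra.FormallyEtale (MvPolynomial (Fin 2) ℂ) K :=
    Algebra.FormallyEtale.of_isLocalization (nonZeroDivisors (MvPolynomial (Fin 2) ℂ))
  let e := (KaehlerDifferential.tensorKaehlerEquivOfFormallyEtale ℂ (MvPolynomial (Fin 2) ℂ) K).symm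
  let B := (KaehlerDifferential.mvPolynomialBasis ℂ (Fin 2)).baseChange K
  have key : ∀ P : MvPolynomial (Fin 2) ℂ,
      e (KaehlerDifferential.D ℂ K (algebraMap _ K P)) = 1 ⊗ₜ KaehlerDifferential.D ℂ _ P :=
    KaehlerDifferential.tensorKaehlerEquivOfFormallyEtale_symm_D_algebraMap ℂ _ K
  have hB : ∀ j, B.coord i
      (e (KaehlerDifferential.D ℂ K (algebraMap (MvPolynomial (Fin 2) ℂ) K (MvPolynomial.X j)))) =
      if i = j then 1 else 0 := by
    intro j
    rw [key]
    simp only [B, Module.Basis.coord_apply, Module.Basis.baseChange_repr_tmul,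
      KaehlerDifferential.mvPolynomialBasis_repr_D_X]
    rw [Finsupp.single_apply]
    by_cases h : i = j <;> simp [h, eq_comm (a := j)]
  exact ⟨(B.coord i ∘ₗ e.toLinearMap).compDer (KaehlerDifferential.D ℂ K), hB 0, hB 1⟩

lemma derivation_aeval (v : Fin 2 → K) (d : Derivation ℂ K K) (P : MvPolynomial (Fin 2) ℂ) :
    d (MvPolynomial.aeval v P) =
      ∑ i, MvPolynomial.aeval v (MvPolynomial.pderiv i P) * d (v i) := by
  induction P using MvPolynomial.induction_on with
  | C c => simp
  | add p q hp hq => simp only [map_add, hp, hq, add_mul, Finset.sum_add_distrib]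
  | mul_X p j hp =>
    simp only [map_mul, Derivation.leibniz, hp, MvPolynomial.aeval_X, smul_eq_mul, map_add,
      add_mul, Finset.sum_add_distrib, Finset.mul_sum, MvPolynomial.pderiv_X]
    congr 1
    · fin_cases j <;> simp [Pi.single_apply]
    · exact Finset.sum_congr rfl fun i _ => by ring

/-- A pair of rational functions on which two derivations take the values of the partial
derivatives is algebraically independent. -/
lemma aeval_injective (v : Fin 2 → K) (d : Fin 2 → Derivation ℂ K K)
    (hd : ∀ i j, d i (v j) = if i = j then 1 else 0) :
    Function.Injective (MvPolynomial.aeval v : MvPolynomial (Fin 2) ℂ →ₐ[ℂ] K) := by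
  rw [injective_iff_map_eq_zero]
  -- Induction on a strict bound `n` for the degree: the partial derivatives of an algebraic
  -- relation are relations of smaller degree, hence zero, and in characteristic zero this leaves
  -- only a constant.
  have key : ∀ n : ℕ, ∀ P : MvPolynomial (Fin 2) ℂ, MvPolynomial.aeval v P = 0 →
      (∀ m : Fin 2 →₀ ℕ, n ≤ m.degree → P.coeff m = 0) → P = 0 := by
    intro n
    induction n with
    | zero => exact fun P _ h => MvPolynomial.ext _ _ fun m => by simpa using h m (Nat.zero_le _)
    | succ n ih =>
      intro P hP h
      have h1 : ∀ i, MvPolynomial.pderiv i P = 0 := by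
        intro i
        apply ih
        · have := derivation_aeval v (d i) P
          rw [hP, map_zero] at this
          simpa [hd] using this.symm
        · intro m hm
          rw [MvPolynomial.coeff_pderiv, h, zero_mul]
          rw [map_add, Finsupp.degree_single]; omega
      have h2 : P = MvPolynomial.C (P.coeff 0) := by
        ext m
        rw [MvPolynomial.coeff_C]
        split_ifs with h0
        · rw [h0]
        · obtain ⟨i, hi⟩ : ∃ i, m i ≠ 0 := by
            by_contra hc
            push Not at hc
            exact h0 (Finsupp.ext fun i => (hc i).symm)
          have h3 := congrArg (MvPolynomial.coeff (m - Finsupp.single i 1)) (h1 i)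
          rw [MvPolynomial.coeff_pderiv, MvPolynomial.coeff_zero] at h3
          have h4 : m - Finsupp.single i 1 + Finsupp.single i 1 = m := by
            ext j
            by_cases hj : i = j
            · subst hj; simp; omega
            · simp [hj]
          rw [h4] at h3
          refine (mul_eq_zero.1 h3).resolve_right ?_
          exact Nat.cast_add_one_ne_zero _
      rw [h2] at hP
      simp only [MvPolynomial.algHom_C] at hP
      rw [h2, (map_eq_zero_iff _ (algebraMap ℂ K).injective).1 hP, map_zero]
  intro P hP
  refine key (P.totalDegree + 1) P hP fun m hm => ?_
  by_contra hc
  have := MvPolynomial.le_totalDegree (MvPolynomial.mem_support_iff.2 hc)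
  rw [Finsupp.degree_eq_sum] at hm
  rw [Finsupp.sum_fintype _ _ (by simp)] at this
  omega

/-- The derivations dual to a pair of rational functions with nonzero Jacobian. -/
lemma exists_dual_derivations (t u : K)
    (h : ∀ d e : Derivation ℂ K K, d x = 1 → d y = 0 → e x = 0 → e y = 1 →
      d t * e u - d u * e t ≠ 0) :
    ∃ d : Fin 2 → Derivation ℂ K K,
      ∀ i j, d i (![t, u] j) = if i = j then 1 else 0 := by
  obtain ⟨d, hd⟩ := exists_partial 0
  obtain ⟨e, he⟩ := exists_partial 1
  have hJ := h d e (by simp [hd.1]) (by simp [hd.2]) (by simp [he.1]) (by simp [he.2])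
  set J := d t * e u - d u * e t with hJd
  -- Cramer's rule for the inverse of the Jacobian matrix.
  refine ⟨![J⁻¹ • (e u • d - d u • e), J⁻¹ • (d t • e - e t • d)], fun i j => ?_⟩
  fin_cases i <;> fin_cases j <;> simp
  · rw [inv_mul_eq_one₀ hJ, hJd]; ring
  · right; ring
  · right; ring
  · rw [inv_mul_eq_one₀ hJ, hJd]; ring

end DP4
end

noncomputable section

namespace DP4

/-! ### The affine boundary curves -/

/-- The homogeneous equations of the ten boundary curves that meet the affine plane: the nine
lines `y, y - 1, y - b, x, x - 1, x - a, x - y, b x - a y, (p₄ p₅)` and the conic, in the order of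
`lineCls`. -/
def curve {R : Type*} [CommRing R] (A B X Y Z : R) : Fin 10 → R :=
  ![Y, Y - Z, Y - B * Z, X, X - Z, X - A * Z, X - Y, B * X - A * Y,
    B * (X - Z) - A * (Y - Z) + Y - X, B * ((X - Y) * A * Z + X * (Y - Z)) - A * Y * (X - Z)]

/-- The degrees of the ten boundary curves. -/
def curveDeg : Fin 10 → ℕ := ![1, 1, 1, 1, 1, 1, 1, 1, 1, 2]

lemma map_curve {R S : Type*} [CommRing R] [CommRing S] (φ : R →+* S) (A B X Y Z : R)
    (k : Fin 10) : φ (curve A B X Y Z k) = curve (φ A) (φ B) (φ X) (φ Y) (φ Z) k := by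
  fin_cases k <;> simp [curve]

lemma curve_mul {R : Type*} [CommRing R] (A B X Y Z : R) (k : Fin 10) :
    curve A B (X * Z) (Y * Z) Z k = curve A B X Y 1 k * Z ^ curveDeg k := by
  fin_cases k <;> simp [curve, curveDeg] <;> ring

/-- The equations of the boundary curves as rational functions. -/
def bdry (a b : ℂ) (k : Fin 10) : K := curve (cst a) (cst b) x y 1 k

/-- Homogeneous coordinates of a point of the surface in terms of the coordinates `(t, u)` near
the line `l`. -/
def param (a b : ℂ) : Fin 16 → Fin 3 → MvPolynomial (Fin 2) ℂ :=
  let t := MvPolynomial.X 0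
  let u := MvPolynomial.X 1
  let A := MvPolynomial.C a
  let B := MvPolynomial.C b
  ![![1, t * u, t], ![t * u, 1, t], ![t, t * u, 1], ![1 + t, 1 + t * u, 1],
    ![A + t, B + t * u, 1], ![1, u, t], ![u, t, 1], ![u, t + 1, 1], ![u, t + B, 1],
    ![t, u, 1], ![t + 1, u, 1], ![t + A, u, 1], ![u, u - t, 1], ![A * u, B * u - t, A],
    ![(A - 1) * u, B * (u - 1) + A - u - t, A - 1],
    -- The conic passes through `[0:1:0]`, so its equation is linear in `y`; setting the equation
    -- equal to `t` and `x` equal to `u` determines `y` as a quotient.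
    ![u * ((B - A) * u + A - A * B), t - A * B * u + B * u, (B - A) * u + A - A * B]]

/-- The multiplicity of the `k`-th boundary curve at the blown-up point, or along the line, `l`. -/
def mult (l : Fin 16) (k : Fin 10) : ℕ :=
  -- The affine curve `k` is itself the line of index `k + 6`.
  if (l : ℕ) = k + 6 then 1 else
    ![![1, 1, 1, 0, 0, 0, 0, 0, 0, 1], ![0, 0, 0, 1, 1, 1, 0, 0, 0, 1],
      ![1, 0, 0, 1, 0, 0, 1, 1, 0, 1], ![0, 1, 0, 0, 1, 0, 1, 0, 1, 1],
      ![0, 0, 1, 0, 0, 1, 0, 1, 1, 1], 0, 0, 0, 0, 0, 0, 0, 0, 0, 0, 0] l k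

/-- The order of the third homogeneous coordinate along the line `l`. -/
def ordZ : Fin 16 → ℕ := ![1, 1, 0, 0, 0, 1, 0, 0, 0, 0, 0, 0, 0, 0, 0, 0]

/-- The third homogeneous coordinate divided by its power of `t`. -/
def leadZ (a b : ℂ) (l : Fin 16) : MvPolynomial (Fin 2) ℂ :=
  if ordZ l = 1 then 1 else param a b l 2

/-- The equations of the boundary curves that vanish along the line `l`, divided by `t`. -/
def curveQuot (a b : ℂ) (l : Fin 16) : Fin 10 → MvPolynomial (Fin 2) ℂ :=
  let t := MvPolynomial.X 0
  let u := MvPolynomial.X 1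
  let A := MvPolynomial.C a
  let B := MvPolynomial.C b
  ![![u, u - 1, u - B, 0, 0, 0, 0, 0, 0, A * B * (1 - t * u) + B * (u - 1) - A * u * (1 - t)],
    ![0, 0, 0, u, u - 1, u - A, 0, 0, 0, A * B * (t * u - 1) + B * u * (1 - t) - A * (u - 1)],
    ![u, 0, 0, 1, 0, 0, 1 - u, B - A * u, 0,
      A * B * (1 - u) + B * (t * u - 1) - A * u * (t - 1)],
    ![0, u, 0, 0, 1, 0, 1 - u, 0, B - A * u + u - 1,
      A * B * (1 - u) + B * (1 + t) * u - A * (1 + t * u)],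
    ![0, 0, u, 0, 0, 1, 0, B - A * u, B - A * u + u - 1,
      A * B * (1 - u) + B * (B + t * u - 1 + A * u) - A * (u * (A + t - 1) + B)],
    0, 1, 1, 1, 1, 1, 1, 1, fun _ => A, fun _ => A - 1,
    fun _ => ((B - A) * u + A - A * B) ^ 2] l

/-- The equation of the `k`-th boundary curve in the coordinates of the line `l`, divided by its
power of `t`. -/
def curveLead (a b : ℂ) (l : Fin 16) (k : Fin 10) : MvPolynomial (Fin 2) ℂ :=
  if mult l k = 1 then curveQuot a b l k else
    curve (MvPolynomial.C a) (MvPolynomial.C b) (param a b l 0) (param a b l 1) (param a b l 2) k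

/-- The second coordinate of a point of the line `l` off the other boundary curve `k`. -/
def witness (a : ℂ) : Fin 16 → Fin 10 → ℂ :=
  ![![1, 0, 0, 0, 0, 0, 0, 0, 0, 0], ![0, 0, 0, 1, 0, 0, 0, 0, 0, 0],
    ![1, 0, 0, 0, 0, 0, 0, 0, 0, 0], ![0, 1, 0, 0, 0, 0, 0, 0, 0, 0],
    ![0, 0, 1, 0, 0, 0, 0, 0, 0, 0], ![1, 1, 1, 0, 0, 0, 0, 0, 0, 1],
    ![0, 0, 0, 1, 0, 0, 1, 1, 0, 1], ![0, 0, 0, 1, 0, 0, 0, 0, 0, 0],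
    ![0, 0, 0, 1, 0, 0, 0, 0, 0, 0], ![1, 0, 0, 0, 0, 0, 1, 1, 0, 1],
    ![1, 0, 0, 0, 0, 0, 0, 0, 0, 0], ![1, 0, 0, 0, 0, 0, 0, 0, 0, 0],
    ![1, 0, 0, 1, 0, 0, 0, 1, 0, a], ![1, 0, 0, 1, 0, 0, 1, 0, 0, 1],
    ![0, 0, 0, 1, 0, 0, 0, 0, 0, 0], ![1, 0, 0, 1, 0, 0, a, 1, 0, 0]]

lemma param_two (a b : ℂ) (l : Fin 16) :
    param a b l 2 = MvPolynomial.X 0 ^ ordZ l * leadZ a b l := by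
  fin_cases l <;> simp [param, ordZ, leadZ]

/-- The exceptional divisors and the boundary curves themselves contribute factors `t`; the table
`curveQuot` lists the explicit quotients. That no further factor `t` can be split off is
`eval_curveLead`. -/
lemma curve_param (a b : ℂ) (l : Fin 16) (k : Fin 10) :
    curve (MvPolynomial.C a) (MvPolynomial.C b) (param a b l 0) (param a b l 1) (param a b l 2) k
      = MvPolynomial.X 0 ^ mult l k * curveLead a b l k := by
  unfold curveLead
  split_ifs with h
  · rw [h, pow_one]
    revert h
    fin_cases l <;> fin_cases k <;> intro h <;>
      first
      | (exfalso; revert h; decide)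
      | (simp [curve, param, curveQuot]; try ring)
  · have : mult l k = 0 := by
      revert h; revert l k; decide
    rw [this, pow_zero, one_mul]

lemma eval_leadZ {a b : ℂ} (hab : a * b * (a - 1) * (b - 1) * (a - b) ≠ 0) (l : Fin 16)
    (k : Fin 10) : MvPolynomial.eval ![0, witness a l k] (leadZ a b l) ≠ 0 := by
  simp only [mul_ne_zero_iff] at hab
  obtain ⟨⟨⟨⟨ha, hb⟩, ha1⟩, hb1⟩, hne⟩ := hab
  fin_cases l
  all_goals simp [leadZ, ordZ, param]
  · exact ha
  · exact ha1
  · fin_cases k <;> simp [witness] <;> grind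

-- A polynomial that is non-zero at some point with `t = 0` is not divisible by `t`, so `mult` is
-- the exact order of vanishing. The hypothesis of general position enters through the values at
-- these points.
set_option maxHeartbeats 8000000 in
lemma eval_curveLead {a b : ℂ} (hab : a * b * (a - 1) * (b - 1) * (a - b) ≠ 0) (l : Fin 16)
    (k : Fin 10) : MvPolynomial.eval ![0, witness a l k] (curveLead a b l k) ≠ 0 := by
  simp only [mul_ne_zero_iff] at hab
  obtain ⟨⟨⟨⟨ha, hb⟩, ha1⟩, hb1⟩, hne⟩ := hab
  fin_cases l <;> fin_cases k <;>
    simp [curveLead, mult, curveQuot, curve, param, witness] <;> grind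

end DP4
end

noncomputable section

namespace DP4

/-! ### Algebraic independence of the coordinates along each line. -/

lemma algebraMap_ne_zero (P : MvPolynomial (Fin 2) ℂ) (p : Fin 2 → ℂ)
    (h : MvPolynomial.eval p P ≠ 0) : algebraMap (MvPolynomial (Fin 2) ℂ) K P ≠ 0 := by
  rw [Ne, map_eq_zero_iff _ (IsFractionRing.injective (MvPolynomial (Fin 2) ℂ) K)]
  rintro rfl
  simp at h

lemma algebraMap_C (c : ℂ) : algebraMap (MvPolynomial (Fin 2) ℂ) K (MvPolynomial.C c) = cst c :=
  (IsScalarTower.algebraMap_apply ℂ (MvPolynomial (Fin 2) ℂ) K c).symm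

lemma cst_ne_zero {c : ℂ} (h : c ≠ 0) : cst c ≠ 0 := by
  rw [Ne, map_eq_zero_iff _ (algebraMap ℂ K).injective]; exact h

lemma x_ne_zero : x ≠ 0 := algebraMap_ne_zero _ 1 (by simp)

lemma y_ne_zero : y ≠ 0 := algebraMap_ne_zero _ 1 (by simp)

lemma x_sub_cst_ne_zero (c : ℂ) : x - cst c ≠ 0 := by
  rw [x, ← algebraMap_C, ← map_sub]
  exact algebraMap_ne_zero _ (fun _ => c + 1) (by simp)

lemma x_sub_one_ne_zero : x - 1 ≠ 0 := by simpa using x_sub_cst_ne_zero 1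

lemma linear_ne_zero (c d : ℂ) (h : c ≠ 0) : cst c * x + cst d ≠ 0 := by
  rw [x, ← algebraMap_C, ← algebraMap_C, ← map_mul, ← map_add]
  exact algebraMap_ne_zero _ (fun _ => (1 - d) / c) (by simp; field_simp; simp)

lemma conic_coeff_ne_zero {a b : ℂ} (hne : a - b ≠ 0) :
    (cst b - cst a) * x + cst a - cst a * cst b ≠ 0 := by
  have := linear_ne_zero (b - a) (a - a * b) (by rw [← neg_sub]; exact neg_ne_zero.2 hne)
  simpa [add_sub_assoc] using this

lemma exists_lineCoord_derivations {a b : ℂ} (hab : a * b * (a - 1) * (b - 1) * (a - b) ≠ 0)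
    (l : Fin 16) :
    ∃ d : Fin 2 → Derivation ℂ K K,
      ∀ i j, d i (lineCoord a b l j) = if i = j then 1 else 0 := by
  simp only [mul_ne_zero_iff] at hab
  obtain ⟨⟨⟨⟨ha, hb⟩, ha1⟩, hb1⟩, hne⟩ := hab
  have hx := x_ne_zero
  have hy := y_ne_zero
  have hx1 := x_sub_one_ne_zero
  have hxa := x_sub_cst_ne_zero a
  have ha' := cst_ne_zero ha
  have ha1' : -1 + cst a ≠ 0 := by
    have := cst_ne_zero ha1
    rwa [cst, map_sub, map_one, sub_eq_neg_add] at this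
  have hc := conic_coeff_ne_zero hne
  -- The sixteen Jacobians are computed one by one; only the conic leaves a factor that has to be
  -- rearranged into the one controlled by `conic_coeff_ne_zero`.
  have key : ∀ l, ∃ t u, lineCoord a b l = ![t, u] ∧
      ∀ d e : Derivation ℂ K K, d x = 1 → d y = 0 → e x = 0 → e y = 1 →
      d t * e u - d u * e t ≠ 0 := by
    intro l
    fin_cases l <;> refine ⟨_, _, rfl, fun d e h1 h2 h3 h4 => ?_⟩ <;>
      simp [h1, h2, h3, h4, Derivation.leibniz_div, Derivation.leibniz_inv] <;> try assumption
    intro h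
    apply hc
    linear_combination -h
  obtain ⟨t, u, h, hJ⟩ := key l
  rw [h]
  exact exists_dual_derivations t u hJ

lemma aeval_lineCoord_injective {a b : ℂ} (hab : a * b * (a - 1) * (b - 1) * (a - b) ≠ 0)
    (l : Fin 16) : Function.Injective
      (MvPolynomial.aeval (lineCoord a b l) : MvPolynomial (Fin 2) ℂ →ₐ[ℂ] K) :=
  let ⟨d, hd⟩ := exists_lineCoord_derivations hab l
  aeval_injective _ d hd

lemma not_X_dvd {P : MvPolynomial (Fin 2) ℂ} {z : ℂ} (h : MvPolynomial.eval ![0, z] P ≠ 0) :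
    ¬ MvPolynomial.X 0 ∣ P := by
  rintro ⟨Q, rfl⟩
  simp at h

lemma aeval_lineCoord_ne_zero {a b : ℂ} (hab : a * b * (a - 1) * (b - 1) * (a - b) ≠ 0)
    (l : Fin 16) {P : MvPolynomial (Fin 2) ℂ}
    (h : ¬ MvPolynomial.X 0 ∣ P) :
    MvPolynomial.aeval (lineCoord a b l) P ≠ 0 := by
  rw [Ne, map_eq_zero_iff _ (aeval_lineCoord_injective hab l)]
  rintro rfl
  exact h (dvd_zero _)

lemma lineCoord_zero_ne_zero {a b : ℂ} (hab : a * b * (a - 1) * (b - 1) * (a - b) ≠ 0)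
    (l : Fin 16) : lineCoord a b l 0 ≠ 0 := by
  have := (map_eq_zero_iff _ (aeval_lineCoord_injective hab l)).not.2
    (MvPolynomial.X_ne_zero (R := ℂ) (0 : Fin 2))
  rwa [MvPolynomial.aeval_X] at this

/-! ### Logarithmic derivatives -/

lemma dlog_mul {f g : K} (hf : f ≠ 0) (hg : g ≠ 0) : dlog (f * g) = dlog f + dlog g := by
  rw [dlog, dlog, dlog, Derivation.leibniz, smul_add, smul_smul, smul_smul, add_comm]
  congr 2 <;> field_simp

lemma dlog_cst (c : ℂ) : dlog (cst c) = 0 := by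
  rw [dlog, cst, Derivation.map_algebraMap, smul_zero]

lemma dlog_one : dlog 1 = 0 := by simp [dlog]

lemma dlog_pow {f : K} (hf : f ≠ 0) (n : ℕ) : dlog (f ^ n) = (n : ℤ) • dlog f := by
  induction n with
  | zero => simp [dlog_one]
  | succ n ih =>
    rw [pow_succ, dlog_mul (pow_ne_zero n hf) hf, ih, Nat.cast_succ, add_smul, one_smul]

lemma dlog_mem_regularForms {a b : ℂ} (l : Fin 16) {P : MvPolynomial (Fin 2) ℂ}
    (h : ¬ MvPolynomial.X 0 ∣ P) :
    dlog (MvPolynomial.aeval (lineCoord a b l) P) ∈ regularForms a b l := by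
  have h1 : ¬ MvPolynomial.X 0 ∣ (1 : MvPolynomial (Fin 2) ℂ) :=
    not_X_dvd (z := 0) (by simp)
  refine Submodule.subset_span ⟨_, ⟨1, P, h, ?_⟩, _, ⟨P, 1, h1, ?_⟩, rfl⟩ <;> simp

/-! ### Residues of the boundary curves -/

lemma aeval_param {a b : ℂ} (hab : a * b * (a - 1) * (b - 1) * (a - b) ≠ 0)
    (l : Fin 16) :
    MvPolynomial.aeval (lineCoord a b l) (param a b l 0) =
        x * MvPolynomial.aeval (lineCoord a b l) (param a b l 2) ∧
      MvPolynomial.aeval (lineCoord a b l) (param a b l 1) =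
        y * MvPolynomial.aeval (lineCoord a b l) (param a b l 2) := by
  simp only [mul_ne_zero_iff] at hab
  obtain ⟨⟨⟨⟨ha, hb⟩, ha1⟩, hb1⟩, hne⟩ := hab
  have hx := x_ne_zero
  have hy := y_ne_zero
  have hx1 := x_sub_one_ne_zero
  have hxa := x_sub_cst_ne_zero a
  fin_cases l <;> constructor <;> simp [param, lineCoord] <;> field_simp <;> try ring

/-- The order of the `k`-th boundary curve along the line `l`. -/
def bdryRes (l : Fin 16) (k : Fin 10) : ℤ := mult l k - ordZ l * curveDeg k

/-- Dehomogenization of `curve_param`: a form of degree `n` satisfies `F(xZ, yZ, Z) = F(x, y, 1) Z ^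
n`, and `Z` has its own order `ordZ` along the line. This accounts for the subtraction in `bdryRes`.
-/
lemma bdry_mul {a b : ℂ} (hab : a * b * (a - 1) * (b - 1) * (a - b) ≠ 0) (l : Fin 16)
    (k : Fin 10) :
    bdry a b k * (lineCoord a b l 0 ^ ordZ l *
        MvPolynomial.aeval (lineCoord a b l) (leadZ a b l)) ^ curveDeg k =
      lineCoord a b l 0 ^ mult l k * MvPolynomial.aeval (lineCoord a b l) (curveLead a b l k) := by
  have h := congrArg (MvPolynomial.aeval (lineCoord a b l)) (curve_param a b l k)
  have hp := aeval_param hab l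
  change (MvPolynomial.aeval (lineCoord a b l)).toRingHom _ = _ at h
  rw [map_curve] at h
  change curve (MvPolynomial.aeval (lineCoord a b l) (MvPolynomial.C a))
    (MvPolynomial.aeval (lineCoord a b l) (MvPolynomial.C b))
    (MvPolynomial.aeval (lineCoord a b l) (param a b l 0))
    (MvPolynomial.aeval (lineCoord a b l) (param a b l 1))
    (MvPolynomial.aeval (lineCoord a b l) (param a b l 2)) k = _ at h
  rw [hp.1, hp.2, curve_mul, MvPolynomial.aeval_C, MvPolynomial.aeval_C, param_two] at h
  simpa [bdry] using h

lemma bdry_ne_zero {a b : ℂ} (hab : a * b * (a - 1) * (b - 1) * (a - b) ≠ 0) (k : Fin 10) :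
    bdry a b k ≠ 0 := by
  intro h
  have h1 := bdry_mul hab 0 k
  rw [h, zero_mul] at h1
  exact mul_ne_zero (pow_ne_zero _ (lineCoord_zero_ne_zero hab 0))
    (aeval_lineCoord_ne_zero hab 0 (not_X_dvd (eval_curveLead hab 0 k))) h1.symm

lemma isResidue_bdry {a b : ℂ} (hab : a * b * (a - 1) * (b - 1) * (a - b) ≠ 0) (l : Fin 16)
    (k : Fin 10) : IsResidue a b l (dlog (bdry a b k)) (bdryRes l k) := by
  have h := congrArg dlog (bdry_mul hab l k)
  have ht := lineCoord_zero_ne_zero hab l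
  have hZ := aeval_lineCoord_ne_zero hab l (not_X_dvd (eval_leadZ hab l k))
  have hL := aeval_lineCoord_ne_zero hab l (not_X_dvd (eval_curveLead hab l k))
  have hp : ∀ n, lineCoord a b l 0 ^ n ≠ 0 := fun n => pow_ne_zero n ht
  rw [dlog_mul (bdry_ne_zero hab k) (pow_ne_zero _ (mul_ne_zero (hp _) hZ)),
    dlog_pow (mul_ne_zero (hp _) hZ), dlog_mul (hp _) hZ, dlog_mul (hp _) hL, dlog_pow ht,
    dlog_pow ht] at h
  have h2 : dlog (bdry a b k) - ((bdryRes l k : ℤ) : ℂ) • dlog (lineCoord a b l 0) =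
      dlog (MvPolynomial.aeval (lineCoord a b l) (curveLead a b l k)) -
        (curveDeg k : ℤ) • dlog (MvPolynomial.aeval (lineCoord a b l) (leadZ a b l)) := by
    rw [bdryRes, Int.cast_smul_eq_zsmul, sub_smul, mul_comm, mul_smul]
    rw [smul_add] at h
    rw [eq_sub_iff_add_eq.2 h]
    abel
  rw [IsResidue, h2]
  exact sub_mem (dlog_mem_regularForms l (not_X_dvd (eval_curveLead hab l k)))
    (zsmul_mem (dlog_mem_regularForms l (not_X_dvd (eval_leadZ hab l k))) _)

/-! ### Uniqueness of residues -/

/-- The dual derivations are the partial derivatives in `t` and `u`, and the quotient rule only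
squares the denominator, which stays prime to `t`. -/
lemma derivation_localRing {a b : ℂ} (hab : a * b * (a - 1) * (b - 1) * (a - b) ≠ 0) (l : Fin 16)
    (d : Fin 2 → Derivation ℂ K K)
    (hd : ∀ i j, d i (lineCoord a b l j) = if i = j then 1 else 0) (i : Fin 2) {f : K}
    (hf : f ∈ localRing a b l) : d i f ∈ localRing a b l := by
  obtain ⟨P, Q, hQ, rfl⟩ := hf
  have hX : Prime (MvPolynomial.X 0 : MvPolynomial (Fin 2) ℂ) := MvPolynomial.X_prime
  refine ⟨MvPolynomial.pderiv i P * Q - P * MvPolynomial.pderiv i Q, Q ^ 2,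
    fun h => hQ (hX.dvd_of_dvd_pow h), ?_⟩
  have h0 := aeval_lineCoord_ne_zero hab l hQ
  have h1 : ∀ R : MvPolynomial (Fin 2) ℂ, d i (MvPolynomial.aeval (lineCoord a b l) R) =
      MvPolynomial.aeval (lineCoord a b l) (MvPolynomial.pderiv i R) := by
    intro R
    rw [derivation_aeval]
    simp [hd]
  rw [Derivation.leibniz_div, h1, h1]
  simp only [map_sub, map_mul, map_pow, smul_eq_mul]
  field_simp

lemma localRing_mul {a b : ℂ} (l : Fin 16) {f g : K} (hf : f ∈ localRing a b l)
    (hg : g ∈ localRing a b l) : f * g ∈ localRing a b l := by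
  obtain ⟨P, Q, hQ, rfl⟩ := hf
  obtain ⟨R, S, hS, rfl⟩ := hg
  refine ⟨P * R, Q * S, fun h => ?_, by simp only [map_mul]; rw [div_mul_div_comm]⟩
  exact ((MvPolynomial.X_prime).dvd_or_dvd h).elim hQ hS

lemma localRing_add {a b : ℂ} (hab : a * b * (a - 1) * (b - 1) * (a - b) ≠ 0) (l : Fin 16)
    {f g : K} (hf : f ∈ localRing a b l) (hg : g ∈ localRing a b l) :
    f + g ∈ localRing a b l := by
  obtain ⟨P, Q, hQ, rfl⟩ := hf
  obtain ⟨R, S, hS, rfl⟩ := hg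
  refine ⟨P * S + Q * R, Q * S, fun h => ?_, ?_⟩
  · exact ((MvPolynomial.X_prime).dvd_or_dvd h).elim hQ hS
  · have h0 := aeval_lineCoord_ne_zero hab l hQ
    have h1 := aeval_lineCoord_ne_zero hab l hS
    simp only [map_add, map_mul]
    rw [div_add_div _ _ h0 h1]

lemma cst_mem_localRing {a b : ℂ} (l : Fin 16) (c : ℂ) : cst c ∈ localRing a b l :=
  ⟨MvPolynomial.C c, 1, not_X_dvd (z := 0) (by simp), by simp⟩

/-- Contraction with `∂/∂t` maps regular forms into the local ring and `c dt/t` to `c/t`. An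
equality `c/t = P/Q` reads `c Q = t P`, so `t` would divide `Q` if `c` were non-zero. -/
lemma eq_zero_of_smul_dlog_mem {a b : ℂ} (hab : a * b * (a - 1) * (b - 1) * (a - b) ≠ 0)
    (l : Fin 16) {c : ℂ} (h : c • dlog (lineCoord a b l 0) ∈ regularForms a b l) : c = 0 := by
  obtain ⟨d, hd⟩ := exists_lineCoord_derivations hab l
  have key : ∀ ω ∈ regularForms a b l, (d 0).liftKaehlerDifferential ω ∈ localRing a b l := by
    intro ω hω
    induction hω using Submodule.span_induction with
    | mem ω h =>
      obtain ⟨f, hf, g, hg, rfl⟩ := h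
      rw [map_smul, Derivation.liftKaehlerDifferential_comp_D, smul_eq_mul]
      exact localRing_mul l hf (derivation_localRing hab l d hd 0 hg)
    | zero => simpa using cst_mem_localRing (a := a) (b := b) l 0
    | add _ _ _ _ h1 h2 => rw [map_add]; exact localRing_add hab l h1 h2
    | smul c _ _ h =>
      rw [← algebraMap_smul K c, map_smul, smul_eq_mul]
      exact localRing_mul l (cst_mem_localRing l c) h
  obtain ⟨P, Q, hQ, hPQ⟩ := key _ h
  have ht := lineCoord_zero_ne_zero hab l
  have h0 := aeval_lineCoord_ne_zero hab l hQ
  rw [← algebraMap_smul K c, map_smul, dlog, map_smul,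
    Derivation.liftKaehlerDifferential_comp_D, hd] at hPQ
  simp only [if_true, smul_eq_mul, mul_one] at hPQ
  rw [eq_div_iff h0] at hPQ
  have h1 : MvPolynomial.C c * Q = MvPolynomial.X 0 * P := by
    apply aeval_lineCoord_injective hab l
    simp only [map_mul, MvPolynomial.aeval_X, MvPolynomial.algHom_C]
    rw [← hPQ]
    field_simp
  by_contra hc
  apply hQ
  refine ⟨MvPolynomial.C c⁻¹ * P, ?_⟩
  rw [mul_left_comm, ← h1, ← mul_assoc, ← MvPolynomial.C_mul, inv_mul_cancel₀ hc,
    MvPolynomial.C_1, one_mul]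

lemma IsResidue.add {a b : ℂ} {l : Fin 16} {ω ω' : Forms} {c c' : ℂ} (h : IsResidue a b l ω c)
    (h' : IsResidue a b l ω' c') : IsResidue a b l (ω + ω') (c + c') := by
  have := add_mem h h'
  rw [IsResidue, add_smul]
  convert this using 1
  abel

lemma IsResidue.smul {a b : ℂ} {l : Fin 16} {ω : Forms} {c : ℂ} (h : IsResidue a b l ω c)
    (e : ℂ) : IsResidue a b l (e • ω) (e * c) := by
  rw [IsResidue, mul_smul, ← smul_sub]
  exact Submodule.smul_mem _ e h

lemma IsResidue.zero (a b : ℂ) (l : Fin 16) : IsResidue a b l 0 0 := by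
  rw [IsResidue, zero_smul, sub_zero]
  exact zero_mem _

lemma IsResidue.sum {a b : ℂ} {l : Fin 16} {ι : Type*} (s : Finset ι) {ω : ι → Forms} {c : ι → ℂ}
    (h : ∀ i ∈ s, IsResidue a b l (ω i) (c i)) :
    IsResidue a b l (∑ i ∈ s, ω i) (∑ i ∈ s, c i) := by
  classical
  induction s using Finset.induction_on with
  | empty => exact IsResidue.zero a b l
  | insert i s hi ih =>
    rw [Finset.sum_insert hi, Finset.sum_insert hi]
    exact (h i (Finset.mem_insert_self i s)).add
      (ih fun j hj => h j (Finset.mem_insert_of_mem hj))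

lemma IsResidue.unique {a b : ℂ} (hab : a * b * (a - 1) * (b - 1) * (a - b) ≠ 0) {l : Fin 16}
    {ω : Forms} {c c' : ℂ} (h : IsResidue a b l ω c) (h' : IsResidue a b l ω c') : c = c' := by
  have := sub_mem h' h
  rw [sub_sub_sub_cancel_left, ← sub_smul] at this
  exact sub_eq_zero.1 (eq_zero_of_smul_dlog_mem hab l this)

end DP4
end

noncomputable section

namespace DP4

/-! ### The logarithmic forms in terms of the boundary curves -/

/-- The two lines in the reducible fibres of the pencil `i` over `0, 1, r i, ∞`. -/
def fib : Fin 10 → Fin 4 → Fin 2 → Fin 16 :=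
  ![![![2, 9], ![3, 10], ![4, 11], ![0, 5]], ![![1, 5], ![3, 7], ![4, 8], ![2, 6]],
    ![![0, 6], ![3, 12], ![4, 13], ![1, 9]], ![![2, 12], ![0, 7], ![4, 14], ![1, 10]],
    ![![1, 11], ![0, 8], ![3, 14], ![2, 13]], ![![5, 14], ![7, 11], ![2, 15], ![8, 10]],
    ![![8, 12], ![7, 13], ![1, 15], ![6, 14]], ![![9, 14], ![10, 13], ![0, 15], ![11, 12]],
    ![![6, 11], ![5, 13], ![3, 15], ![8, 9]], ![![7, 9], ![5, 12], ![4, 15], ![6, 10]]]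

/-- The multiplicity of the line `l` in the `s`-th reducible fibre of the pencil `i`. -/
def fibMult (i : Fin 10) (s : Fin 4) (l : Fin 16) : ℕ :=
  if l = fib i s 0 ∨ l = fib i s 1 then 1 else 0

/-- The residues along the lines of the form `η i s`. -/
def fibRes (i : Fin 10) (s : Fin 3) (l : Fin 16) : ℤ :=
  fibMult i s.castSucc l - fibMult i 3 l

/-- The line that is the `k`-th affine boundary curve. -/
def bdryLine (k : Fin 10) : Fin 16 := Fin.natAdd 6 k

/-- The equation of the line `l` in the affine plane (`1` for the lines that do not meet it). -/
def lineEq (a b : ℂ) : Fin 16 → K :=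
  ![1, 1, 1, 1, 1, 1, y, y - 1, y - cst b, x, x - 1, x - cst a, x - y, cst b * x - cst a * y,
    cst b * (x - 1) - cst a * (y - 1) + y - x,
    cst b * ((x - y) * cst a + x * (y - 1)) - cst a * y * (x - 1)]

/-- The divisor of `U i - σ` is the fibre over `σ` minus the fibre over `∞`, so in the affine plane
it is a constant, recorded in `c`, times a quotient of the equations of the lines in these fibres.
An abstract field makes this a plain identity in four letters. -/
lemma U_sub_mul_aux {F : Type*} [Field F] (A B X Y : F) (hA : A ≠ 0) (hB : B ≠ 0)
    (hA1 : A - 1 ≠ 0) (hB1 : B - 1 ≠ 0) (hAB : A - B ≠ 0) (h0 : Y ≠ 0) (h2 : Y - B ≠ 0)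
    (h3 : X ≠ 0) (h4 : X - 1 ≠ 0) (h5 : X - A ≠ 0) (h6 : X - Y ≠ 0) (h7 : B * X - A * Y ≠ 0)
    (h8 : B * (X - 1) - A * (Y - 1) + Y - X ≠ 0) (i : Fin 10) (s : Fin 3) :
    let e : Fin 16 → F := ![1, 1, 1, 1, 1, 1, Y, Y - 1, Y - B, X, X - 1, X - A, X - Y,
      B * X - A * Y, B * (X - 1) - A * (Y - 1) + Y - X,
      B * ((X - Y) * A + X * (Y - 1)) - A * Y * (X - 1)]
    let u : Fin 10 → F := ![X, 1 / Y, Y / X, (X - Y) / (X - 1), B * (A - X) / (A * Y - B * X),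
      ((1 - X) * B + X + (A - 1) * Y - A) / ((X - 1) * (Y - B)),
      (X - Y) * (Y - B) / (Y * (A * Y - B * X - A + B + X - Y)),
      -X * (X * (B - 1) + (1 - Y) * A - B + Y) / ((X - Y) * (X - A)),
      Y * (X - A) / (X * (Y - B)), X * (Y - 1) / (Y * (X - 1))]
    let c : Fin 10 → Fin 3 → F := ![![1, 1, 1], ![1, -1, -1 / B], ![1, -1, -1 / A],
      ![1, -1, 1 / (A - 1)], ![B, A, A * B / (B - A)], ![-1, -1, -1 / B], ![-1, -1, 1 / (A - 1)],
      ![-1, -1, -1], ![1, 1, 1 / (B - 1)], ![1, -1, -1 / (B * (A - 1))]]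
    let ρ : Fin 10 → F := ![A, 1 / B, B / A, (A - B) / (A - 1), B * (A - 1) / (A - B), (B - A) / B,
      1 / (1 - A), 1 - B, (A - 1) / (B - 1), A * (B - 1) / (B * (A - 1))]
    (u i - ![0, 1, ρ i] s) * (e (fib i 3 0) * e (fib i 3 1)) =
      c i s * (e (fib i s.castSucc 0) * e (fib i s.castSucc 1)) := by
  have h7' : A * Y - B * X ≠ 0 := by rw [← neg_sub]; exact neg_ne_zero.2 h7
  -- The equation of the line through `p₄` and `p₅` is kept opaque, because up to sign it is a
  -- denominator of the seventh function.
  obtain ⟨D, hD⟩ : ∃ D, D = B * (X - 1) - A * (Y - 1) + Y - X := ⟨_, rfl⟩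
  have hD' : A * Y - B * X - A + B + X - Y = -D := by rw [hD]; ring
  rw [← hD] at h8
  have hA1' : 1 - A ≠ 0 := by rw [← neg_sub]; exact neg_ne_zero.2 hA1
  have hAB' : B - A ≠ 0 := by rw [← neg_sub]; exact neg_ne_zero.2 hAB
  intro e u c ρ
  fin_cases i <;> fin_cases s <;> simp only [e, u, c, ρ, fib, Fin.zero_eta, Fin.mk_one,
    Fin.reduceFinMk, Fin.castSucc_zero, Fin.castSucc_one, Fin.reduceCastSucc, Matrix.cons_val, hD',
    ← hD] <;>
    field_simp <;> (try rw [hD]) <;> ring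

lemma U_sub_mul {a b : ℂ} (hab : a * b * (a - 1) * (b - 1) * (a - b) ≠ 0) (i : Fin 10)
    (s : Fin 3) : ∃ c : ℂ, c ≠ 0 ∧ (U a b i - cst (![0, 1, r a b i] s)) *
        (lineEq a b (fib i 3 0) * lineEq a b (fib i 3 1)) =
      cst c * (lineEq a b (fib i s.castSucc 0) * lineEq a b (fib i s.castSucc 1)) := by
  have hk := bdry_ne_zero hab
  simp only [mul_ne_zero_iff] at hab
  obtain ⟨⟨⟨⟨ha, hb⟩, ha1⟩, hb1⟩, hne⟩ := hab
  have key := U_sub_mul_aux (cst a) (cst b) x y (cst_ne_zero ha) (cst_ne_zero hb)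
    (by simpa using cst_ne_zero ha1) (by simpa using cst_ne_zero hb1)
    (by simpa using cst_ne_zero hne) (hk 0) (by simpa [bdry, curve] using hk 2) (hk 3) (hk 4)
    (by simpa [bdry, curve] using hk 5) (hk 6) (hk 7) (hk 8) i s
  refine ⟨(![![1, 1, 1], ![1, -1, -1 / b], ![1, -1, -1 / a], ![1, -1, 1 / (a - 1)],
    ![b, a, a * b / (b - a)], ![-1, -1, -1 / b], ![-1, -1, 1 / (a - 1)], ![-1, -1, -1],
    ![1, 1, 1 / (b - 1)], ![1, -1, -1 / (b * (a - 1))]] : Fin 10 → Fin 3 → ℂ) i s, ?_, ?_⟩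
  · have hne2 : b - a ≠ 0 := by rw [← neg_sub]; exact neg_ne_zero.2 hne
    fin_cases i <;> fin_cases s <;> simp [ha, hb, ha1, hb1, hne2]
  · refine (congrArg (fun z => (U a b i - z) * (lineEq a b (fib i 3 0) * lineEq a b (fib i 3 1)))
      ?_).trans (key.trans (congrArg (fun z => z * (lineEq a b (fib i s.castSucc 0) *
        lineEq a b (fib i s.castSucc 1))) ?_))
    · fin_cases s
      · simp
      · simp
      · fin_cases i <;> simp [r]
    · fin_cases i <;> fin_cases s <;> simp

end DP4
end

noncomputable section

namespace DP4

/-! ### Residues of the forms of the web. -/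

lemma lineEq_bdryLine (a b : ℂ) (k : Fin 10) : lineEq a b (bdryLine k) = bdry a b k := by
  fin_cases k <;> simp [bdry, curve, lineEq, bdryLine]

lemma lineEq_castAdd (a b : ℂ) (j : Fin 6) : lineEq a b (Fin.castAdd 10 j) = 1 := by
  fin_cases j <;> rfl

lemma lineEq_ne_zero {a b : ℂ} (hab : a * b * (a - 1) * (b - 1) * (a - b) ≠ 0) (l : Fin 16) :
    lineEq a b l ≠ 0 := by
  refine Fin.addCases (m := 6) (n := 10) (fun j => ?_) (fun k => ?_) l
  · rw [lineEq_castAdd]; exact one_ne_zero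
  · exact (lineEq_bdryLine a b k).trans_ne (bdry_ne_zero hab k)

lemma η_eq_dlog (a b : ℂ) (i : Fin 10) (s : Fin 3) :
    η a b i s = dlog (U a b i - cst (![0, 1, r a b i] s)) := by
  fin_cases s <;> simp [η]

lemma η_eq {a b : ℂ} (hab : a * b * (a - 1) * (b - 1) * (a - b) ≠ 0) (i : Fin 10) (s : Fin 3) :
    η a b i s = dlog (lineEq a b (fib i s.castSucc 0)) + dlog (lineEq a b (fib i s.castSucc 1)) -
      (dlog (lineEq a b (fib i 3 0)) + dlog (lineEq a b (fib i 3 1))) := by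
  obtain ⟨c, hc, h⟩ := U_sub_mul hab i s
  have hl := lineEq_ne_zero hab
  have hU : U a b i - cst (![0, 1, r a b i] s) ≠ 0 := by
    intro h0
    rw [h0, zero_mul] at h
    exact mul_ne_zero (cst_ne_zero hc) (mul_ne_zero (hl _) (hl _)) h.symm
  have h2 := congrArg dlog h
  rw [dlog_mul hU (mul_ne_zero (hl _) (hl _)), dlog_mul (cst_ne_zero hc)
    (mul_ne_zero (hl _) (hl _)), dlog_mul (hl _) (hl _), dlog_mul (hl _) (hl _), dlog_cst,
    zero_add] at h2
  rw [η_eq_dlog, ← h2, add_sub_cancel_right]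

/-- The order of the equation of the line `m` along the line `l`. -/
def lineRes (m l : Fin 16) : ℤ :=
  Fin.addCases (m := 6) (n := 10) (fun _ => 0) (fun k => bdryRes l k) m

lemma isResidue_lineEq {a b : ℂ} (hab : a * b * (a - 1) * (b - 1) * (a - b) ≠ 0)
    (m l : Fin 16) : IsResidue a b l (dlog (lineEq a b m)) (lineRes m l) := by
  refine Fin.addCases (m := 6) (n := 10) (fun j => ?_) (fun k => ?_) m
  · rw [lineEq_castAdd, dlog_one, lineRes, Fin.addCases_left, Int.cast_zero]
    exact IsResidue.zero a b l
  · rw [lineRes, Fin.addCases_right]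
    exact (lineEq_bdryLine a b k) ▸ isResidue_bdry hab l k

/-- The affine equations also have zeros and poles along the exceptional divisors and the line at
infinity. In the difference of two fibres these contributions cancel except along the components of
the fibres. -/
lemma lineRes_fib : ∀ i s l, lineRes (fib i (Fin.castSucc s) 0) l +
    lineRes (fib i (Fin.castSucc s) 1) l - (lineRes (fib i 3 0) l + lineRes (fib i 3 1) l) =
    fibRes i s l := by
  decide +kernel

lemma isResidue_η {a b : ℂ} (hab : a * b * (a - 1) * (b - 1) * (a - b) ≠ 0) (i : Fin 10)
    (s : Fin 3) (l : Fin 16) : IsResidue a b l (η a b i s) (fibRes i s l) := by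
  rw [η_eq hab, ← lineRes_fib]
  have h := fun m => isResidue_lineEq hab m l
  have := ((h (fib i s.castSucc 0)).add (h (fib i s.castSucc 1))).add
    (((h (fib i 3 0)).add (h (fib i 3 1))).smul (-1))
  convert this using 1
  · rw [neg_smul, one_smul, sub_eq_add_neg]
  · push_cast; ring

/-! ### The residue map -/

lemma H_eq_span (a b : ℂ) : H a b = Submodule.span ℂ (Set.range fun p : Fin 10 × Fin 3 =>
    η a b p.1 p.2) := by
  rw [H]
  simp only [Hc, ← Submodule.span_iUnion]
  congr 1
  ext ω
  simp

lemma η_mem_H (a b : ℂ) (i : Fin 10) (s : Fin 3) : η a b i s ∈ H a b := by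
  rw [H_eq_span]
  exact Submodule.subset_span ⟨(i, s), rfl⟩

lemma existsUnique_isResidue {a b : ℂ} (hab : a * b * (a - 1) * (b - 1) * (a - b) ≠ 0)
    (ω : H a b) (l : Fin 16) : ∃! c : ℂ, IsResidue a b l ω c := by
  obtain ⟨ω, hω⟩ := ω
  refine existsUnique_of_exists_of_unique ?_ fun c c' => IsResidue.unique hab
  change ∃ c, IsResidue a b l ω c
  have hω' := hω
  clear hω
  rw [H_eq_span] at hω'
  induction hω' using Submodule.span_induction with
  | mem ω h => obtain ⟨p, rfl⟩ := h; exact ⟨_, isResidue_η hab p.1 p.2 l⟩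
  | zero => exact ⟨0, IsResidue.zero a b l⟩
  | add _ _ _ _ h1 h2 =>
    obtain ⟨c, hc⟩ := h1
    obtain ⟨d, hd⟩ := h2
    exact ⟨_, hc.add hd⟩
  | smul e _ _ h =>
    obtain ⟨c, hc⟩ := h
    exact ⟨_, hc.smul e⟩

/-- The vector of the residues of a form along the sixteen lines. -/
def resid {a b : ℂ} (hab : a * b * (a - 1) * (b - 1) * (a - b) ≠ 0) :
    H a b →ₗ[ℂ] Fin 16 → ℂ where
  toFun ω l := (existsUnique_isResidue hab ω l).choose
  map_add' ω ω' := funext fun l => ((existsUnique_isResidue hab _ l).choose_spec.2 _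
    ((existsUnique_isResidue hab ω l).choose_spec.1.add
      (existsUnique_isResidue hab ω' l).choose_spec.1)).symm
  map_smul' c ω := funext fun l => ((existsUnique_isResidue hab _ l).choose_spec.2 _
    ((existsUnique_isResidue hab ω l).choose_spec.1.smul c)).symm

variable {a b : ℂ} (hab : a * b * (a - 1) * (b - 1) * (a - b) ≠ 0)

lemma isResidue_resid (ω : H a b) (l : Fin 16) : IsResidue a b l ω (resid hab ω l) :=
  (existsUnique_isResidue hab ω l).choose_spec.1

lemma isResidue_iff (ω : H a b) (l : Fin 16) (c : ℂ) :
    IsResidue a b l ω c ↔ resid hab ω l = c :=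
  ⟨fun h => (isResidue_resid hab ω l).unique hab h, fun h => h ▸ isResidue_resid hab ω l⟩

lemma resid_η (i : Fin 10) (s : Fin 3) (l : Fin 16) (h : η a b i s ∈ H a b) :
    resid hab ⟨η a b i s, h⟩ l = fibRes i s l :=
  (isResidue_iff hab _ l _).1 (isResidue_η hab i s l)

lemma H_le_span_bdry {a b : ℂ} (hab : a * b * (a - 1) * (b - 1) * (a - b) ≠ 0) :
    H a b ≤ Submodule.span ℂ (Set.range fun k => dlog (bdry a b k)) := by
  rw [H_eq_span, Submodule.span_le]
  rintro _ ⟨⟨i, s⟩, rfl⟩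
  have h : ∀ l, dlog (lineEq a b l) ∈ Submodule.span ℂ (Set.range fun k => dlog (bdry a b k)) := by
    intro l
    refine Fin.addCases (m := 6) (n := 10) (fun j => ?_) (fun k => ?_) l
    · rw [lineEq_castAdd, dlog_one]; exact zero_mem _
    · exact (lineEq_bdryLine a b k) ▸ Submodule.subset_span ⟨k, rfl⟩
  change η a b i s ∈ _
  rw [η_eq hab]
  exact sub_mem (add_mem (h _) (h _)) (add_mem (h _) (h _))

/-- With `H_le_span_bdry`, this makes `H` the span of the ten boundary forms. They are solved for
successively from the `η`, the six lines with equation `1` contributing nothing. -/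
lemma dlog_bdry_mem_H {a b : ℂ} (hab : a * b * (a - 1) * (b - 1) * (a - b) ≠ 0) (k : Fin 10) :
    dlog (bdry a b k) ∈ H a b := by
  have h := η_mem_H a b
  obtain ⟨g, hg⟩ : ∃ g : Fin 16 → Forms, ∀ l, g l = dlog (lineEq a b l) := ⟨_, fun _ => rfl⟩
  have e : ∀ i s, η a b i s = g (fib i s.castSucc 0) + g (fib i s.castSucc 1) -
      (g (fib i 3 0) + g (fib i 3 1)) := fun i s => by simp only [hg, η_eq hab]
  have z : ∀ l : Fin 6, g (Fin.castAdd 10 l) = 0 := fun l => by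
    rw [hg, lineEq_castAdd, dlog_one]
  have z0 : g 0 = 0 := z 0
  have z1 : g 1 = 0 := z 1
  have z2 : g 2 = 0 := z 2
  have z3 : g 3 = 0 := z 3
  have z4 : g 4 = 0 := z 4
  have z5 : g 5 = 0 := z 5
  have g9 : g 9 ∈ H a b := by simpa [e, fib, z0, z2, z5] using h 0 0
  have g10 : g 10 ∈ H a b := by simpa [e, fib, z0, z3, z5] using h 0 1
  have g11 : g 11 ∈ H a b := by simpa [e, fib, z0, z4, z5] using h 0 2
  have g6 : g 6 ∈ H a b := by simpa [e, fib, z1, z5, z2] using h 1 0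
  have g7 : g 7 ∈ H a b := by simpa [e, fib, z3, z2] using add_mem (h 1 1) g6
  have g8 : g 8 ∈ H a b := by simpa [e, fib, z4, z2] using add_mem (h 1 2) g6
  have g12 : g 12 ∈ H a b := by simpa [e, fib, z3, z1] using add_mem (h 2 1) g9
  have g13 : g 13 ∈ H a b := by simpa [e, fib, z4, z1] using add_mem (h 2 2) g9
  have g14 : g 14 ∈ H a b := by simpa [e, fib, z4, z1] using add_mem (h 3 2) g10
  have g15 : g 15 ∈ H a b := by simpa [e, fib, z0] using add_mem (h 7 2) (add_mem g11 g12)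
  rw [← lineEq_bdryLine, ← hg]
  fin_cases k <;> assumption

lemma bdryRes_bdryLine : ∀ k k', bdryRes (bdryLine k') k = if k = k' then 1 else 0 := by
  decide +kernel

lemma sum_bdryRes : ∀ k j, ∑ l, bdryRes l k * lineCls l j = 0 := by
  decide +kernel

/-- The residues of the ten boundary forms along the ten boundary lines form the identity matrix, so
they recover the coefficients of a form. -/
lemma resid_injective : Function.Injective (resid hab) := by
  rw [injective_iff_map_eq_zero]
  rintro ⟨ω, hω⟩ h
  obtain ⟨c, rfl⟩ := Submodule.mem_span_range_iff_exists_fun ℂ |>.1 (H_le_span_bdry hab hω)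
  have h1 : ∀ l, ∑ k, c k * (bdryRes l k : ℂ) = 0 := fun l =>
    ((isResidue_iff hab ⟨_, hω⟩ l _).1
      (IsResidue.sum Finset.univ fun k _ => (isResidue_bdry hab l k).smul (c k))).symm.trans
      (congrFun h l)
  have h2 : ∀ k, c k = 0 := by
    intro k
    simpa [bdryRes_bdryLine] using h1 (bdryLine k)
  simp [h2]

/-- The divisor of a boundary equation is principal and supported on the sixteen lines, so its class
in `Pic` is zero; the residues of `dlog` are its multiplicities. -/
lemma sum_resid (ω : H a b) (j : Fin 6) : ∑ l, resid hab ω l * (lineCls l j : ℂ) = 0 := by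
  obtain ⟨ω, hω⟩ := ω
  obtain ⟨c, rfl⟩ := Submodule.mem_span_range_iff_exists_fun ℂ |>.1 (H_le_span_bdry hab hω)
  have h1 : ∀ l, resid hab ⟨_, hω⟩ l = ∑ k, c k * (bdryRes l k : ℂ) := fun l =>
    (isResidue_iff hab _ l _).1
      (IsResidue.sum Finset.univ fun k _ => (isResidue_bdry hab l k).smul (c k))
  simp only [h1, Finset.sum_mul]
  rw [Finset.sum_comm]
  refine Finset.sum_eq_zero fun k _ => ?_
  have := congrArg (Int.cast : ℤ → ℂ) (sum_bdryRes k j)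
  push_cast at this
  simp only [mul_assoc, ← Finset.mul_sum, this, mul_zero]

/-- A combination of boundary forms matches `v` on the ten affine lines. The difference is supported
on `ℓ₁, …, ℓ₅` and `h - ℓ₁ - ℓ₂`, whose classes are a basis of `Pic`, so it vanishes. -/
lemma exists_resid_eq (v : Fin 16 → ℂ) (hv : ∀ j, ∑ l, v l * (lineCls l j : ℂ) = 0) :
    ∃ ω : H a b, resid hab ω = v := by
  let ω : H a b := ∑ k, v (bdryLine k) • ⟨dlog (bdry a b k), dlog_bdry_mem_H hab k⟩
  refine ⟨ω, ?_⟩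
  have h1 : ∀ k, resid hab ω (bdryLine k) = v (bdryLine k) := by
    intro k
    have h2 : ∀ k', resid hab ⟨dlog (bdry a b k'), dlog_bdry_mem_H hab k'⟩ (bdryLine k) =
        bdryRes (bdryLine k) k' := fun k' =>
      (isResidue_iff hab _ _ _).1 (isResidue_bdry hab _ _)
    simp only [ω, map_sum, map_smul, Finset.sum_apply, Pi.smul_apply, h2, bdryRes_bdryLine]
    simp
  have h3 : ∀ j, ∑ l, (resid hab ω - v) l * (lineCls l j : ℂ) = 0 := by
    intro j
    simp only [Pi.sub_apply, sub_mul, Finset.sum_sub_distrib, hv, sum_resid, sub_zero]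
  rw [← sub_eq_zero]
  have h4 : ∀ k, (resid hab ω - v) (bdryLine k) = 0 := fun k => by simp [h1]
  generalize resid hab ω - v = u at h3 h4
  have h5 : ∀ j, ∑ l : Fin 6, u (Fin.castAdd 10 l) * (lineCls (Fin.castAdd 10 l) j : ℂ) = 0 := by
    intro j
    have := h3 j
    rw [Fin.sum_univ_add (a := 6) (b := 10)] at this
    rw [← this, left_eq_add]
    exact Finset.sum_eq_zero fun k _ => by
      rw [show u (Fin.natAdd 6 k) = 0 from h4 k, zero_mul]
  have h6 : ∀ l j : Fin 6, lineCls (Fin.castAdd 10 l) j = if l = 5 then ![1, -1, -1, 0, 0, 0] j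
      else if j = l + 1 then 1 else 0 := by decide
  have e0 := h5 0
  have e1 := h5 1
  have e2 := h5 2
  have e3 := h5 3
  have e4 := h5 4
  have e5 := h5 5
  simp only [h6, Fin.sum_univ_six] at e0 e1 e2 e3 e4 e5
  simp at e0 e1 e2 e3 e4 e5
  funext l
  refine Fin.addCases (m := 6) (n := 10) (fun l => ?_) h4 l
  rw [e0, neg_zero, add_zero] at e1 e2
  fin_cases l <;> assumption

end DP4
end

noncomputable section

namespace DP4

/-! ### The Weyl group as a group of signed permutations -/

/-- The reflections in the fundamental roots, as elements of `W`. -/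
def simpleReflection (k : Fin 5) : W :=
  ⟨reflect (root k) (inter_root k), Subgroup.subset_closure ⟨k, rfl⟩⟩

lemma simpleReflection_mul_self (k : Fin 5) : simpleReflection k * simpleReflection k = 1 := by
  ext1
  refine LinearEquiv.ext fun d => ?_
  change reflect (root k) (inter_root k) (reflect (root k) (inter_root k) d) = d
  exact (reflect (root k) (inter_root k)).apply_symm_apply d

lemma W_induction {P : W → Prop} (one : P 1)
    (mul : ∀ k w, P w → P (simpleReflection k * w)) (w : W) : P w := by
  obtain ⟨w, hw⟩ := w
  induction hw using Subgroup.closure_induction_left with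
  | one => exact one
  | mul_left x hx y hy ih =>
    obtain ⟨k, rfl⟩ := hx
    exact mul k ⟨y, hy⟩ ih
  | inv_mul_cancel x hx y hy ih =>
    obtain ⟨k, rfl⟩ := hx
    have h : (simpleReflection k)⁻¹ = simpleReflection k :=
      inv_eq_of_mul_eq_one_left (simpleReflection_mul_self k)
    have := mul k ⟨y, hy⟩ ih
    rw [← h] at this
    exact this

/-- `w` maps `ε_i` to `s i ε_{σ i}`, and the number of signs is even. -/
def IsSigned (w : W) (σ : Equiv.Perm (Fin 5)) (s : Fin 5 → ℤˣ) : Prop :=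
  (∀ i j, signedCoeff w i j = if σ i = j then (s i : ℤ) else 0) ∧ ∏ i, s i = 1

lemma IsSigned.mul {u w : W} {σ τ : Equiv.Perm (Fin 5)} {s t : Fin 5 → ℤˣ} (hu : IsSigned u σ s)
    (hw : IsSigned w τ t) : IsSigned (u * w) (σ * τ) fun i => t i * s (τ i) := by
  refine ⟨fun i j => ?_, ?_⟩
  · rw [signedCoeff_mul, Finset.sum_eq_single (τ i)]
    · rw [hw.1, hu.1, if_pos rfl, mul_ite, mul_zero, Units.val_mul]
      rfl
    · intro k _ hk
      rw [hw.1, if_neg (Ne.symm hk), zero_mul]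
    · simp
  · rw [Finset.prod_mul_distrib, hw.2, one_mul, Equiv.prod_comp τ s, hu.2]

lemma isSigned_one : IsSigned 1 1 1 := by
  refine ⟨fun i j => ?_, by simp⟩
  change 1 - inter (hCls - eCls i) (hCls - eCls j) = _
  revert i j; decide

/-- The permutation underlying a simple reflection. -/
def simplePerm : Fin 5 → Equiv.Perm (Fin 5) :=
  ![Equiv.swap 0 1, Equiv.swap 1 2, Equiv.swap 2 3, Equiv.swap 3 4, Equiv.swap 3 4]

/-- The signs of a simple reflection. -/
def simpleSign : Fin 5 → Fin 5 → ℤˣ := ![1, 1, 1, 1, ![1, 1, 1, -1, -1]]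

lemma isSigned_simpleReflection (k : Fin 5) :
    IsSigned (simpleReflection k) (simplePerm k) (simpleSign k) := by
  refine ⟨fun i j => ?_, by revert k; decide⟩
  change 1 - inter ((hCls - eCls i) + inter (hCls - eCls i) (root k) • root k) (hCls - eCls j) = _
  revert k i j; decide

lemma exists_isSigned (w : W) : ∃ σ s, IsSigned w σ s := by
  induction w using W_induction with
  | one => exact ⟨_, _, isSigned_one⟩
  | mul k w h =>
    obtain ⟨σ, s, h⟩ := h
    exact ⟨_, _, (isSigned_simpleReflection k).mul h⟩

lemma exists_isSigned_perm (σ : Equiv.Perm (Fin 5)) : ∃ w, IsSigned w σ 1 := by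
  have h := Equiv.Perm.mclosure_swap_castSucc_succ 4
  have hσ : σ ∈ Submonoid.closure (Set.range fun i : Fin 4 => Equiv.swap i.castSucc i.succ) :=
    h ▸ Submonoid.mem_top σ
  induction hσ using Submonoid.closure_induction with
  | mem x hx =>
    obtain ⟨i, rfl⟩ := hx
    refine ⟨simpleReflection i.castSucc, ?_⟩
    convert isSigned_simpleReflection i.castSucc using 1 <;> fin_cases i <;> rfl
  | one => exact ⟨1, isSigned_one⟩
  | mul x y _ _ hx hy =>
    obtain ⟨u, hu⟩ := hx
    obtain ⟨w, hw⟩ := hy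
    exact ⟨u * w, by simpa using! hu.mul hw⟩

/-- The change of the signs of `ε_i` and `ε_j`. -/
def flip (i j : Fin 5) (k : Fin 5) : ℤˣ := if k = i ∨ k = j then -1 else 1

/-- The two reflections at the fork of the diagram `D₅` have the same underlying transposition, so
their product changes just two signs; conjugation by a permutation moves these to `i` and `j`. -/
lemma exists_isSigned_flip {i j : Fin 5} (hij : i ≠ j) : ∃ w, IsSigned w 1 (flip i j) := by
  obtain ⟨σ, hi, hj⟩ : ∃ σ : Equiv.Perm (Fin 5), σ 3 = i ∧ σ 4 = j := by
    revert i j; decide +kernel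
  obtain ⟨u, hu⟩ := exists_isSigned_perm σ
  obtain ⟨v, hv⟩ := exists_isSigned_perm σ⁻¹
  have h := (hu.mul ((isSigned_simpleReflection 3).mul (isSigned_simpleReflection 4))).mul hv
  refine ⟨u * (simpleReflection 3 * simpleReflection 4) * v, ?_⟩
  convert h using 1
  · ext k
    simp [simplePerm]
  · funext k
    have : simpleSign 4 (σ⁻¹ k) = flip i j k := by
      rw [← hi, ← hj, flip]
      simp only [← Equiv.Perm.inv_eq_iff_eq]
      generalize σ⁻¹ k = m
      revert m; decide
    rw [← this]
    simp [simpleSign]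

lemma IsSigned.polyRep_X {w : W} {σ : Equiv.Perm (Fin 5)} {s : Fin 5 → ℤˣ} (h : IsSigned w σ s)
    (i : Fin 5) : polyRep w (MvPolynomial.X i) = (s i : ℤ) • MvPolynomial.X (σ i) := by
  change MvPolynomial.aeval _ (MvPolynomial.X i) = _
  rw [MvPolynomial.aeval_X]
  simp only [h.1, ite_smul, zero_smul, Finset.sum_ite_eq, Finset.mem_univ, if_true]

/-- The vectors `ε_i` are half-integral; their doubles `2 (h - ℓ_i) + K` allow the signed
permutation to be stated inside `Pic`. -/
lemma IsSigned.two_smul {w : W} {σ : Equiv.Perm (Fin 5)} {s : Fin 5 → ℤˣ} (h : IsSigned w σ s)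
    (i : Fin 5) : (2 : ℤ) • (w : Pic ≃ₗ[ℤ] Pic) (hCls - eCls i) + canCls =
      (s i : ℤ) • ((2 : ℤ) • (hCls - eCls (σ i)) + canCls) := by
  have hK : inter (hCls - eCls i) canCls = -2 := by revert i; decide
  rw [two_smul_add_canCls _ (by rw [← W_canCls w, inter_W, hK])]
  have := h.1 i
  simp only [signedCoeff] at this
  simp only [this, ite_smul, zero_smul, Finset.sum_ite_eq, Finset.mem_univ, if_true]

/-! ### Lines -/

/-- The sign of the line `l` with respect to `ε_i`. -/
def lineSign (i : Fin 5) (l : Fin 16) : ℤ := 1 - 2 * inter (lineCls l) (hCls - eCls i)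

lemma lineCls_injective : Function.Injective lineCls := by
  have : ∀ l l', lineCls l = lineCls l' → l = l' := by decide +kernel
  exact fun l l' => this l l'

lemma exists_line (w : W) (l : Fin 16) : ∃ l', (w : Pic ≃ₗ[ℤ] Pic) (lineCls l) = lineCls l' := by
  induction w using W_induction with
  | one => exact ⟨l, rfl⟩
  | mul k w h =>
    obtain ⟨m, hm⟩ := h
    have : ∀ k m, ∃ l', lineCls m + inter (lineCls m) (root k) • root k = lineCls l' := by
      decide +kernel
    obtain ⟨l', h'⟩ := this k m
    refine ⟨l', ?_⟩
    rw [← h', ← hm]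
    rfl

/-- The action of `W` on the lines. -/
def lineMap (w : W) (l : Fin 16) : Fin 16 := (exists_line w l).choose

lemma lineCls_lineMap (w : W) (l : Fin 16) :
    lineCls (lineMap w l) = (w : Pic ≃ₗ[ℤ] Pic) (lineCls l) := (exists_line w l).choose_spec.symm

lemma lineMap_eq {w : W} {l l' : Fin 16} (h : (w : Pic ≃ₗ[ℤ] Pic) (lineCls l) = lineCls l') :
    lineMap w l = l' := lineCls_injective ((lineCls_lineMap w l).trans h)

lemma lineMap_one (l : Fin 16) : lineMap 1 l = l := lineMap_eq rfl

lemma lineMap_mul (u w : W) (l : Fin 16) : lineMap (u * w) l = lineMap u (lineMap w l) :=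
  lineMap_eq (by rw [lineCls_lineMap, lineCls_lineMap]; rfl)

/-- The action of `W` on the lines, by permutations. -/
def lineEquiv (w : W) : Equiv.Perm (Fin 16) where
  toFun := lineMap w
  invFun := lineMap w⁻¹
  left_inv l := by rw [← lineMap_mul, inv_mul_cancel, lineMap_one]
  right_inv l := by rw [← lineMap_mul, mul_inv_cancel, lineMap_one]

/-- Since a line has degree `-1` against `K`, its `i`-th sign is minus its intersection number with
`2 ε_i`, and `w` preserves the pairing. -/
lemma IsSigned.lineSign_lineMap {w : W} {σ : Equiv.Perm (Fin 5)} {s : Fin 5 → ℤˣ}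
    (h : IsSigned w σ s) (i : Fin 5) (l : Fin 16) :
    lineSign (σ i) (lineMap w l) = s i * lineSign i l := by
  have hK : ∀ l, inter (lineCls l) canCls = -1 := by decide
  have h1 := congrArg (inter (lineCls (lineMap w l))) (h.two_smul i)
  rw [inter_add_right, inter_smul_right, inter_smul_right, inter_add_right, inter_smul_right, hK,
    lineCls_lineMap, inter_W, ← lineCls_lineMap] at h1
  have h2 : (s i : ℤ) * s i = 1 := by
    rw [← Units.val_mul, Int.units_mul_self, Units.val_one]
  rw [lineSign, lineSign]
  linear_combination s i * h1 + (2 * inter (lineCls (lineMap w l)) (hCls - eCls (σ i)) - 1) * h2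

/-! ### Conics -/

/-- The index `i` of the vector `±ε_i` that belongs to a conic class. -/
def conicDir : Fin 10 → Fin 5 := ![1, 0, 2, 3, 4, 2, 1, 0, 3, 4]

/-- The sign of the vector `±ε_i` that belongs to a conic class. -/
def conicSgn : Fin 10 → ℤˣ := ![1, 1, 1, 1, 1, -1, -1, -1, -1, -1]

/-- The conic class that belongs to the vector `e ε_i`. -/
def conicIdx (i : Fin 5) (e : ℤˣ) : Fin 10 :=
  if e = 1 then ![1, 0, 2, 3, 4] i else ![7, 6, 5, 8, 9] i

lemma conicIdx_eq : ∀ i, conicIdx (conicDir i) (conicSgn i) = i := by decide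

lemma conicDir_conicIdx : ∀ d e, conicDir (conicIdx d e) = d := by decide

lemma conicSgn_conicIdx : ∀ d e, conicSgn (conicIdx d e) = e := by decide

lemma two_smul_conicCls : ∀ i, (2 : ℤ) • conicCls i + canCls =
    (conicSgn i : ℤ) • ((2 : ℤ) • (hCls - eCls (conicDir i)) + canCls) := by
  decide

lemma conicCls_injective : Function.Injective conicCls := by
  have : ∀ l l', conicCls l = conicCls l' → l = l' := by decide
  exact fun l l' => this l l'

lemma two_smul_add_injective {u v : Pic} (h : (2 : ℤ) • u + canCls = (2 : ℤ) • v + canCls) :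
    u = v := by
  funext j
  have := congrFun h j
  simp only [Pi.add_apply, Pi.smul_apply, smul_eq_mul] at this
  omega

/-- Each conic class `𝔠` satisfies `2 𝔠 + K = ± 2 ε_d`, and `K` is fixed by `w`. -/
lemma IsSigned.conicCls {w : W} {σ : Equiv.Perm (Fin 5)} {s : Fin 5 → ℤˣ} (h : IsSigned w σ s)
    (i : Fin 10) : (w : Pic ≃ₗ[ℤ] Pic) (conicCls i) =
      DP4.conicCls (conicIdx (σ (conicDir i)) (s (conicDir i) * conicSgn i)) := by
  apply two_smul_add_injective
  rw [two_smul_conicCls, conicDir_conicIdx, conicSgn_conicIdx, Units.val_mul, mul_comm, mul_smul,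
    ← h.two_smul, ← map_smul, ← W_canCls w, ← map_smul, ← map_add, ← map_add, ← map_smul,
    ← two_smul_conicCls]

lemma exists_conic (w : W) (i : Fin 10) :
    ∃ j, (w : Pic ≃ₗ[ℤ] Pic) (conicCls i) = conicCls j :=
  let ⟨_, _, h⟩ := exists_isSigned w
  ⟨_, h.conicCls i⟩

/-- The action of `W` on the conic classes. -/
def conicMap (w : W) (i : Fin 10) : Fin 10 := (exists_conic w i).choose

lemma conicCls_conicMap (w : W) (i : Fin 10) :
    conicCls (conicMap w i) = (w : Pic ≃ₗ[ℤ] Pic) (conicCls i) :=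
  (exists_conic w i).choose_spec.symm

lemma conicMap_eq {w : W} {i j : Fin 10} (h : (w : Pic ≃ₗ[ℤ] Pic) (conicCls i) = conicCls j) :
    conicMap w i = j := conicCls_injective ((conicCls_conicMap w i).trans h)

lemma conicMap_one (i : Fin 10) : conicMap 1 i = i := conicMap_eq rfl

lemma conicMap_mul (u w : W) (i : Fin 10) : conicMap (u * w) i = conicMap u (conicMap w i) :=
  conicMap_eq (by rw [conicCls_conicMap, conicCls_conicMap]; rfl)

lemma IsSigned.conicMap {w : W} {σ : Equiv.Perm (Fin 5)} {s : Fin 5 → ℤˣ} (h : IsSigned w σ s)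
    (d : Fin 5) (e : ℤˣ) : conicMap w (conicIdx d e) = conicIdx (σ d) (s d * e) := by
  rw [conicMap_eq (h.conicCls _), conicDir_conicIdx, conicSgn_conicIdx]

lemma conicMap_inv_apply (w : W) (i : Fin 10) : conicMap w (conicMap w⁻¹ i) = i := by
  rw [← conicMap_mul, mul_inv_cancel, conicMap_one]

lemma conicMap_apply_inv (w : W) (i : Fin 10) : conicMap w⁻¹ (conicMap w i) = i := by
  rw [← conicMap_mul, inv_mul_cancel, conicMap_one]

/-- The action of `W` on the conic classes, by permutations. -/
def conicEquiv (w : W) : Equiv.Perm (Fin 10) where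
  toFun := conicMap w
  invFun := conicMap w⁻¹
  left_inv := conicMap_apply_inv w
  right_inv := conicMap_inv_apply w

end DP4
end

noncomputable section

namespace DP4

/-! ### The action on forms -/

section Restrict

variable {G V S : Type*} [Group G] [AddCommGroup V] [Module ℂ V] [AddCommGroup S] [Module ℂ S]

/-- The restriction of a representation along an injective map with stable range. -/
def restrictRep (T : Representation ℂ G V) (ι : S →ₗ[ℂ] V) (hι : Function.Injective ι)
    (h : ∀ g s, T g (ι s) ∈ LinearMap.range ι) : Representation ℂ G S where
  toFun g := (LinearEquiv.ofInjective ι hι).symm.toLinearMap ∘ₗ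
    (T g ∘ₗ ι).codRestrict (LinearMap.range ι) (h g)
  map_one' := by
    ext s
    change (LinearEquiv.ofInjective ι hι).symm _ = s
    rw [LinearEquiv.symm_apply_eq]
    ext
    simp
  map_mul' g g' := by
    ext s
    change (LinearEquiv.ofInjective ι hι).symm _ = (LinearEquiv.ofInjective ι hι).symm _
    congr 1
    ext
    have : ∀ z : LinearMap.range ι, ι ((LinearEquiv.ofInjective ι hι).symm z) = z := fun z =>
      congrArg Subtype.val ((LinearEquiv.ofInjective ι hι).apply_symm_apply z)
    simp [this]

lemma restrictRep_apply (T : Representation ℂ G V) (ι : S →ₗ[ℂ] V) (hι : Function.Injective ι)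
    (h : ∀ g s, T g (ι s) ∈ LinearMap.range ι) (g : G) (s : S) :
    ι (restrictRep T ι hι h g s) = T g (ι s) :=
  congrArg Subtype.val ((LinearEquiv.ofInjective ι hι).apply_symm_apply ⟨_, h g s⟩)

end Restrict

/-- The permutation representation of `W` on the functions on the set of lines. -/
def lineRep : Representation ℂ W (Fin 16 → ℂ) where
  toFun w := LinearMap.funLeft ℂ ℂ (lineMap w⁻¹)
  map_one' := by ext; simp [LinearMap.funLeft_apply, lineMap_one]
  map_mul' u w := by ext; simp [LinearMap.funLeft_apply, lineMap_mul]

lemma lineRep_apply (w : W) (v : Fin 16 → ℂ) (l : Fin 16) :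
    lineRep w v (lineMap w l) = v l := by
  change v (lineMap w⁻¹ (lineMap w l)) = v l
  rw [← lineMap_mul, inv_mul_cancel, lineMap_one]

variable {a b : ℂ} (hab : a * b * (a - 1) * (b - 1) * (a - b) ≠ 0)

/-- The permutation of the lines is induced by a linear automorphism of `Pic`, so it preserves the
relation `∑ v_ℓ [ℓ] = 0` that cuts out the image of `resid`. -/
lemma lineRep_resid_mem (w : W) (ω : H a b) :
    lineRep w (resid hab ω) ∈ LinearMap.range (resid hab) := by
  refine exists_resid_eq hab _ fun j => ?_
  rw [← Equiv.sum_comp (lineEquiv w)]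
  have h1 : ∀ d : Pic, (w : Pic ≃ₗ[ℤ] Pic) d j =
      ∑ k, d k * (w : Pic ≃ₗ[ℤ] Pic) (Pi.single k 1) j := by
    intro d
    conv_lhs => rw [← Finset.univ_sum_single d]
    rw [map_sum, Finset.sum_apply]
    refine Finset.sum_congr rfl fun k _ => ?_
    rw [show Pi.single k (d k) = d k • (Pi.single k 1 : Pic) by
      rw [← Pi.single_smul, smul_eq_mul, mul_one], map_smul]
    rfl
  have h2 : ∀ l, (lineCls (lineEquiv w l) j : ℂ) =
      ∑ k, (lineCls l k : ℂ) * ((w : Pic ≃ₗ[ℤ] Pic) (Pi.single k 1) j : ℤ) := by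
    intro l
    rw [show lineCls (lineEquiv w l) = _ from lineCls_lineMap w l, h1]
    push_cast
    rfl
  have h3 : ∀ l, lineRep w (resid hab ω) (lineEquiv w l) = resid hab ω l :=
    lineRep_apply w _
  simp only [h2, h3, Finset.mul_sum, ← mul_assoc]
  rw [Finset.sum_comm]
  exact Finset.sum_eq_zero fun k _ => by rw [← Finset.sum_mul, sum_resid, zero_mul]

/-- The action of `W` on `H` by permutation of the residues. -/
def formRep : Representation ℂ W (H a b) :=
  restrictRep lineRep (resid hab) (resid_injective hab) (lineRep_resid_mem hab)

lemma resid_formRep (w : W) (ω : H a b) (l : Fin 16) :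
    resid hab (formRep hab w ω) (lineMap w l) = resid hab ω l := by
  rw [formRep, restrictRep_apply, lineRep_apply]

lemma isResidueAction_iff (ρ : Representation ℂ W (H a b)) :
    IsResidueAction a b ρ ↔
      ∀ w ω l, resid hab (ρ w ω) (lineMap w l) = resid hab ω l := by
  constructor
  · intro h w ω l
    exact (isResidue_iff hab _ _ _).1
      (h w l _ (lineCls_lineMap w l).symm ω _ (isResidue_resid hab ω l))
  · intro h w l l' hl ω c hc
    rw [isResidue_iff hab] at hc ⊢
    rw [← hc, ← h w ω l, lineMap_eq hl]

lemma isResidueAction_formRep : IsResidueAction a b (formRep hab) :=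
  (isResidueAction_iff hab _).2 (resid_formRep hab)

lemma eq_formRep (ρ : Representation ℂ W (H a b)) (h : IsResidueAction a b ρ) :
    ρ = formRep hab := by
  rw [isResidueAction_iff hab] at h
  ext w ω : 2
  apply resid_injective hab
  funext l
  obtain ⟨m, rfl⟩ := (lineEquiv w).surjective l
  exact (h w ω m).trans (resid_formRep hab w ω m).symm

/-! ### The subspaces attached to the conic classes -/

lemma sum_resid_inter (ω : H a b) (d : Pic) :
    ∑ l, resid hab ω l * (inter (lineCls l) d : ℂ) = 0 := by
  simp only [inter, Int.cast_sub, Int.cast_mul, Int.cast_sum, mul_sub, Finset.mul_sum,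
    Finset.sum_sub_distrib, ← mul_assoc]
  rw [← Finset.sum_mul, sum_resid, zero_mul, zero_sub, neg_eq_zero, Finset.sum_comm]
  exact Finset.sum_eq_zero fun k _ => by rw [← Finset.sum_mul, sum_resid, zero_mul]

lemma sum_resid_eq_zero (ω : H a b) : ∑ l, resid hab ω l = 0 := by
  have h := sum_resid_inter hab ω canCls
  have hK : ∀ l, inter (lineCls l) canCls = -1 := by decide
  simpa [hK] using h

/-- Only the reducible fibres carry residues, and the two components of a fibre carry the same one.
Expressed through intersection numbers and sums of classes, the condition is visibly compatible with
`W`, which yields `formRep_mem_Hc`. -/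
lemma mem_Hc_iff (ω : H a b) (i : Fin 10) : (ω : Forms) ∈ Hc a b i ↔
    (∀ l, inter (lineCls l) (conicCls i) ≠ 0 → resid hab ω l = 0) ∧
      ∀ l l', lineCls l + lineCls l' = conicCls i → resid hab ω l = resid hab ω l' := by
  have hη : ∀ c : Fin 3 → ℂ, ∀ l, resid hab (∑ s, c s • ⟨η a b i s, η_mem_H a b i s⟩) l =
      ∑ s, c s * fibRes i s l := by
    intro c l
    simp only [map_sum, map_smul, Finset.sum_apply, Pi.smul_apply, resid_η, smul_eq_mul]
  constructor
  · intro h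
    obtain ⟨c, hc⟩ := (Submodule.mem_span_range_iff_exists_fun ℂ).1 h
    have hc' : ω = ∑ s, c s • ⟨η a b i s, η_mem_H a b i s⟩ := by
      ext1
      simp [← hc]
    rw [hc']
    simp only [hη]
    constructor
    · intro l hl
      have : ∀ i s l, inter (lineCls l) (conicCls i) ≠ 0 → fibRes i s l = 0 := by decide +kernel
      simp [this i _ l hl]
    · intro l l' hl
      have : ∀ i l l', lineCls l + lineCls l' = conicCls i → ∀ s, fibRes i s l = fibRes i s l' := by
        decide +kernel
      simp [this i l l' hl]
  · rintro ⟨h1, h2⟩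
    have key : ω = ∑ s : Fin 3, resid hab ω (fib i s.castSucc 0) •
        ⟨η a b i s, η_mem_H a b i s⟩ := by
      apply resid_injective hab
      funext l
      rw [hη]
      have hf : ∀ i s, lineCls (fib i s 0) + lineCls (fib i s 1) = conicCls i := by decide +kernel
      have hs : ∀ s, resid hab ω (fib i s 1) = resid hab ω (fib i s 0) := fun s =>
        (h2 _ _ (hf i s)).symm
      have hcount : ∀ i l, inter (lineCls l) (conicCls i) = 0 →
          ∑ s, ∑ t, (if l = fib i s t then 1 else 0) = 1 := by decide +kernel
      -- The total residue is zero and counts the value on each fibre twice; hence the value over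
      -- `∞` is determined by those over `0, 1, r i`, which serve as coefficients of the `η`.
      have hsum : ∑ s : Fin 4, resid hab ω (fib i s 0) = 0 := by
        have h3 : ∀ l, resid hab ω l =
            ∑ s, ∑ t, if l = fib i s t then resid hab ω (fib i s t) else 0 := by
          intro l
          by_cases hl : inter (lineCls l) (conicCls i) = 0
          · have := congrArg (fun n : ℕ => (n : ℂ) * resid hab ω l) (hcount i l hl)
            simp only [Nat.cast_sum, Finset.sum_mul, Nat.cast_one, one_mul] at this
            rw [← this]
            refine Finset.sum_congr rfl fun s _ => Finset.sum_congr rfl fun t _ => ?_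
            split_ifs with h
            · rw [← h]; simp
            · simp
          · rw [h1 l hl]
            refine (Finset.sum_eq_zero fun s _ => Finset.sum_eq_zero fun t _ => ?_).symm
            split_ifs with h
            · rw [← h, h1 l hl]
            · rfl
        have h4 := (Finset.sum_congr rfl fun l _ => (h3 l).symm).trans (sum_resid_eq_zero hab ω)
        rw [Finset.sum_comm] at h4
        simp_rw [Finset.sum_comm (s := (Finset.univ : Finset (Fin 16)))] at h4
        simp only [Finset.sum_ite_eq', Finset.mem_univ, if_true, Fin.sum_univ_two, hs] at h4
        simp only [← two_mul, ← Finset.mul_sum] at h4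
        exact (mul_eq_zero.1 h4).resolve_left two_ne_zero
      by_cases hl : inter (lineCls l) (conicCls i) = 0
      · have : ∀ i l, inter (lineCls l) (conicCls i) = 0 → ∃ s t, l = fib i s t := by
          decide +kernel
        obtain ⟨s, t, rfl⟩ := this i l hl
        have ht : resid hab ω (fib i s t) = resid hab ω (fib i s 0) := by
          fin_cases t
          · rfl
          · exact hs s
        have hres : ∀ i s t s', fibRes i s' (fib i s t) =
            (if s'.castSucc = s then 1 else 0) - if s = 3 then 1 else 0 := by decide +kernel
        rw [ht]
        simp only [hres]
        rw [Fin.sum_univ_castSucc] at hsum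
        refine Fin.lastCases ?_ (fun s => ?_) s
        · rw [eq_neg_of_add_eq_zero_right hsum, ← Finset.sum_neg_distrib]
          refine Finset.sum_congr rfl fun s' _ => ?_
          have : s'.castSucc ≠ Fin.last 3 := (Fin.castSucc_lt_last s').ne
          rw [if_neg this, if_pos (show Fin.last 3 = 3 from rfl)]
          simp
        · have : s.castSucc ≠ 3 := (Fin.castSucc_lt_last s).ne
          simp [this]
      · rw [h1 l hl]
        have : ∀ i s l, inter (lineCls l) (conicCls i) ≠ 0 → fibRes i s l = 0 := by decide +kernel
        simp [this i _ l hl]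
    rw [key, Submodule.coe_sum]
    exact sum_mem fun s _ => Submodule.smul_mem _ _ (Submodule.subset_span ⟨s, rfl⟩)

lemma formRep_mem_Hc (w : W) (i : Fin 10) (ω : H a b) (h : (ω : Forms) ∈ Hc a b i) :
    (formRep hab w ω : Forms) ∈ Hc a b (conicMap w i) := by
  rw [mem_Hc_iff hab] at h ⊢
  constructor
  · intro l hl
    obtain ⟨m, rfl⟩ := (lineEquiv w).surjective l
    refine (resid_formRep hab w ω m).trans (h.1 m fun h0 => hl ?_)
    rw [show lineCls (lineEquiv w m) = _ from lineCls_lineMap w m, conicCls_conicMap, inter_W, h0]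
  · intro l l' hl
    obtain ⟨m, rfl⟩ := (lineEquiv w).surjective l
    obtain ⟨m', rfl⟩ := (lineEquiv w).surjective l'
    refine (resid_formRep hab w ω m).trans (Eq.trans ?_ (resid_formRep hab w ω m').symm)
    refine h.2 m m' ((w : Pic ≃ₗ[ℤ] Pic).injective ?_)
    rw [map_add, ← conicCls_conicMap, ← hl, ← lineCls_lineMap, ← lineCls_lineMap]
    rfl

/-! ### Fourier coefficients of the residue vectors -/

/-- The Fourier coefficient of the residue vector at the character `s_j s_k`. -/
def chi (j k : Fin 5) : H a b →ₗ[ℂ] ℂ :=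
  ∑ l, ((lineSign j l * lineSign k l : ℤ) : ℂ) • (LinearMap.proj l ∘ₗ resid hab)

lemma chi_apply (j k : Fin 5) (ω : H a b) :
    chi hab j k ω = ∑ l, (lineSign j l : ℂ) * lineSign k l * resid hab ω l := by
  simp [chi, LinearMap.sum_apply]

lemma lineSign_mul_self : ∀ j l, lineSign j l * lineSign j l = 1 := by decide

lemma sum_lineSign_resid (j : Fin 5) (ω : H a b) :
    ∑ l, (lineSign j l : ℂ) * resid hab ω l = 0 := by
  have h1 := sum_resid_inter hab ω (hCls - eCls j)
  have h2 := sum_resid_eq_zero hab ω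
  have : ∀ l, (lineSign j l : ℂ) * resid hab ω l = resid hab ω l -
      2 * (resid hab ω l * (inter (lineCls l) (hCls - eCls j) : ℂ)) := by
    intro l
    rw [lineSign]
    push_cast
    ring
  simp only [this, Finset.sum_sub_distrib, ← Finset.mul_sum, h1, h2, mul_zero, sub_zero]

lemma chi_symm (j k : Fin 5) (ω : H a b) : chi hab j k ω = chi hab k j ω := by
  simp only [chi_apply, mul_comm (lineSign j _ : ℂ)]

lemma chi_self (j : Fin 5) (ω : H a b) : chi hab j j ω = 0 := by
  rw [chi_apply, ← sum_resid_eq_zero hab ω]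
  refine Finset.sum_congr rfl fun l _ => ?_
  rw [← Int.cast_mul, lineSign_mul_self, Int.cast_one, one_mul]

/-- Fourier inversion on the sixteen sign vectors of product `-1`: the characters `1`, `s_j`, `s_j
s_k` with `j < k` span all functions, and those of degree at most one annihilate residue vectors. -/
lemma eq_zero_of_chi (ω : H a b) (h : ∀ j k, chi hab j k ω = 0) : ω = 0 := by
  apply resid_injective hab
  rw [map_zero]
  funext l
  -- Twice the orthogonality relation for sixteen characters: ordered pairs count each `s_j s_k`
  -- twice, and the five diagonal terms explain the correction `2 - 5 = -3`.
  have hF : ∀ l l', (if l' = l then 32 else 0) =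
      (∑ j, ∑ k, lineSign j l * lineSign k l * (lineSign j l' * lineSign k l')) +
        2 * (∑ j, lineSign j l * lineSign j l') - 3 := by decide +kernel
  have h1 : ∑ l', (((if l' = l then 32 else 0 : ℤ)) : ℂ) * resid hab ω l' = 0 := by
    simp only [hF]
    push_cast
    simp only [sub_mul, add_mul, Finset.sum_sub_distrib, Finset.sum_add_distrib, Finset.sum_mul,
      Finset.mul_sum, mul_assoc]
    have e1 : ∑ l', ∑ j, ∑ k, (lineSign j l : ℂ) * (lineSign k l * (lineSign j l' *
        (lineSign k l' * resid hab ω l'))) = 0 := by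
      rw [Finset.sum_comm]
      refine Finset.sum_eq_zero fun j _ => ?_
      rw [Finset.sum_comm]
      refine Finset.sum_eq_zero fun k _ => ?_
      have := h j k
      rw [chi_apply] at this
      rw [← Finset.mul_sum, ← Finset.mul_sum]
      simp only [← mul_assoc] at this ⊢
      rw [this, mul_zero]
    have e2 : ∑ l', ∑ j, 2 * ((lineSign j l : ℂ) * (lineSign j l' * resid hab ω l')) = 0 := by
      rw [Finset.sum_comm]
      refine Finset.sum_eq_zero fun j _ => ?_
      rw [← Finset.mul_sum, ← Finset.mul_sum, sum_lineSign_resid, mul_zero, mul_zero]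
    rw [e1, e2, ← Finset.mul_sum, sum_resid_eq_zero]
    ring
  simpa using h1

lemma chi_formRep {w : W} {σ : Equiv.Perm (Fin 5)} {s : Fin 5 → ℤˣ} (h : IsSigned w σ s)
    (j k : Fin 5) (ω : H a b) :
    chi hab (σ j) (σ k) (formRep hab w ω) = ((s j : ℤ) : ℂ) * ((s k : ℤ) : ℂ) * chi hab j k ω := by
  rw [chi_apply, chi_apply, ← Equiv.sum_comp (lineEquiv w), Finset.mul_sum]
  refine Finset.sum_congr rfl fun l _ => ?_
  rw [show lineEquiv w l = lineMap w l from rfl, h.lineSign_lineMap, h.lineSign_lineMap,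
    resid_formRep]
  push_cast
  ring

lemma lineSign_conicDir : ∀ i l, inter (lineCls l) (conicCls i) = 0 →
    lineSign (conicDir i) l = conicSgn i := by decide +kernel

/-- On the lines where such a form has residues, the sign in the direction of the conic class is
constant, so the coefficient reduces to one of degree one, which vanishes. -/
lemma chi_conicDir {i : Fin 10} {ω : H a b} (h : (ω : Forms) ∈ Hc a b i) (k : Fin 5) :
    chi hab (conicDir i) k ω = 0 := by
  rw [mem_Hc_iff hab] at h
  rw [chi_apply, ← mul_zero ((conicSgn i : ℤ) : ℂ), ← sum_lineSign_resid hab k ω, Finset.mul_sum]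
  refine Finset.sum_congr rfl fun l _ => ?_
  by_cases hl : inter (lineCls l) (conicCls i) = 0
  · rw [lineSign_conicDir i l hl, mul_assoc]
  · rw [h.1 l hl]; ring

/-- The five signs of a line have product `-1`. Where the sign in the direction of the conic class
is `e`, the other four have product `-e`, so the products over complementary pairs differ by `-e`.
-/
lemma chi_partner {i : Fin 10} {ω : H a b} (h : (ω : Forms) ∈ Hc a b i)
    (θ : Equiv.Perm (Fin 5)) (hθ : θ 0 = conicDir i) :
    chi hab (θ 3) (θ 4) ω = -((conicSgn i : ℤ) : ℂ) * chi hab (θ 1) (θ 2) ω := by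
  rw [mem_Hc_iff hab] at h
  rw [chi_apply, chi_apply, Finset.mul_sum]
  refine Finset.sum_congr rfl fun l _ => ?_
  by_cases hl : inter (lineCls l) (conicCls i) = 0
  · have h1 : ∀ l, ∏ j, lineSign j l = -1 := by decide
    have h2 := h1 l
    rw [← Equiv.prod_comp θ, Fin.prod_univ_five, hθ, lineSign_conicDir i l hl] at h2
    have h3 := lineSign_mul_self (θ 3) l
    have h4 := lineSign_mul_self (θ 4) l
    have h5 : ((conicSgn i : ℤˣ) : ℤ) * conicSgn i = 1 := by
      rw [← Units.val_mul, Int.units_mul_self, Units.val_one]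
    have h6 : lineSign (θ 3) l * lineSign (θ 4) l =
        -(conicSgn i : ℤ) * (lineSign (θ 1) l * lineSign (θ 2) l) := by
      linear_combination (lineSign (θ 3) l * lineSign (θ 4) l) * h2 -
        (conicSgn i * lineSign (θ 1) l * lineSign (θ 2) l) *
          (lineSign (θ 4) l * lineSign (θ 4) l * h3 + h4)
    have h7 := congrArg (Int.cast : ℤ → ℂ) h6
    push_cast at h7
    rw [h7]
    ring
  · rw [h.1 l hl]; ring

/-- The Fourier coefficients of the forms `η`. -/
def chiInt (i : Fin 10) (s : Fin 3) (j k : Fin 5) : ℤ :=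
  ∑ l, lineSign j l * lineSign k l * fibRes i s l

lemma chi_η (i : Fin 10) (s : Fin 3) (j k : Fin 5) (h : η a b i s ∈ H a b) :
    chi hab j k ⟨η a b i s, h⟩ = chiInt i s j k := by
  rw [chi_apply, chiInt]
  push_cast
  simp only [resid_η]

end DP4
end

noncomputable section

namespace DP4

/-! ### The action on symbols -/

section Incl

variable (a b : ℂ) (ν : ℕ)

/-- The inclusion of `H_i` in `H`. -/
def formIncl (i : Fin 10) : Hc a b i →ₗ[ℂ] H a b := Submodule.inclusion (le_iSup (Hc a b) i)

lemma incl_eq (i : Fin 10) : incl a b ν i = PiTensorProduct.map fun _ => formIncl a b i := rfl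

/-- A linear retraction of `H` onto the subspace induces one on the tensor powers. -/
lemma incl_injective (i : Fin 10) : Function.Injective (incl a b ν i) := by
  obtain ⟨g, hg⟩ := LinearMap.exists_leftInverse_of_injective
    (formIncl a b i) (LinearMap.ker_eq_bot.2 (Submodule.inclusion_injective _))
  have h : PiTensorProduct.map (fun _ : Fin ν => g) ∘ₗ incl a b ν i = LinearMap.id := by
    rw [incl_eq, ← PiTensorProduct.map_comp]
    simp only [hg, PiTensorProduct.map_id]
  exact Function.LeftInverse.injective (g := PiTensorProduct.map fun _ => g)
    fun x => LinearMap.congr_fun h x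

/-- The componentwise inclusion of the tuples of symbols. -/
def inclAll : Symbols a b ν →ₗ[ℂ] Fin 10 → ⨂[ℂ]^ν (H a b) :=
  LinearMap.pi fun i => incl a b ν i ∘ₗ LinearMap.proj i

lemma inclAll_injective : Function.Injective (inclAll a b ν) := fun _ _ h =>
  funext fun i => incl_injective a b ν i (congrFun h i)

variable {a b}

/-- The action of `W` on the tuples of tensors indexed by the conic classes. -/
def tensorRep (ρ : Representation ℂ W (H a b)) :
    Representation ℂ W (Fin 10 → ⨂[ℂ]^ν (H a b)) where
  toFun w := LinearMap.pi fun j =>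
    PiTensorProduct.map (fun _ => ρ w) ∘ₗ LinearMap.proj (conicMap w⁻¹ j)
  map_one' := by
    refine LinearMap.ext fun F => funext fun j => ?_
    change PiTensorProduct.map (fun _ => ρ 1) (F (conicMap 1⁻¹ j)) = F j
    rw [inv_one, conicMap_one, map_one]
    exact LinearMap.congr_fun PiTensorProduct.map_id _
  map_mul' u w := by
    refine LinearMap.ext fun F => funext fun j => ?_
    change PiTensorProduct.map (fun _ => ρ (u * w)) (F (conicMap (u * w)⁻¹ j)) =
      PiTensorProduct.map (fun _ => ρ u) (PiTensorProduct.map (fun _ => ρ w)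
        (F (conicMap w⁻¹ (conicMap u⁻¹ j))))
    rw [← LinearMap.comp_apply, ← PiTensorProduct.map_comp, mul_inv_rev, conicMap_mul, map_mul]
    rfl

lemma tensorRep_apply (ρ : Representation ℂ W (H a b)) (w : W)
    (F : Fin 10 → ⨂[ℂ]^ν (H a b)) (i : Fin 10) :
    tensorRep ν ρ w F (conicMap w i) = PiTensorProduct.map (fun _ => ρ w) (F i) := by
  change PiTensorProduct.map (fun _ => ρ w) (F (conicMap w⁻¹ (conicMap w i))) = _
  rw [conicMap_apply_inv]

end Incl

variable {a b : ℂ} (hab : a * b * (a - 1) * (b - 1) * (a - b) ≠ 0) (ν : ℕ)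

lemma map_incl_mem (w : W) (i : Fin 10) (x : ⨂[ℂ]^ν (Hc a b i)) :
    PiTensorProduct.map (fun _ => formRep hab w) (incl a b ν i x) ∈
      LinearMap.range (incl a b ν (conicMap w i)) := by
  let g : Hc a b i →ₗ[ℂ] Hc a b (conicMap w i) :=
    ((H a b).subtype ∘ₗ formRep hab w ∘ₗ formIncl a b i).codRestrict _
      fun ω => formRep_mem_Hc hab w i _ ω.2
  refine ⟨PiTensorProduct.map (fun _ => g) x, ?_⟩
  rw [incl_eq, incl_eq, ← LinearMap.comp_apply, ← LinearMap.comp_apply, ← PiTensorProduct.map_comp,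
    ← PiTensorProduct.map_comp]
  rfl

/-- The action of `W` on the tuples of symbols. -/
def symbolRep : Representation ℂ W (Symbols a b ν) :=
  restrictRep (tensorRep ν (formRep hab)) (inclAll a b ν) (inclAll_injective a b ν) (by
    intro w Ω
    have h : ∀ j, tensorRep ν (formRep hab) w (inclAll a b ν Ω) j ∈
        LinearMap.range (incl a b ν j) := by
      intro j
      obtain ⟨i, rfl⟩ := (conicEquiv w).surjective j
      exact (tensorRep_apply ν _ w _ i).symm ▸ map_incl_mem hab ν w i (Ω i)
    choose Ω' hΩ' using h
    exact ⟨Ω', funext hΩ'⟩)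

lemma incl_symbolRep (w : W) (Ω : Symbols a b ν) (i : Fin 10) :
    incl a b ν (conicMap w i) (symbolRep hab ν w Ω (conicMap w i)) =
      PiTensorProduct.map (fun _ => formRep hab w) (incl a b ν i (Ω i)) := by
  exact (congrFun (restrictRep_apply _ _ (inclAll_injective a b ν) _ w Ω) _).trans
    (tensorRep_apply ν _ w _ i)

lemma isBulletAction_symbolRep : IsBulletAction a b ν (formRep hab) (symbolRep hab ν) := by
  intro w i j h Ω
  obtain rfl := conicMap_eq h
  exact incl_symbolRep hab ν w Ω i

lemma eq_symbolRep (τ : Representation ℂ W (Symbols a b ν))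
    (h : IsBulletAction a b ν (formRep hab) τ) : τ = symbolRep hab ν := by
  refine MonoidHom.ext fun w => LinearMap.ext fun Ω => funext fun j => ?_
  obtain ⟨i, rfl⟩ := (conicEquiv w).surjective j
  refine incl_injective a b ν _ ?_
  exact (h w i _ (conicCls_conicMap w i).symm Ω).trans (incl_symbolRep hab ν w Ω i).symm

lemma Φ_apply (Ω : Symbols a b ν) : Φ a b ν Ω = ∑ i, incl a b ν i (Ω i) := by
  simp [Φ, LinearMap.sum_apply]

lemma Φ_symbolRep (w : W) (Ω : Symbols a b ν) :
    Φ a b ν (symbolRep hab ν w Ω) = PiTensorProduct.map (fun _ => formRep hab w) (Φ a b ν Ω) := by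
  rw [Φ_apply, Φ_apply, map_sum, ← Equiv.sum_comp (conicEquiv w)]
  exact Finset.sum_congr rfl fun i _ => incl_symbolRep hab ν w Ω i

lemma symbolRep_mem_HLogAR (w : W) (Ω : Symbols a b ν) (h : Ω ∈ HLogAR a b ν) :
    symbolRep hab ν w Ω ∈ HLogAR a b ν := by
  rw [HLogAR, LinearMap.mem_ker] at h ⊢
  rw [Φ_symbolRep, h, map_zero]

lemma swap₂_map {M N : Type*} [AddCommGroup M] [Module ℂ M] [AddCommGroup N] [Module ℂ N]
    (g : M →ₗ[ℂ] N) (x : ⨂[ℂ]^2 M) :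
    swap₂ N (PiTensorProduct.map (fun _ => g) x) =
      PiTensorProduct.map (fun _ => g) (swap₂ M x) := by
  have : swap₂ N ∘ₗ PiTensorProduct.map (fun _ => g) =
      PiTensorProduct.map (fun _ => g) ∘ₗ swap₂ M := by
    ext v
    simp [swap₂, PiTensorProduct.reindex_tprod]
  exact LinearMap.congr_fun this x

lemma swap₂_symbolRep (w : W) (Ω : Symbols a b 2) (c : ℂ)
    (h : ∀ i, swap₂ (Hc a b i) (Ω i) = c • Ω i) (i : Fin 10) :
    swap₂ (Hc a b i) (symbolRep hab 2 w Ω i) = c • symbolRep hab 2 w Ω i := by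
  obtain ⟨i, rfl⟩ := (conicEquiv w).surjective i
  refine incl_injective a b 2 _ ?_
  rw [map_smul, show conicEquiv w i = conicMap w i from rfl, incl_symbolRep, incl_eq, ← swap₂_map]
  change swap₂ _ (incl a b 2 _ _) = _
  rw [incl_symbolRep, swap₂_map, incl_eq, swap₂_map, h, map_smul, map_smul]

lemma mem_HLogARsym (Ω : Symbols a b 2) : Ω ∈ HLogARsym a b ↔
    Ω ∈ HLogAR a b 2 ∧ ∀ i, swap₂ (Hc a b i) (Ω i) = (1 : ℂ) • Ω i := by
  simp [HLogARsym, sub_eq_zero]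

lemma mem_HLogARasym (Ω : Symbols a b 2) : Ω ∈ HLogARasym a b ↔
    Ω ∈ HLogAR a b 2 ∧ ∀ i, swap₂ (Hc a b i) (Ω i) = (-1 : ℂ) • Ω i := by
  rw [HLogARasym, Submodule.mem_inf, Submodule.mem_iInf]
  refine and_congr_right fun _ => forall_congr' fun i => ?_
  exact add_eq_zero_iff_eq_neg.trans (Iff.of_eq (congrArg _ (neg_one_smul ℂ (Ω i)).symm))

/-- The abelian relations as a subrepresentation. -/
def subHLogAR : Subrepresentation (symbolRep hab ν) where
  toSubmodule := HLogAR a b ν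
  apply_mem_toSubmodule w := fun Ω h => symbolRep_mem_HLogAR hab ν w Ω h

/-- The symmetric abelian relations of weight two as a subrepresentation. -/
def subHLogARsym : Subrepresentation (symbolRep hab 2) where
  toSubmodule := HLogARsym a b
  apply_mem_toSubmodule w Ω h := by
    rw [mem_HLogARsym] at h ⊢
    exact ⟨symbolRep_mem_HLogAR hab 2 w Ω h.1, swap₂_symbolRep hab w Ω 1 h.2⟩

/-- The antisymmetric abelian relations of weight two as a subrepresentation. -/
def subHLogARasym : Subrepresentation (symbolRep hab 2) where
  toSubmodule := HLogARasym a b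
  apply_mem_toSubmodule w Ω h := by
    rw [mem_HLogARasym] at h ⊢
    exact ⟨symbolRep_mem_HLogAR hab 2 w Ω h.1, swap₂_symbolRep hab w Ω (-1) h.2⟩

end DP4
end

noncomputable section

namespace DP4

/-! ### Coordinates on tensor powers -/

section TensorEval

variable {V ι : Type*} [AddCommGroup V] [Module ℂ V] {ν : ℕ}

/-- The functional `⊗ v_n ↦ ∏ φ_n (v_n)` on a tensor power. -/
def tensorEval (φ : Fin ν → V →ₗ[ℂ] ℂ) : ⨂[ℂ]^ν V →ₗ[ℂ] ℂ :=
  PiTensorProduct.lift ((MultilinearMap.mkPiAlgebra ℂ (Fin ν) ℂ).compLinearMap φ)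

lemma tensorEval_tprod (φ : Fin ν → V →ₗ[ℂ] ℂ) (v : Fin ν → V) :
    tensorEval φ (PiTensorProduct.tprod ℂ v) = ∏ n, φ n (v n) := by
  simp [tensorEval]

lemma tensorEval_smul (φ : Fin ν → V →ₗ[ℂ] ℂ) (c : Fin ν → ℂ) :
    tensorEval (fun n => c n • φ n) = (∏ n, c n) • tensorEval φ := by
  ext v
  simp [tensorEval_tprod, Finset.prod_mul_distrib]

lemma tensorEval_map {V' : Type*} [AddCommGroup V'] [Module ℂ V'] (φ : Fin ν → V' →ₗ[ℂ] ℂ)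
    (g : V →ₗ[ℂ] V') (x : ⨂[ℂ]^ν V) :
    tensorEval φ (PiTensorProduct.map (fun _ => g) x) = tensorEval (fun n => φ n ∘ₗ g) x := by
  have : tensorEval φ ∘ₗ PiTensorProduct.map (fun _ => g) = tensorEval (fun n => φ n ∘ₗ g) := by
    ext v
    simp [tensorEval_tprod]
  exact LinearMap.congr_fun this x

lemma tensorEval_swap₂ (φ : Fin 2 → V →ₗ[ℂ] ℂ) (x : ⨂[ℂ]^2 V) :
    tensorEval φ (swap₂ V x) = tensorEval ![φ 1, φ 0] x := by
  have : tensorEval φ ∘ₗ swap₂ V = tensorEval ![φ 1, φ 0] := by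
    ext v
    simp [tensorEval_tprod, swap₂, PiTensorProduct.reindex_tprod, mul_comm]
    rfl
  exact LinearMap.congr_fun this x

/-- A separating family embeds `V` in `ι → ℂ`. The embedding splits, so its tensor power is
injective, and there the functionals are the coordinates in the tensor basis. -/
lemma eq_zero_of_tensorEval [Finite ι] (φ : ι → V →ₗ[ℂ] ℂ) (hφ : ∀ v, (∀ k, φ k v = 0) → v = 0)
    (x : ⨂[ℂ]^ν V) (h : ∀ f : Fin ν → ι, tensorEval (fun n => φ (f n)) x = 0) : x = 0 := by
  have := Fintype.ofFinite ι
  have hinj : Function.Injective (LinearMap.pi φ) := by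
    rw [injective_iff_map_eq_zero]
    exact fun v hv => hφ v fun k => congrFun hv k
  obtain ⟨g, hg⟩ := LinearMap.exists_leftInverse_of_injective _ (LinearMap.ker_eq_bot.2 hinj)
  have hx : PiTensorProduct.map (fun _ => LinearMap.pi φ) x = 0 := by
    refine (Basis.piTensorProduct fun _ : Fin ν => Pi.basisFun ℂ ι).ext_elem fun f => ?_
    have key : (Basis.piTensorProduct fun _ : Fin ν => Pi.basisFun ℂ ι).coord f ∘ₗ
        PiTensorProduct.map (fun _ => LinearMap.pi φ) = tensorEval fun n => φ (f n) := by
      ext v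
      simp [tensorEval_tprod, Basis.piTensorProduct_repr_tprod_apply]
    rw [map_zero]
    exact (LinearMap.congr_fun key x).trans (h f)
  have hid : PiTensorProduct.map (fun _ : Fin ν => g) ∘ₗ
      PiTensorProduct.map (fun _ => LinearMap.pi φ) = LinearMap.id := by
    rw [← PiTensorProduct.map_comp]
    simp only [hg, PiTensorProduct.map_id]
  rw [← LinearMap.id_apply (R := ℂ) x, ← hid, LinearMap.comp_apply, hx, map_zero]

end TensorEval

variable {a b : ℂ} (hab : a * b * (a - 1) * (b - 1) * (a - b) ≠ 0) {ν : ℕ}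

/-- The restriction to `H_i` of the Fourier coefficient attached to a pair of indices. -/
def chiH (i : Fin 10) (p : Fin 5 × Fin 5) : Hc a b i →ₗ[ℂ] ℂ :=
  chi hab p.1 p.2 ∘ₗ formIncl a b i

/-- The coordinates of a tuple of symbols. -/
def coef (i : Fin 10) (f : Fin ν → Fin 5 × Fin 5) : Symbols a b ν →ₗ[ℂ] ℂ :=
  tensorEval (fun n => chiH hab i (f n)) ∘ₗ LinearMap.proj i

lemma coef_apply (i : Fin 10) (f : Fin ν → Fin 5 × Fin 5) (Ω : Symbols a b ν) :
    coef hab i f Ω = tensorEval (fun n => chiH hab i (f n)) (Ω i) := rfl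

lemma coef_eq_tensorEval_incl (i : Fin 10) (f : Fin ν → Fin 5 × Fin 5) (Ω : Symbols a b ν) :
    coef hab i f Ω = tensorEval (fun n => chi hab (f n).1 (f n).2) (incl a b ν i (Ω i)) :=
  (tensorEval_map _ _ _).symm

lemma coef_eq_mul (i : Fin 10) (f g : Fin ν → Fin 5 × Fin 5) (c : Fin ν → ℂ)
    (h : ∀ n, chiH hab i (f n) = c n • chiH hab i (g n)) (Ω : Symbols a b ν) :
    coef hab i f Ω = (∏ n, c n) * coef hab i g Ω := by
  rw [coef_apply, coef_apply, funext h, tensorEval_smul]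
  rfl

lemma chiH_symm (i : Fin 10) (j k : Fin 5) : chiH hab i (j, k) = chiH hab i (k, j) :=
  LinearMap.ext fun _ => chi_symm hab j k _

lemma chiH_eq_zero {i : Fin 10} {p : Fin 5 × Fin 5} (h : conicDir i = p.1 ∨ conicDir i = p.2) :
    chiH hab i p = 0 := by
  refine LinearMap.ext fun ω => ?_
  rcases h with h | h
  · change chi hab p.1 p.2 _ = 0
    rw [← h]
    exact chi_conicDir hab (by exact ω.2) _
  · change chi hab p.1 p.2 _ = 0
    rw [← h, chi_symm]
    exact chi_conicDir hab (by exact ω.2) _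

lemma chiH_partner {i : Fin 10} (θ : Equiv.Perm (Fin 5)) (hθ : θ 0 = conicDir i) :
    chiH hab i (θ 3, θ 4) = (-((conicSgn i : ℤ) : ℂ)) • chiH hab i (θ 1, θ 2) :=
  LinearMap.ext fun ω => chi_partner hab (by exact ω.2) θ hθ

lemma eq_zero_of_chiH {i : Fin 10} (θ : Equiv.Perm (Fin 5)) (hθ : θ 0 = conicDir i)
    (ω : Hc a b i) (h : ∀ k : Fin 3, chiH hab i (θ 1, θ (![2, 3, 4] k)) ω = 0) : ω = 0 := by
  have h2 : ∀ π : Equiv.Perm (Fin 5), π 0 = 0 → chiH hab i (θ (π 1), θ (π 2)) ω = 0 →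
      chiH hab i (θ (π 3), θ (π 4)) ω = 0 := by
    intro π hπ h0
    have := LinearMap.congr_fun (chiH_partner hab (θ * π) (by simp [hπ, hθ])) ω
    simpa [h0] using this
  have key : ∀ j k, chiH hab i (θ j, θ k) ω = 0 := by
    intro j k
    by_cases hj : j = 0
    · rw [chiH_eq_zero hab (Or.inl (by rw [hj, hθ])), LinearMap.zero_apply]
    by_cases hk : k = 0
    · rw [chiH_eq_zero hab (Or.inr (by rw [hk, hθ])), LinearMap.zero_apply]
    by_cases hjk : j = k
    · rw [hjk]; exact chi_self hab _ _
    -- A pair in `{1, 2, 3, 4}` or its complement contains `1`, and complementary pairs have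
    -- proportional coefficients; three coefficients therefore suffice.
    have hcomb : ∀ j k : Fin 5, j ≠ 0 → k ≠ 0 → j ≠ k → (∃ m : Fin 3, j = 1 ∧ k = ![2, 3, 4] m) ∨
        (∃ m : Fin 3, k = 1 ∧ j = ![2, 3, 4] m) ∨
        ∃ π : Equiv.Perm (Fin 5), π 0 = 0 ∧ π 1 = 1 ∧ (∃ m : Fin 3, π 2 = ![2, 3, 4] m) ∧
          π 3 = j ∧ π 4 = k := by decide +kernel
    rcases hcomb j k hj hk hjk with ⟨m, rfl, rfl⟩ | ⟨m, rfl, rfl⟩ | ⟨π, h0, h1, ⟨m, hm⟩, rfl, rfl⟩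
    · exact h m
    · rw [chiH_symm]; exact h m
    · exact h2 π h0 (by rw [h1, hm]; exact h m)
  have h0 : formIncl a b i ω = 0 := eq_zero_of_chi hab _ fun j k => by
    simpa using! key (θ⁻¹ j) (θ⁻¹ k)
  exact Submodule.inclusion_injective _ (h0.trans (map_zero _).symm)

lemma eq_zero_of_coef (Ω : Symbols a b ν) (h : ∀ i, ∃ θ : Equiv.Perm (Fin 5), θ 0 = conicDir i ∧
    ∀ k : Fin ν → Fin 3, coef hab i (fun n => (θ 1, θ (![2, 3, 4] (k n)))) Ω = 0) : Ω = 0 := by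
  funext i
  obtain ⟨θ, hθ, hk⟩ := h i
  exact eq_zero_of_tensorEval (fun k : Fin 3 => chiH hab i (θ 1, θ (![2, 3, 4] k)))
    (eq_zero_of_chiH hab θ hθ) (Ω i) hk

lemma sum_coef {Ω : Symbols a b ν} (h : Ω ∈ HLogAR a b ν) (f : Fin ν → Fin 5 × Fin 5) :
    ∑ i, coef hab i f Ω = 0 := by
  simp only [coef_eq_tensorEval_incl]
  rw [← map_sum, ← Φ_apply, LinearMap.mem_ker.1 h, map_zero]

lemma coef_symbolRep {w : W} {σ : Equiv.Perm (Fin 5)} {s : Fin 5 → ℤˣ} (h : IsSigned w σ s)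
    (i : Fin 10) (f : Fin ν → Fin 5 × Fin 5) (Ω : Symbols a b ν) :
    coef hab (conicMap w i) (fun n => (σ (f n).1, σ (f n).2)) (symbolRep hab ν w Ω) =
      (∏ n, ((s (f n).1 * s (f n).2 : ℤˣ) : ℤ) : ℂ) * coef hab i f Ω := by
  rw [coef_eq_tensorEval_incl, incl_symbolRep, tensorEval_map, coef_eq_tensorEval_incl,
    ← smul_eq_mul, ← LinearMap.smul_apply, ← tensorEval_smul]
  congr 2
  funext n
  refine LinearMap.ext fun ω => ?_
  change chi hab _ _ (formRep hab w ω) = _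
  rw [chi_formRep hab h]
  push_cast
  rfl

lemma coef_swap₂ (i : Fin 10) (p q : Fin 5 × Fin 5) (Ω : Symbols a b 2) (c : ℂ)
    (h : swap₂ (Hc a b i) (Ω i) = c • Ω i) : coef hab i ![q, p] Ω = c * coef hab i ![p, q] Ω := by
  rw [coef_apply, coef_apply, ← smul_eq_mul, ← map_smul, ← h, tensorEval_swap₂]
  congr 2
  funext n
  fin_cases n <;> rfl

/-- The conic classes as the vectors `±ε_d`. -/
def conicProd : Fin 5 × ℤˣ ≃ Fin 10 where
  toFun x := conicIdx x.1 x.2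
  invFun i := (conicDir i, conicSgn i)
  left_inv _ := Prod.ext (conicDir_conicIdx _ _) (conicSgn_conicIdx _ _)
  right_inv i := conicIdx_eq i

/-- The sum of the coordinates of a tuple of symbols over the two conic classes `±ε_d`. -/
def psum (f : Fin ν → Fin 5 × Fin 5) (d : Fin 5) : Symbols a b ν →ₗ[ℂ] ℂ :=
  ∑ e : ℤˣ, coef hab (conicIdx d e) f

lemma psum_apply (f : Fin ν → Fin 5 × Fin 5) (d : Fin 5) (Ω : Symbols a b ν) :
    psum hab f d Ω = ∑ e : ℤˣ, coef hab (conicIdx d e) f Ω := by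
  simp [psum]

lemma sum_psum {Ω : Symbols a b ν} (h : Ω ∈ HLogAR a b ν) (f : Fin ν → Fin 5 × Fin 5) :
    ∑ d, psum hab f d Ω = 0 := by
  rw [← sum_coef hab h f]
  simp only [psum_apply]
  rw [← Fintype.sum_prod_type', ← Equiv.sum_comp conicProd]
  rfl

lemma psum_eq_zero {f : Fin ν → Fin 5 × Fin 5} {d : Fin 5} {n : Fin ν}
    (h : d = (f n).1 ∨ d = (f n).2) (Ω : Symbols a b ν) : psum hab f d Ω = 0 := by
  rw [psum_apply]
  refine Finset.sum_eq_zero fun e _ => ?_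
  -- The functional in slot `n` is zero on this space, so it may be rescaled by `0` while the others
  -- are rescaled by `1`.
  rw [coef_eq_mul hab _ f f (Function.update 1 n 0), Finset.prod_eq_zero (Finset.mem_univ n),
    zero_mul]
  · simp
  · intro m
    by_cases hm : m = n
    · subst hm
      rw [Function.update_self, zero_smul]
      exact chiH_eq_zero hab (by rwa [conicDir_conicIdx])
    · rw [Function.update_of_ne hm, Pi.one_apply, one_smul]

/-- A sign at `d` merely exchanges the two classes `±ε_{σ d}`, so in the sum over both only the
signs at the indices of the pairs remain. -/
lemma psum_symbolRep {w : W} {σ : Equiv.Perm (Fin 5)} {s : Fin 5 → ℤˣ} (h : IsSigned w σ s)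
    (f : Fin ν → Fin 5 × Fin 5) (d : Fin 5) (Ω : Symbols a b ν) :
    psum hab (fun n => (σ (f n).1, σ (f n).2)) (σ d) (symbolRep hab ν w Ω) =
      (∏ n, ((s (f n).1 * s (f n).2 : ℤˣ) : ℤ) : ℂ) * psum hab f d Ω := by
  rw [psum_apply, psum_apply, Finset.mul_sum, ← Equiv.sum_comp (Equiv.mulLeft (s d))]
  refine Finset.sum_congr rfl fun e _ => ?_
  rw [← coef_symbolRep hab h, h.conicMap]
  rfl

end DP4
end

noncomputable section

namespace DP4

/-! ### Abelian relations as functions on the symmetric group -/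

variable {a b : ℂ} (hab : a * b * (a - 1) * (b - 1) * (a - b) ≠ 0) {ν : ℕ}

/-- The function on the symmetric group formed by the sums of coordinates with slots given by
the pattern `k`. -/
def model (k : Fin ν → Fin 5 × Fin 5) : Symbols a b ν →ₗ[ℂ] Equiv.Perm (Fin 5) → ℂ :=
  LinearMap.pi fun θ => psum hab (fun n => (θ (k n).1, θ (k n).2)) (θ 0)

lemma model_apply (k : Fin ν → Fin 5 × Fin 5) (Ω : Symbols a b ν) (θ : Equiv.Perm (Fin 5)) :
    model hab k Ω θ = psum hab (fun n => (θ (k n).1, θ (k n).2)) (θ 0) Ω := rfl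

lemma model_symbolRep {w : W} {σ : Equiv.Perm (Fin 5)} {s : Fin 5 → ℤˣ} (h : IsSigned w σ s)
    (k : Fin ν → Fin 5 × Fin 5) (Ω : Symbols a b ν) (θ : Equiv.Perm (Fin 5)) :
    model hab k (symbolRep hab ν w Ω) (σ * θ) =
      (∏ n, ((s (θ (k n).1) * s (θ (k n).2) : ℤˣ) : ℤ) : ℂ) * model hab k Ω θ := by
  rw [model_apply, model_apply]
  exact psum_symbolRep hab h (fun n => (θ (k n).1, θ (k n).2)) (θ 0) Ω

/-- The pairs `p` and `q` are complementary in `{1, 2, 3, 4}`. -/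
def IsCompl₂ (p q : Fin 5 × Fin 5) : Prop :=
  ∃ π : Equiv.Perm (Fin 5), π 0 = 0 ∧ π 1 = q.1 ∧ π 2 = q.2 ∧ π 3 = p.1 ∧ π 4 = p.2

instance : DecidableRel IsCompl₂ := fun p q => by unfold IsCompl₂; infer_instance

/-- The pairs `p` and `q` agree up to order or, if `c` holds, are complementary. -/
def SlotRel (c : Bool) (p q : Fin 5 × Fin 5) : Prop :=
  if c then IsCompl₂ p q else p = q ∨ p = q.swap

instance (c : Bool) : DecidableRel (SlotRel c) := fun p q => by unfold SlotRel; infer_instance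

lemma chiH_slotRel {c : Bool} {p q : Fin 5 × Fin 5} (h : SlotRel c p q) (e : ℤˣ)
    (θ : Equiv.Perm (Fin 5)) :
    chiH (a := a) (b := b) hab (conicIdx (θ 0) e) (θ p.1, θ p.2) =
      (((if c then -e else 1 : ℤˣ) : ℤ) : ℂ) • chiH hab (conicIdx (θ 0) e) (θ q.1, θ q.2) := by
  cases c with
  | false =>
    obtain rfl | rfl : p = q ∨ p = q.swap := by simpa [SlotRel] using h
    · simp
    · simpa using chiH_symm hab _ _ _
  | true =>
    obtain ⟨π, h0, h1, h2, h3, h4⟩ : IsCompl₂ p q := by simpa [SlotRel] using h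
    have := chiH_partner (a := a) (b := b) hab (i := conicIdx (θ 0) e) (θ * π)
      (by simp [h0, conicDir_conicIdx])
    simpa [h1, h2, h3, h4, conicSgn_conicIdx] using this

lemma coef_slotRel {k k' : Fin ν → Fin 5 × Fin 5} (c : Fin ν → Bool)
    (h : ∀ n, SlotRel (c n) (k n) (k' n)) (e : ℤˣ) (θ : Equiv.Perm (Fin 5)) (Ω : Symbols a b ν) :
    coef hab (conicIdx (θ 0) e) (fun n => (θ (k n).1, θ (k n).2)) Ω =
      (((∏ n, if c n then -e else 1 : ℤˣ) : ℤ) : ℂ) *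
        coef hab (conicIdx (θ 0) e) (fun n => (θ (k' n).1, θ (k' n).2)) Ω := by
  rw [coef_eq_mul hab _ _ _ _ fun n => chiH_slotRel hab (h n) e θ]
  push_cast
  rfl

/-- The values of two patterns agree if they differ by symmetries and by an even number of
exchanges of complementary pairs. -/
lemma model_congr {k k' : Fin ν → Fin 5 × Fin 5} (π : Equiv.Perm (Fin 5)) (c : Fin ν → Bool)
    (h : π 0 = 0 ∧ (∀ n, SlotRel (c n) (π (k n).1, π (k n).2) (k' n)) ∧
      ∀ e : ℤˣ, (∏ n, if c n then -e else 1) = 1) (Ω : Symbols a b ν) (θ : Equiv.Perm (Fin 5)) :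
    model hab k Ω (θ * π) = model hab k' Ω θ := by
  rw [model_apply, model_apply, psum_apply, psum_apply]
  refine Finset.sum_congr rfl fun e _ => ?_
  have := coef_slotRel hab c h.2.1 e θ Ω
  rw [h.2.2 e, Units.val_one, Int.cast_one, one_mul] at this
  rw [← this, Equiv.Perm.mul_apply, h.1]
  rfl

lemma sum_model {Ω : Symbols a b ν} (h : Ω ∈ HLogAR a b ν) (k : Fin ν → Fin 5 × Fin 5)
    (θ : Equiv.Perm (Fin 5)) :
    ∑ d, psum hab (fun n => (θ (k n).1, θ (k n).2)) (θ d) Ω = 0 := by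
  rw [Equiv.sum_comp θ fun d => psum hab (fun n => (θ (k n).1, θ (k n).2)) d Ω, sum_psum hab h]

lemma psum_pattern_eq_zero (k : Fin ν → Fin 5 × Fin 5) (d : Fin 5)
    (h : ∃ n, d = (k n).1 ∨ d = (k n).2) (Ω : Symbols a b ν) (θ : Equiv.Perm (Fin 5)) :
    psum hab (fun n => (θ (k n).1, θ (k n).2)) (θ d) Ω = 0 := by
  obtain ⟨n, hn⟩ := h
  exact psum_eq_zero hab (n := n) (hn.imp (congrArg θ) (congrArg θ)) Ω

lemma psum_pattern_eq_model (k : Fin ν → Fin 5 × Fin 5) (d : Fin 5)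
    (h : ∀ n, (k n).1 ≠ 0 ∧ (k n).2 ≠ 0 ∧ (k n).1 ≠ d ∧ (k n).2 ≠ d) (Ω : Symbols a b ν)
    (θ : Equiv.Perm (Fin 5)) :
    psum hab (fun n => (θ (k n).1, θ (k n).2)) (θ d) Ω = model hab k Ω (θ * Equiv.swap 0 d) := by
  rw [model_apply]
  congr 3
  · funext n
    obtain ⟨h1, h2, h3, h4⟩ := h n
    simp [Equiv.swap_apply_of_ne_of_ne, *]

/-- In the relation `∑_d psum f d = 0`, the term of `d` vanishes as soon as `d` occurs in the
pattern; here just one term is left. -/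
lemma model_eq_zero_of_cover {Ω : Symbols a b ν} (h : Ω ∈ HLogAR a b ν)
    (k : Fin ν → Fin 5 × Fin 5) (hk : ∀ d, d ≠ 0 → ∃ n, d = (k n).1 ∨ d = (k n).2)
    (θ : Equiv.Perm (Fin 5)) : model hab k Ω θ = 0 := by
  have := sum_model hab h k θ
  rwa [Finset.sum_eq_single_of_mem 0 (Finset.mem_univ _)
    fun d _ hd => psum_pattern_eq_zero hab k d (hk d hd) Ω θ] at this

/-- A pattern on the indices `1, 2` leaves the terms of `0, 3, 4` in the relation. The last two are
values of the same model after exchanging `0` with the missing index. -/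
lemma model_add_model₃ {Ω : Symbols a b ν} (h : Ω ∈ HLogAR a b ν)
    (k : Fin ν → Fin 5 × Fin 5)
    (hk : (∀ d : Fin 5, d = 1 ∨ d = 2 → ∃ n, d = (k n).1 ∨ d = (k n).2) ∧
      ∀ n, ((k n).1 = 1 ∨ (k n).1 = 2) ∧ ((k n).2 = 1 ∨ (k n).2 = 2))
    (θ : Equiv.Perm (Fin 5)) : model hab k Ω θ + model hab k Ω (θ * Equiv.swap 0 3) +
      model hab k Ω (θ * Equiv.swap 0 4) = 0 := by
  have := sum_model hab h k θ
  rw [Fin.sum_univ_five, psum_pattern_eq_zero hab k 1 (hk.1 1 (Or.inl rfl)),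
    psum_pattern_eq_zero hab k 2 (hk.1 2 (Or.inr rfl)), psum_pattern_eq_model hab k 3,
    psum_pattern_eq_model hab k 4] at this
  · simpa using! this
  all_goals
    intro n
    obtain ⟨h1 | h1, h2 | h2⟩ := hk.2 n <;> rw [h1, h2] <;> decide

/-- A pattern on `1, 2, 3` leaves the two terms of `0` and `4`. -/
lemma model_add_model₂ {Ω : Symbols a b ν} (h : Ω ∈ HLogAR a b ν)
    (k : Fin ν → Fin 5 × Fin 5)
    (hk : (∀ d : Fin 5, d = 1 ∨ d = 2 ∨ d = 3 → ∃ n, d = (k n).1 ∨ d = (k n).2) ∧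
      ∀ n, ((k n).1 ≠ 0 ∧ (k n).1 ≠ 4) ∧ ((k n).2 ≠ 0 ∧ (k n).2 ≠ 4))
    (θ : Equiv.Perm (Fin 5)) : model hab k Ω (θ * Equiv.swap 0 4) = -model hab k Ω θ := by
  have := sum_model hab h k θ
  rw [Fin.sum_univ_five, psum_pattern_eq_zero hab k 1 (hk.1 1 (by decide)),
    psum_pattern_eq_zero hab k 2 (hk.1 2 (by decide)),
    psum_pattern_eq_zero hab k 3 (hk.1 3 (by decide)), psum_pattern_eq_model hab k 4
      fun n => ⟨(hk.2 n).1.1, (hk.2 n).2.1, (hk.2 n).1.2, (hk.2 n).2.2⟩] at this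
  rw [eq_neg_iff_add_eq_zero, add_comm]
  simpa using! this

/-- The three pairs `{1, x}` or, if `c` holds, their complements. -/
def slot (c : Bool) (x : Fin 3) : Fin 5 × Fin 5 :=
  if c then ![(3, 4), (2, 4), (2, 3)] x else ![(1, 2), (1, 3), (1, 4)] x

/-- Replacing slots by their complements multiplies the coordinate at `e ε_d` by a power of `-e`. An
even number of replacements computes `F(1) + F(-1)`, an odd number `F(-1) - F(1)`; if both vanish,
so do the coordinates at each of the two classes. -/
lemma eq_zero_of_model (Ω : Symbols a b ν)
    (h : ∀ (k : Fin ν → Fin 3) (o : Bool), ∃ c : Fin ν → Bool,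
      (∀ e : ℤˣ, (∏ n, if c n then -e else 1) = if o then -e else 1) ∧
        model hab (fun n => slot (c n) (k n)) Ω = 0) : Ω = 0 := by
  refine eq_zero_of_coef hab Ω fun i => ?_
  refine ⟨Equiv.swap 0 (conicDir i), Equiv.swap_apply_left _ _, fun k => ?_⟩
  set θ := Equiv.swap 0 (conicDir i) with hθ
  set F : ℤˣ → ℂ := fun e => coef hab (conicIdx (θ 0) e)
    (fun n => (θ (slot false (k n)).1, θ (slot false (k n)).2)) Ω with hF
  have hslot : ∀ c x, SlotRel c (slot c x) (slot false x) := by decide +kernel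
  have hsum : ∀ o : Bool, ∑ e : ℤˣ, (((if o then -e else 1 : ℤˣ) : ℤ) : ℂ) * F e = 0 := by
    intro o
    obtain ⟨c, hc, hm⟩ := h k o
    have := congrFun hm θ
    rw [model_apply, psum_apply] at this
    rw [← show _ = (0 : ℂ) from this]
    refine Finset.sum_congr rfl fun e _ => ?_
    rw [coef_slotRel hab c (fun n => hslot (c n) (k n)), hc]
  have h0 := hsum false
  have h1 := hsum true
  have hu : (Finset.univ : Finset ℤˣ) = {1, -1} := rfl
  rw [hu, Finset.sum_pair (by decide)] at h0 h1
  simp only [Bool.false_eq_true, if_false, if_true, neg_neg, Units.val_one, Units.val_neg,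
    Int.cast_one, Int.cast_neg, one_mul, neg_mul] at h0 h1
  have h2 : F 1 = 0 := by linear_combination (h0 - h1) / 2
  have h3 : F (-1) = 0 := by linear_combination (h0 + h1) / 2
  have hFe : F (conicSgn i) = 0 := by
    rcases Int.units_eq_one_or (conicSgn i) with h | h <;> rw [h] <;> assumption
  simp only [hF] at hFe
  have hi : conicIdx (θ 0) (conicSgn i) = i := by
    rw [hθ, Equiv.swap_apply_left, conicIdx_eq]
  rw [hi] at hFe
  rw [← hFe]
  congr 2
  funext n
  generalize k n = x
  fin_cases x <;> rfl

end DP4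
end

noncomputable section

namespace DP4

variable {a b : ℂ} (hab : a * b * (a - 1) * (b - 1) * (a - b) ≠ 0) {ν : ℕ}

/-! ### The patterns in weights one, two and three -/

/-- The pattern `{1, 2}`. -/
def edge : Fin 1 → Fin 5 × Fin 5 := ![(1, 2)]

/-- The pattern `{1, 2} ⊗ {1, 3}`. -/
def wedge : Fin 2 → Fin 5 × Fin 5 := ![(1, 2), (1, 3)]

/-- The pattern `{1, 2} ⊗ {1, 2}`. -/
def doubleEdge : Fin 2 → Fin 5 × Fin 5 := ![(1, 2), (1, 2)]

/-- The pattern `{1, 2} ⊗ {1, 3} ⊗ {2, 3}`. -/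
def triangle : Fin 3 → Fin 5 × Fin 5 := ![(1, 2), (1, 3), (2, 3)]

/-- The first pattern can be moved to the second one by a permutation. -/
def CanMove (k k' : Fin ν → Fin 5 × Fin 5) : Prop :=
  ∃ π : Equiv.Perm (Fin 5), π 0 = 0 ∧ (∀ n, SlotRel false (π (k n).1, π (k n).2) (k' n))

instance (k k' : Fin ν → Fin 5 × Fin 5) : Decidable (CanMove k k') := by
  unfold CanMove; infer_instance

lemma model_eq_zero_of_canMove {k k' : Fin ν → Fin 5 × Fin 5} (hk : CanMove k k')
    {Ω : Symbols a b ν} (h : model hab k Ω = 0) : model hab k' Ω = 0 := by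
  obtain ⟨π, h0, h1⟩ := hk
  funext θ
  rw [← model_congr hab π (fun _ => false) ⟨h0, h1, by simp⟩, h]
  rfl

/-- The indices `1, 2, 3, 4` all occur in the pattern. -/
def Covers (k : Fin ν → Fin 5 × Fin 5) : Prop :=
  ∀ d : Fin 5, d ≠ 0 → ∃ n, d = (k n).1 ∨ d = (k n).2

instance (k : Fin ν → Fin 5 × Fin 5) : Decidable (Covers k) := by
  unfold Covers; infer_instance

lemma eq_zero_of_model_edge (Ω : Symbols a b 1) (h : model hab edge Ω = 0) : Ω = 0 := by
  refine eq_zero_of_model hab Ω fun k o => ?_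
  have : ∀ (k : Fin 1 → Fin 3) (o : Bool), CanMove edge fun n => slot o (k n) := by
    decide +kernel
  exact ⟨fun _ => o, by simp, model_eq_zero_of_canMove hab (this k o) h⟩

/-- For each parity, the slots can be complemented so that the pattern covers `{1, 2, 3, 4}`, and
hence gives zero, or becomes a double edge or a wedge. -/
lemma eq_zero_of_model_wedge {Ω : Symbols a b 2} (hΩ : Ω ∈ HLogAR a b 2)
    (h : model hab wedge Ω = 0) (h' : model hab doubleEdge Ω = 0) : Ω = 0 := by
  refine eq_zero_of_model hab Ω fun k o => ?_
  have : ∀ (k : Fin 2 → Fin 3) (o : Bool), ∃ c : Fin 2 → Bool,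
      (∀ e : ℤˣ, (∏ n, if c n then -e else 1) = if o then -e else 1) ∧
      (Covers (fun n => slot (c n) (k n)) ∨ CanMove doubleEdge (fun n => slot (c n) (k n)) ∨
        CanMove wedge fun n => slot (c n) (k n)) := by
    decide +kernel
  obtain ⟨c, hc, h1 | h1 | h1⟩ := this k o
  · exact ⟨c, hc, funext fun θ => model_eq_zero_of_cover hab hΩ _ h1 θ⟩
  · exact ⟨c, hc, model_eq_zero_of_canMove hab h1 h'⟩
  · exact ⟨c, hc, model_eq_zero_of_canMove hab h1 h⟩

/-- The same reduction in weight three leaves only covering patterns and triangles. -/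
lemma eq_zero_of_model_triangle {Ω : Symbols a b 3} (hΩ : Ω ∈ HLogAR a b 3)
    (h : model hab triangle Ω = 0) : Ω = 0 := by
  refine eq_zero_of_model hab Ω fun k o => ?_
  have : ∀ (k : Fin 3 → Fin 3) (o : Bool), ∃ c : Fin 3 → Bool,
      (∀ e : ℤˣ, (∏ n, if c n then -e else 1) = if o then -e else 1) ∧
      (Covers (fun n => slot (c n) (k n)) ∨ CanMove triangle fun n => slot (c n) (k n)) := by
    decide +kernel
  obtain ⟨c, hc, h1 | h1⟩ := this k o
  · exact ⟨c, hc, funext fun θ => model_eq_zero_of_cover hab hΩ _ h1 θ⟩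
  · exact ⟨c, hc, model_eq_zero_of_canMove hab h1 h⟩

/-! ### Linear equations satisfied by the models. -/

/-- The functions `u` with `u (θ π) = c u (θ)`. -/
def rightEigen (π : Equiv.Perm (Fin 5)) (c : ℂ) : Submodule ℂ (Equiv.Perm (Fin 5) → ℂ) where
  carrier := {u | ∀ θ, u (θ * π) = c * u θ}
  add_mem' hu hv θ := by rw [Pi.add_apply, Pi.add_apply, hu, hv, mul_add]
  zero_mem' θ := by simp
  smul_mem' t u hu θ := by rw [Pi.smul_apply, Pi.smul_apply, hu, smul_eq_mul, smul_eq_mul]; ring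

/-- The functions `u` with `u (θ) + u (θ (0 3)) + u (θ (0 4)) = 0`. -/
def rightSum : Submodule ℂ (Equiv.Perm (Fin 5) → ℂ) where
  carrier := {u | ∀ θ, u θ + u (θ * Equiv.swap 0 3) + u (θ * Equiv.swap 0 4) = 0}
  add_mem' {u v} hu hv θ := by
    simp only [Pi.add_apply]
    linear_combination hu θ + hv θ
  zero_mem' θ := by simp
  smul_mem' t u hu θ := by
    simp only [Pi.smul_apply, smul_eq_mul]
    linear_combination t * hu θ

/-- The model of the abelian relations of weight one. -/
def edgeSpace : Submodule ℂ (Equiv.Perm (Fin 5) → ℂ) :=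
  rightEigen (Equiv.swap 1 2) 1 ⊓ rightEigen (Equiv.swap 3 4) 1 ⊓ rightSum

/-- The model of the antisymmetric abelian relations of weight two. -/
def wedgeSpace : Submodule ℂ (Equiv.Perm (Fin 5) → ℂ) :=
  rightEigen (Equiv.swap 0 4) (-1) ⊓ rightEigen (Equiv.swap 1 4) (-1) ⊓
    rightEigen (Equiv.swap 2 3) (-1)

/-- The model of the symmetric abelian relations of weight two. -/
def doubleEdgeSpace : Submodule ℂ (Equiv.Perm (Fin 5) → ℂ) :=
  rightEigen (Equiv.swap 1 2) 1 ⊓ rightEigen (Equiv.swap 3 4) 1 ⊓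
    rightEigen (Equiv.swap 1 3 * Equiv.swap 2 4) 1 ⊓ rightSum

/-- The model of the abelian relations of weight three. -/
def triangleSpace : Submodule ℂ (Equiv.Perm (Fin 5) → ℂ) :=
  rightEigen (Equiv.swap 0 4) (-1) ⊓ rightEigen (Equiv.swap 1 4 * Equiv.swap 2 3) 1 ⊓
    rightEigen (Equiv.swap 1 3 * Equiv.swap 2 4) 1

lemma mem_rightEigen_of_model {k : Fin ν → Fin 5 × Fin 5} (π : Equiv.Perm (Fin 5))
    (c : Fin ν → Bool) (h : π 0 = 0 ∧ (∀ n, SlotRel (c n) (π (k n).1, π (k n).2) (k n)) ∧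
      ∀ e : ℤˣ, (∏ n, if c n then -e else 1) = 1) (Ω : Symbols a b ν) :
    model hab k Ω ∈ rightEigen π 1 := fun θ => by
  rw [model_congr hab π c h Ω θ, one_mul]

lemma model_edge_mem {Ω : Symbols a b 1} (hΩ : Ω ∈ HLogAR a b 1) :
    model hab edge Ω ∈ edgeSpace :=
  ⟨⟨mem_rightEigen_of_model hab _ ![false] (by decide +kernel) Ω,
    mem_rightEigen_of_model hab _ ![false] (by decide +kernel) Ω⟩,
    model_add_model₃ hab hΩ edge (by decide)⟩

lemma model_triangle_mem {Ω : Symbols a b 3} (hΩ : Ω ∈ HLogAR a b 3) :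
    model hab triangle Ω ∈ triangleSpace :=
  ⟨⟨fun θ => by rw [model_add_model₂ hab hΩ triangle (by decide), neg_one_mul],
    mem_rightEigen_of_model hab _ ![true, true, false] (by decide +kernel) Ω⟩,
    mem_rightEigen_of_model hab _ ![true, false, true] (by decide +kernel) Ω⟩

lemma model_swap (p q : Fin 5 × Fin 5) {Ω : Symbols a b 2} {c : ℂ}
    (h : ∀ i, swap₂ (Hc a b i) (Ω i) = c • Ω i) (θ : Equiv.Perm (Fin 5)) :
    model hab ![q, p] Ω θ = c * model hab ![p, q] Ω θ := by
  rw [model_apply, model_apply, psum_apply, psum_apply, Finset.mul_sum]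
  refine Finset.sum_congr rfl fun e _ => ?_
  have := coef_swap₂ hab (conicIdx (θ 0) e) (θ p.1, θ p.2) (θ q.1, θ q.2) Ω c (h _)
  have e : ∀ p q : Fin 5 × Fin 5, (fun n => (θ (![p, q] n).1, θ (![p, q] n).2)) =
      ![(θ p.1, θ p.2), (θ q.1, θ q.2)] := fun p q => by funext n; fin_cases n <;> rfl
  rw [e, e, this]

lemma model_wedge_swap {Ω : Symbols a b 2} {c : ℂ}
    (h : ∀ i, swap₂ (Hc a b i) (Ω i) = c • Ω i) :
    model hab wedge Ω ∈ rightEigen (Equiv.swap 2 3) c :=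
  fun θ => by
    rw [model_congr hab (k' := ![(1, 3), (1, 2)]) (Equiv.swap 2 3) ![false, false]
      (by decide +kernel), model_swap hab (1, 2) (1, 3) h]
    rfl

lemma model_wedge_rightEigen {Ω : Symbols a b 2} (hΩ : Ω ∈ HLogAR a b 2) :
    model hab wedge Ω ∈ rightEigen (Equiv.swap 0 4) (-1) ⊓
      rightEigen (Equiv.swap 1 4 * Equiv.swap 2 3) 1 :=
  ⟨fun θ => by rw [model_add_model₂ hab hΩ wedge (by decide), neg_one_mul],
    mem_rightEigen_of_model hab _ ![true, true] (by decide +kernel) Ω⟩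

lemma rightEigen_mul {u : Equiv.Perm (Fin 5) → ℂ} {π ρ : Equiv.Perm (Fin 5)} {c d : ℂ}
    (hπ : u ∈ rightEigen π c) (hρ : u ∈ rightEigen ρ d) : u ∈ rightEigen (π * ρ) (c * d) :=
  fun θ => by rw [← mul_assoc, hρ, hπ]; ring

/-- Complementing both slots gives eigenvalue `1` for `(1 4)(2 3)`, and exchanging the tensor
factors gives `-1` for `(2 3)`; the product of the two is `(1 4)`, with eigenvalue `-1`. -/
lemma model_wedge_mem {Ω : Symbols a b 2} (hΩ : Ω ∈ HLogARasym a b) :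
    model hab wedge Ω ∈ wedgeSpace := by
  rw [mem_HLogARasym] at hΩ
  obtain ⟨h1, h2⟩ := model_wedge_rightEigen hab hΩ.1
  have h3 := model_wedge_swap hab hΩ.2
  refine ⟨⟨h1, ?_⟩, h3⟩
  simpa [mul_assoc] using rightEigen_mul h2 h3

/-- In the symmetric case `(1 4)` has eigenvalue `1` while `(0 4)` has `-1`. The braid relation
between these two conjugate transpositions forces the function to equal its negative. -/
lemma model_wedge_eq_zero {Ω : Symbols a b 2} (hΩ : Ω ∈ HLogARsym a b) :
    model hab wedge Ω = 0 := by
  rw [mem_HLogARsym] at hΩ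
  obtain ⟨h1, h2⟩ := model_wedge_rightEigen hab hΩ.1
  have h3 := model_wedge_swap hab hΩ.2
  have h4 : model hab wedge Ω ∈ rightEigen (Equiv.swap 1 4) 1 := by
    simpa [mul_assoc] using rightEigen_mul h2 h3
  have h5 := rightEigen_mul (rightEigen_mul h4 h1) h4
  have h6 := rightEigen_mul (rightEigen_mul h1 h4) h1
  rw [show Equiv.swap (1 : Fin 5) 4 * Equiv.swap 0 4 * Equiv.swap 1 4 =
    Equiv.swap 0 4 * Equiv.swap 1 4 * Equiv.swap 0 4 by decide +kernel] at h5
  funext θ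
  have h7 := (h5 θ).symm.trans (h6 θ)
  rw [Pi.zero_apply]
  linear_combination -(1 / 2 : ℂ) * h7

lemma model_doubleEdge_mem {Ω : Symbols a b 2} (hΩ : Ω ∈ HLogAR a b 2) :
    model hab doubleEdge Ω ∈ doubleEdgeSpace :=
  ⟨⟨⟨mem_rightEigen_of_model hab _ ![false, false] (by decide +kernel) Ω,
    mem_rightEigen_of_model hab _ ![false, false] (by decide +kernel) Ω⟩,
    mem_rightEigen_of_model hab _ ![true, true] (by decide +kernel) Ω⟩,
    model_add_model₃ hab hΩ doubleEdge (by decide)⟩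

lemma model_doubleEdge_eq_zero {Ω : Symbols a b 2} (hΩ : Ω ∈ HLogARasym a b) :
    model hab doubleEdge Ω = 0 := by
  rw [mem_HLogARasym] at hΩ
  funext θ
  have := model_swap hab (1, 2) (1, 2) hΩ.2 θ
  rw [Pi.zero_apply]
  change model hab doubleEdge Ω θ = -1 * model hab doubleEdge Ω θ at this
  linear_combination (1 / 2 : ℂ) * this

/-- Conjugating `(0 4)` by the double transpositions, which act trivially, yields eigenvalue `-1`
for every `(0 i)`, hence for all adjacent transpositions, which generate the group. -/
lemma triangleSpace_apply {u : Equiv.Perm (Fin 5) → ℂ} (hu : u ∈ triangleSpace)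
    (θ : Equiv.Perm (Fin 5)) : u θ = (Equiv.Perm.sign θ : ℤ) * u 1 := by
  obtain ⟨⟨h1, h2⟩, h3⟩ := hu
  have e1 : u ∈ rightEigen (Equiv.swap 0 1) (-1) := by
    have := rightEigen_mul (rightEigen_mul h2 h1) h2
    rwa [show Equiv.swap (1 : Fin 5) 4 * Equiv.swap 2 3 * Equiv.swap 0 4 *
      (Equiv.swap 1 4 * Equiv.swap 2 3) = Equiv.swap 0 1 by decide +kernel,
      show (1 : ℂ) * -1 * 1 = -1 by norm_num] at this
  have e2 : u ∈ rightEigen (Equiv.swap 0 2) (-1) := by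
    have := rightEigen_mul (rightEigen_mul h3 h1) h3
    rwa [show Equiv.swap (1 : Fin 5) 3 * Equiv.swap 2 4 * Equiv.swap 0 4 *
      (Equiv.swap 1 3 * Equiv.swap 2 4) = Equiv.swap 0 2 by decide +kernel,
      show (1 : ℂ) * -1 * 1 = -1 by norm_num] at this
  have e3 : u ∈ rightEigen (Equiv.swap 0 3) (-1) := by
    have := rightEigen_mul (rightEigen_mul h2 e2) h2
    rwa [show Equiv.swap (1 : Fin 5) 4 * Equiv.swap 2 3 * Equiv.swap 0 2 *
      (Equiv.swap 1 4 * Equiv.swap 2 3) = Equiv.swap 0 3 by decide +kernel,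
      show (1 : ℂ) * -1 * 1 = -1 by norm_num] at this
  have key : ∀ i : Fin 5, i ≠ 0 → u ∈ rightEigen (Equiv.swap 0 i) (-1) := by
    intro i hi
    fin_cases i
    exacts [(hi rfl).elim, e1, e2, e3, h1]
  have hadj : ∀ i : Fin 4, ∀ ρ, u (ρ * Equiv.swap i.castSucc i.succ) = -u ρ := by
    intro i ρ
    by_cases hi : i.castSucc = 0
    · rw [hi, key _ (Fin.succ_ne_zero i), neg_one_mul]
    · have h := rightEigen_mul (rightEigen_mul (key _ hi) (key _ (Fin.succ_ne_zero i))) (key _ hi) ρ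
      have hc : ∀ i : Fin 4, i.castSucc ≠ 0 → Equiv.swap 0 i.castSucc * Equiv.swap 0 i.succ *
        Equiv.swap 0 i.castSucc = Equiv.swap i.castSucc i.succ := by decide +kernel
      rw [← hc i hi, h]
      ring
  have hθ : θ ∈ Submonoid.closure (Set.range fun i : Fin 4 => Equiv.swap i.castSucc i.succ) :=
    Equiv.Perm.mclosure_swap_castSucc_succ 4 ▸ Submonoid.mem_top θ
  induction hθ using Submonoid.closure_induction_right with
  | one => simp
  | mul_right x _ y hy ih =>
    obtain ⟨i, rfl⟩ := hy
    rw [hadj, ih, Equiv.Perm.sign_mul, Equiv.Perm.sign_swap (Fin.castSucc_lt_succ).ne]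
    simp

end DP4
end

noncomputable section

namespace DP4

/-! ### Irreducible spaces of functions on the symmetric group -/

/-- The function `e` is, up to a scalar, a primitive idempotent with right translates spanning
the space `S`. -/
structure IsKernel (S : Submodule ℂ (Equiv.Perm (Fin 5) → ℂ)) (D : Finset (Equiv.Perm (Fin 5)))
    (A : Equiv.Perm (Fin 5) → Prop) (e : Equiv.Perm (Fin 5) → ℤ) : Prop where
  apply_inv : ∀ θ, e θ⁻¹ = e θ
  apply_mul : ∀ d ∈ D, ∀ θ, e (d * θ) = e θ
  mem_mul : ∀ d ∈ D, ∀ θ, A (d * θ) ↔ A θ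
  support : ∀ θ, ¬ A θ → e θ = 0
  sum_mul : ∀ u ∈ S, ∀ θ, A θ → ∑ d ∈ D, u (d * θ) = u 1 * e θ
  mem : (fun θ => (e θ : ℂ)) ∈ S
  translate : ∀ u ∈ S, ∀ g, (fun θ => u (g * θ)) ∈ S
  sum_sq_ne : ∑ θ, e θ ^ 2 ≠ 0

section Kernel

variable {S : Submodule ℂ (Equiv.Perm (Fin 5) → ℂ)} {D : Finset (Equiv.Perm (Fin 5))}
  {A : Equiv.Perm (Fin 5) → Prop} {e : Equiv.Perm (Fin 5) → ℤ}

/-- As `e` is invariant under left translation by `D`, `u` may be replaced by its sum over `D`,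
which equals `u 1 • e` wherever `e` does not vanish. -/
lemma IsKernel.sum_mul_self (h : IsKernel S D A e) {u : Equiv.Perm (Fin 5) → ℂ} (hu : u ∈ S) :
    (D.card : ℂ) * ∑ θ, u θ * e θ = u 1 * ∑ θ, (e θ : ℂ) ^ 2 := by
  have h1 : ∀ d ∈ D, ∑ θ, u θ * e θ = ∑ θ, u (d * θ) * e θ := by
    intro d hd
    rw [← Equiv.sum_comp (Equiv.mulLeft d)]
    refine Finset.sum_congr rfl fun θ _ => ?_
    rw [Equiv.coe_mulLeft, h.apply_mul d hd]
  rw [← nsmul_eq_mul, ← Finset.sum_const, Finset.sum_congr rfl h1, Finset.sum_comm, Finset.mul_sum]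
  refine Finset.sum_congr rfl fun θ _ => ?_
  rw [← Finset.sum_mul]
  by_cases hK : A θ
  · rw [h.sum_mul u hu θ hK]
    ring
  · rw [h.support θ hK]
    simp

/-- The scalar product with `e`, applied to translates of `u`, is a convolution because `e` is
invariant under inversion. So `e` reproduces `S` up to a scalar. -/
lemma IsKernel.convolution (h : IsKernel S D A e) {u : Equiv.Perm (Fin 5) → ℂ} (hu : u ∈ S)
    (θ : Equiv.Perm (Fin 5)) :
    (D.card : ℂ) * ∑ g, u g * e (g⁻¹ * θ) = u θ * ∑ θ, (e θ : ℂ) ^ 2 := by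
  have h1 := h.sum_mul_self (h.translate u hu θ)
  rw [mul_one] at h1
  rw [← h1, ← Equiv.sum_comp (Equiv.mulLeft θ)]
  congr 1
  refine Finset.sum_congr rfl fun g _ => ?_
  rw [Equiv.coe_mulLeft, ← h.apply_inv]
  simp

lemma IsKernel.sum_sq_ne' (h : IsKernel S D A e) : ∑ θ, (e θ : ℂ) ^ 2 ≠ 0 := by
  exact_mod_cast h.sum_sq_ne

/-- A non-zero subspace that is stable under translations and under restriction to `A` is the whole
space. -/
lemma IsKernel.eq_of_stable (h : IsKernel S D A e)
    {U : Submodule ℂ (Equiv.Perm (Fin 5) → ℂ)} (hU : U ≤ S) (hne : U ≠ ⊥)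
    (hL : ∀ u ∈ U, ∀ g, (fun θ => u (g * θ)) ∈ U)
    (hK : ∀ u ∈ U, ∃ v ∈ U, ∀ θ, (A θ → v θ = u θ) ∧ (¬ A θ → v θ = 0)) : U = S := by
  have he : (fun θ => (e θ : ℂ)) ∈ U := by
    obtain ⟨u, hu, hu0⟩ := Submodule.exists_mem_ne_zero_of_ne_bot hne
    obtain ⟨g, hg⟩ : ∃ g, u g ≠ 0 := by
      by_contra! hc
      exact hu0 (funext hc)
    obtain ⟨v, hv, hvK⟩ := hK _ (hL u hu g)
    -- The translate by `g` moves a non-zero value to the identity; after restriction to `A`, its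
    -- sum over `D` is a non-zero multiple of `e`, so `e` lies in `U`.
    have h1 : ∑ d ∈ D, (fun θ => v (d * θ)) = u g • fun θ => (e θ : ℂ) := by
      funext θ
      rw [Finset.sum_apply, Pi.smul_apply, smul_eq_mul]
      by_cases hθ : A θ
      · have h2 := h.sum_mul _ (hU (hL u hu g)) θ hθ
        rw [mul_one] at h2
        rw [← h2]
        exact Finset.sum_congr rfl fun d hd => (hvK _).1 ((h.mem_mul d hd θ).2 hθ)
      · rw [h.support θ hθ, Int.cast_zero, mul_zero]
        exact Finset.sum_eq_zero fun d hd => (hvK _).2 fun hc => hθ ((h.mem_mul d hd θ).1 hc)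
    have h2 : u g • (fun θ => (e θ : ℂ)) ∈ U := h1 ▸ sum_mem fun d _ => hL v hv d
    exact (Submodule.smul_mem_iff _ hg).1 h2
  refine le_antisymm hU fun u hu => ?_
  have h1 : (∑ θ, (e θ : ℂ) ^ 2) • u =
      (D.card : ℂ) • ∑ g, u g • fun θ => ((e (g⁻¹ * θ) : ℤ) : ℂ) := by
    funext θ
    simp only [Pi.smul_apply, Finset.sum_apply, smul_eq_mul]
    rw [mul_comm, h.convolution hu]
  have h2 : (∑ θ, (e θ : ℂ) ^ 2) • u ∈ U := h1 ▸ Submodule.smul_mem _ _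
    (sum_mem fun g _ => Submodule.smul_mem _ _ (hL _ he g⁻¹))
  exact (Submodule.smul_mem_iff _ h.sum_sq_ne').1 h2

/-- Normalized convolution with `e` is a projection onto `S`, so the dimension is its trace. All 120
diagonal entries of the matrix are equal to the same multiple of `e 1`. -/
lemma IsKernel.finrank_eq (h : IsKernel S D A e) :
    (Module.finrank ℂ S : ℤ) * ∑ θ, e θ ^ 2 = 120 * e 1 * D.card := by
  suffices (Module.finrank ℂ S : ℂ) * ∑ θ, (e θ : ℂ) ^ 2 = 120 * e 1 * D.card by
    exact_mod_cast this
  set N := ∑ θ, (e θ : ℂ) ^ 2 with hN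
  have hN0 : N ≠ 0 := h.sum_sq_ne'
  let p : (Equiv.Perm (Fin 5) → ℂ) →ₗ[ℂ] (Equiv.Perm (Fin 5) → ℂ) :=
    (D.card / N : ℂ) • Matrix.toLin' (Matrix.of fun θ g => ((e (g⁻¹ * θ) : ℤ) : ℂ))
  have hp : ∀ v θ, p v θ = (D.card / N : ℂ) * ∑ g, v g * e (g⁻¹ * θ) := by
    intro v θ
    simp [p, Matrix.mulVec, dotProduct, mul_comm]
  have hproj : LinearMap.IsProj S p := by
    refine ⟨fun v => ?_, fun u hu => ?_⟩
    · have h1 : p v = (D.card / N : ℂ) • ∑ g, v g • fun θ => ((e (g⁻¹ * θ) : ℤ) : ℂ) := by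
        funext θ
        rw [hp]
        simp [Finset.sum_apply]
      rw [h1]
      exact Submodule.smul_mem _ _ (sum_mem fun g _ => Submodule.smul_mem _ _
        (h.translate _ h.mem g⁻¹))
    · funext θ
      rw [hp, div_mul_eq_mul_div, h.convolution hu, mul_div_assoc, div_self hN0, mul_one]
  have htr := hproj.trace
  simp only [p, map_smul, Matrix.trace_toLin'_eq] at htr
  rw [← htr]
  have hcard : Fintype.card (Equiv.Perm (Fin 5)) = 120 := by
    rw [Fintype.card_perm, Fintype.card_fin]; rfl
  simp [Matrix.trace, hcard]
  field_simp

end Kernel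

/-! ### The three kernels -/

lemma rightEigen_translate {π : Equiv.Perm (Fin 5)} {c : ℂ} {u : Equiv.Perm (Fin 5) → ℂ}
    (hu : u ∈ rightEigen π c) (g : Equiv.Perm (Fin 5)) :
    (fun θ => u (g * θ)) ∈ rightEigen π c := fun θ => by
  simpa only [mul_assoc] using hu (g * θ)

lemma rightSum_translate {u : Equiv.Perm (Fin 5) → ℂ}
    (hu : u ∈ rightSum) (g : Equiv.Perm (Fin 5)) : (fun θ => u (g * θ)) ∈ rightSum := fun θ => by
  simpa [mul_assoc] using hu (g * θ)

lemma cast_mem_rightEigen {π : Equiv.Perm (Fin 5)} (c : ℤ) {e : Equiv.Perm (Fin 5) → ℤ}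
    (h : ∀ θ, e (θ * π) = c * e θ) : (fun θ => (e θ : ℂ)) ∈ rightEigen π c := fun θ => by
  change ((e (θ * π) : ℤ) : ℂ) = c * (e θ : ℤ)
  rw [h, Int.cast_mul]

lemma cast_mem_rightSum {e : Equiv.Perm (Fin 5) → ℤ}
    (h : ∀ θ, e θ + e (θ * Equiv.swap 0 3) + e (θ * Equiv.swap 0 4) = 0) :
    (fun θ => (e θ : ℂ)) ∈ rightSum := fun θ => by
  change ((e θ : ℤ) : ℂ) + (e (θ * Equiv.swap 0 3) : ℤ) + (e (θ * Equiv.swap 0 4) : ℤ) = 0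
  exact_mod_cast h θ

/-- The kernel of the space `edgeSpace`. -/
def edgeKernel (θ : Equiv.Perm (Fin 5)) : ℤ :=
  if θ 1 ≠ 0 ∧ θ 2 ≠ 0 ∧ θ 1 < 3 ∧ θ 2 < 3 then if θ 0 = 0 then 2 else -1 else 0

/-- The kernel of the space `wedgeSpace`. -/
def wedgeKernel (θ : Equiv.Perm (Fin 5)) : ℤ :=
  if (θ 2 = 2 ∨ θ 2 = 3) ∧ (θ 3 = 2 ∨ θ 3 = 3) then Equiv.Perm.sign θ else 0

/-- The involution `(1 2) (3 4)` of the indices. -/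
def mate : Fin 5 → Fin 5 := ![0, 2, 1, 4, 3]

/-- The kernel of the space `doubleEdgeSpace`. -/
def doubleEdgeKernel (θ : Equiv.Perm (Fin 5)) : ℤ :=
  if θ 0 = 0 then if θ 2 = mate (θ 1) then 8 else -4
  else if θ (mate (θ⁻¹ 0)) = mate (θ 0) then -4 else 2

/-- The dihedral group of order eight that stabilises `{{1, 2}, {3, 4}}`. -/
def dihedral : Finset (Equiv.Perm (Fin 5)) :=
  {1, Equiv.swap 1 2, Equiv.swap 3 4, Equiv.swap 1 2 * Equiv.swap 3 4,
    Equiv.swap 1 3 * Equiv.swap 2 4, Equiv.swap 1 2 * (Equiv.swap 1 3 * Equiv.swap 2 4),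
    Equiv.swap 3 4 * (Equiv.swap 1 3 * Equiv.swap 2 4),
    Equiv.swap 1 2 * Equiv.swap 3 4 * (Equiv.swap 1 3 * Equiv.swap 2 4)}

/-- On permutations preserving `{1, 2}` from positions `1, 2`, a function of the space has only the
values at `1`, `(0 3)` and `(0 4)`, with sum zero. Left translation by `(3 4)` exchanges the last
two, so the sum over `D` is `2 u(1)` or `-u(1)`. -/
lemma isKernel_edge : IsKernel edgeSpace {1, Equiv.swap 3 4}
    (fun θ => θ 1 ≠ 0 ∧ θ 2 ≠ 0 ∧ θ 1 < 3 ∧ θ 2 < 3) edgeKernel where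
  apply_inv := by decide +kernel
  apply_mul := by decide +kernel
  mem_mul := by decide +kernel
  support θ hθ := if_neg hθ
  sum_mul u hu θ hθ := by
    obtain ⟨⟨h1, h2⟩, h3⟩ := hu
    have hR : ∀ ρ π, π ∈ ({1, Equiv.swap 1 2, Equiv.swap 3 4, Equiv.swap 1 2 * Equiv.swap 3 4} :
        Finset (Equiv.Perm (Fin 5))) → u (ρ * π) = u ρ := by
      intro ρ π hπ
      simp only [Finset.mem_insert, Finset.mem_singleton] at hπ
      obtain rfl | rfl | rfl | rfl := hπ
      · rw [mul_one]
      · rw [h1, one_mul]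
      · rw [h2, one_mul]
      · rw [← mul_assoc, h2, h1, one_mul, one_mul]
    have hcases : ∀ θ : Equiv.Perm (Fin 5), (θ 1 ≠ 0 ∧ θ 2 ≠ 0 ∧ θ 1 < 3 ∧ θ 2 < 3) →
        ∃ π ∈ ({1, Equiv.swap 1 2, Equiv.swap 3 4, Equiv.swap 1 2 * Equiv.swap 3 4} :
          Finset (Equiv.Perm (Fin 5))), ∃ π' ∈ ({1, Equiv.swap 1 2, Equiv.swap 3 4,
            Equiv.swap 1 2 * Equiv.swap 3 4} : Finset (Equiv.Perm (Fin 5))),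
        (θ = 1 * π ∧ Equiv.swap 3 4 * θ = 1 * π' ∧ edgeKernel θ = 2) ∨
        (θ = Equiv.swap 0 3 * π ∧ Equiv.swap 3 4 * θ = Equiv.swap 0 4 * π' ∧ edgeKernel θ = -1) ∨
        (θ = Equiv.swap 0 4 * π ∧ Equiv.swap 3 4 * θ = Equiv.swap 0 3 * π' ∧
          edgeKernel θ = -1) := by
      decide +kernel
    have h4 := h3 1
    rw [one_mul, one_mul] at h4
    rw [Finset.sum_pair (by decide +kernel), one_mul]
    obtain ⟨π, hπ, π', hπ', ⟨e1, e2, e3⟩ | ⟨e1, e2, e3⟩ | ⟨e1, e2, e3⟩⟩ := hcases θ hθ <;>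
    rw [e2, e3, e1, hR _ _ hπ, hR _ _ hπ'] <;> push_cast
    · ring
    · linear_combination h4
    · linear_combination h4
  mem := ⟨⟨by exact_mod_cast cast_mem_rightEigen 1 (by decide +kernel),
    by exact_mod_cast cast_mem_rightEigen 1 (by decide +kernel)⟩,
    cast_mem_rightSum (by decide +kernel)⟩
  translate u hu g := ⟨⟨rightEigen_translate hu.1.1 g, rightEigen_translate hu.1.2 g⟩,
    rightSum_translate hu.2 g⟩
  sum_sq_ne := by decide +kernel

/-- The set `A` is the subgroup `S₃ × S₂` generated by `(0 4), (1 4)` and `(2 3)`, on which the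
function is `u(1)` times the sign. No averaging is needed; the words in the generators enumerate the
subgroup. -/
lemma isKernel_wedge : IsKernel wedgeSpace {1}
    (fun θ => (θ 2 = 2 ∨ θ 2 = 3) ∧ (θ 3 = 2 ∨ θ 3 = 3)) wedgeKernel where
  apply_inv := by decide +kernel
  apply_mul := by decide +kernel
  mem_mul := by decide +kernel
  support θ hθ := if_neg hθ
  sum_mul u hu θ hθ := by
    obtain ⟨⟨h1, h2⟩, h3⟩ := hu
    have hR : ∀ i j k : Fin 2, ∀ l m : Fin 2, u ((Equiv.swap 0 4) ^ (i : ℕ) *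
        (Equiv.swap 1 4) ^ (j : ℕ) * (Equiv.swap 0 4) ^ (k : ℕ) * (Equiv.swap 1 4) ^ (l : ℕ) *
        (Equiv.swap 2 3) ^ (m : ℕ)) = (-1) ^ (i + j + k + l + m : ℕ) * u 1 := by
      have hpow : ∀ (π : Equiv.Perm (Fin 5)) (i : ℕ), u ∈ rightEigen π (-1) →
          u ∈ rightEigen (π ^ i) ((-1) ^ i) := by
        intro π i hπ
        induction i with
        | zero => intro θ; simp
        | succ i ih => rw [pow_succ, pow_succ]; exact rightEigen_mul ih hπ
      intro i j k l m
      have := rightEigen_mul (rightEigen_mul (rightEigen_mul (rightEigen_mul (hpow _ i h1)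
        (hpow _ j h2)) (hpow _ k h1)) (hpow _ l h2)) (hpow _ m h3) 1
      rw [one_mul] at this
      rw [this]
      ring
    have hcases : ∀ θ : Equiv.Perm (Fin 5), ((θ 2 = 2 ∨ θ 2 = 3) ∧ (θ 3 = 2 ∨ θ 3 = 3)) →
        ∃ i j k l m : Fin 2, (Equiv.swap 0 4) ^ (i : ℕ) *
        (Equiv.swap 1 4) ^ (j : ℕ) * (Equiv.swap 0 4) ^ (k : ℕ) * (Equiv.swap 1 4) ^ (l : ℕ) *
        (Equiv.swap 2 3) ^ (m : ℕ) = θ ∧ wedgeKernel θ = (-1) ^ (i + j + k + l + m : ℕ) := by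
      decide +kernel
    obtain ⟨i, j, k, l, m, rfl, h4⟩ := hcases θ hθ
    rw [Finset.sum_singleton, one_mul, hR, h4]
    push_cast
    ring
  mem := ⟨⟨by exact_mod_cast cast_mem_rightEigen (-1) (by decide +kernel),
    by exact_mod_cast cast_mem_rightEigen (-1) (by decide +kernel)⟩,
    by exact_mod_cast cast_mem_rightEigen (-1) (by decide +kernel)⟩
  translate u hu g := ⟨⟨rightEigen_translate hu.1.1 g, rightEigen_translate hu.1.2 g⟩,
    rightEigen_translate hu.2 g⟩
  sum_sq_ne := by decide +kernel

/-- Sign changes act trivially here, so there is no restriction and `A` is everything. The sum over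
the dihedral group is bi-invariant, thus constant on four double cosets, and the three-term
relations determine its values `8, -4, -4, 2` in units of `u(1)`. -/
lemma isKernel_doubleEdge : IsKernel doubleEdgeSpace dihedral (fun _ => True)
    doubleEdgeKernel where
  apply_inv := by decide +kernel
  apply_mul := by decide +kernel
  mem_mul _ _ _ := Iff.rfl
  support θ hθ := (hθ trivial).elim
  sum_mul u hu θ _ := by
    obtain ⟨⟨⟨h1, h2⟩, h3⟩, h4⟩ := hu
    have h3' : ∀ ρ, u (ρ * Equiv.swap 1 3 * Equiv.swap 2 4) = 1 * u ρ := fun ρ => by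
      rw [mul_assoc, h3]
    have hR : ∀ ρ π, π ∈ dihedral → u (ρ * π) = u ρ := by
      intro ρ π hπ
      simp only [dihedral, Finset.mem_insert, Finset.mem_singleton] at hπ
      obtain rfl | rfl | rfl | rfl | rfl | rfl | rfl | rfl := hπ <;>
        simp only [mul_one, ← mul_assoc ρ, h1 _, h2 _, h3 _, h3' _, one_mul]
    set q : Equiv.Perm (Fin 5) → ℂ := fun θ => ∑ d ∈ dihedral, u (d * θ) with hq
    have hqR : ∀ ρ π, π ∈ dihedral → q (ρ * π) = q ρ := by
      intro ρ π hπ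
      simp only [hq, ← mul_assoc, hR _ π hπ]
    have hqL : ∀ ρ π, π ∈ dihedral → q (π * ρ) = q ρ := by
      intro ρ π hπ
      have hD : ∀ π ∈ dihedral, ∀ x, x ∈ dihedral ↔ x * π ∈ dihedral := by decide +kernel
      simp only [hq, ← mul_assoc]
      exact Finset.sum_equiv (Equiv.mulRight π) (hD π hπ) fun x _ => rfl
    have hqs : ∀ ρ, q ρ + q (ρ * Equiv.swap 0 3) + q (ρ * Equiv.swap 0 4) = 0 := by
      intro ρ
      simp only [hq, ← Finset.sum_add_distrib, ← mul_assoc]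
      exact Finset.sum_eq_zero fun d _ => h4 _
    have hcases : ∀ θ, ∃ d ∈ dihedral, ∃ d' ∈ dihedral,
        (θ = d * 1 * d' ∧ doubleEdgeKernel θ = 8) ∨
        (θ = d * Equiv.swap 2 3 * d' ∧ doubleEdgeKernel θ = -4) ∨
        (θ = d * Equiv.swap 0 1 * d' ∧ doubleEdgeKernel θ = -4) ∨
        (θ = d * (Equiv.swap 0 1 * Equiv.swap 2 3) * d' ∧ doubleEdgeKernel θ = 2) := by
      decide +kernel
    have hmove : ∀ θ ρ : Equiv.Perm (Fin 5), (∃ d ∈ dihedral, ∃ d' ∈ dihedral, θ = d * ρ * d') →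
        q θ = q ρ := by
      rintro θ ρ ⟨d, hd, d', hd', rfl⟩
      rw [hqR _ _ hd', hqL _ _ hd]
    have q0 : q 1 = 8 * u 1 := by
      simp only [hq, mul_one]
      rw [Finset.sum_congr rfl fun d hd => (one_mul d ▸ hR 1 d hd : u d = u 1), Finset.sum_const,
        show dihedral.card = 8 by decide +kernel, nsmul_eq_mul]
      norm_num
    have r0 := hqs 1
    rw [hmove (1 * Equiv.swap 0 3) (Equiv.swap 0 1) (by decide +kernel),
      hmove (1 * Equiv.swap 0 4) (Equiv.swap 0 1) (by decide +kernel)] at r0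
    have r1 := hqs (Equiv.swap 0 1)
    rw [hmove (Equiv.swap 0 1 * Equiv.swap 0 3) (Equiv.swap 0 1 * Equiv.swap 2 3)
        (by decide +kernel),
      hmove (Equiv.swap 0 1 * Equiv.swap 0 4) (Equiv.swap 0 1 * Equiv.swap 2 3)
        (by decide +kernel)] at r1
    have r2 := hqs (Equiv.swap 2 3)
    rw [hmove (Equiv.swap 2 3 * Equiv.swap 0 3) (Equiv.swap 0 1 * Equiv.swap 2 3)
        (by decide +kernel),
      hmove (Equiv.swap 2 3 * Equiv.swap 0 4) (Equiv.swap 0 1 * Equiv.swap 2 3)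
        (by decide +kernel)] at r2
    change q θ = _
    obtain ⟨d, hd, d', hd', ⟨e1, e2⟩ | ⟨e1, e2⟩ | ⟨e1, e2⟩ | ⟨e1, e2⟩⟩ := hcases θ <;>
      rw [hmove θ _ ⟨d, hd, d', hd', e1⟩, e2] <;> push_cast
    · linear_combination q0
    · linear_combination r2 - r1 + r0 / 2 - q0 / 2
    · linear_combination r0 / 2 - q0 / 2
    · linear_combination r1 / 2 - r0 / 4 + q0 / 4
  mem := ⟨⟨⟨by exact_mod_cast cast_mem_rightEigen 1 (by decide +kernel),
    by exact_mod_cast cast_mem_rightEigen 1 (by decide +kernel)⟩,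
    by exact_mod_cast cast_mem_rightEigen 1 (by decide +kernel)⟩,
    cast_mem_rightSum (by decide +kernel)⟩
  translate u hu g := ⟨⟨⟨rightEigen_translate hu.1.1.1 g, rightEigen_translate hu.1.1.2 g⟩,
    rightEigen_translate hu.1.2 g⟩, rightSum_translate hu.2 g⟩
  sum_sq_ne := by decide +kernel

lemma finrank_edgeSpace : Module.finrank ℂ edgeSpace = 20 := by
  have h := isKernel_edge.finrank_eq
  rw [show ∑ θ, edgeKernel θ ^ 2 = 24 by decide +kernel, show edgeKernel 1 = 2 by decide +kernel,
    show ({1, Equiv.swap 3 4} : Finset (Equiv.Perm (Fin 5))).card = 2 by decide +kernel] at h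
  omega

lemma finrank_wedgeSpace : Module.finrank ℂ wedgeSpace = 10 := by
  have h := isKernel_wedge.finrank_eq
  rw [show ∑ θ, wedgeKernel θ ^ 2 = 12 by decide +kernel, show wedgeKernel 1 = 1 by decide +kernel,
    Finset.card_singleton] at h
  omega

lemma finrank_doubleEdgeSpace : Module.finrank ℂ doubleEdgeSpace = 5 := by
  have h := isKernel_doubleEdge.finrank_eq
  rw [show ∑ θ, doubleEdgeKernel θ ^ 2 = 1536 by decide +kernel,
    show doubleEdgeKernel 1 = 8 by decide +kernel, show dihedral.card = 8 by decide +kernel] at h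
  omega

end DP4
end

noncomputable section

namespace DP4

/-! ### Minimal stable subspaces and Specht modules -/

section Minimal

variable {M : Type*} [AddCommGroup M] [Module ℂ M] {τ : Representation ℂ W M}

/-- The non-zero subspace `S` contains no smaller non-zero stable subspace. -/
def IsMinimal (τ : Representation ℂ W M) (S : Submodule ℂ M) : Prop :=
  S ≠ ⊥ ∧ ∀ U ≤ S, (∀ w, ∀ x ∈ U, τ w x ∈ U) → U ≠ ⊥ → U = S

lemma IsMinimal.isIrreducible {σ : Subrepresentation τ} (h : IsMinimal τ σ.toSubmodule) :
    σ.toRepresentation.IsIrreducible := by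
  have hnt : Nontrivial (Subrepresentation σ.toRepresentation) := by
    refine ⟨⊥, ⊤, fun hc => h.1 ((Submodule.eq_bot_iff _).2 fun x hx => ?_)⟩
    have h1 : (⟨x, hx⟩ : σ.toSubmodule) ∈ (⊤ : Submodule ℂ σ.toSubmodule) := trivial
    rw [← show (⊥ : Submodule ℂ σ.toSubmodule) = ⊤ from
      congrArg Subrepresentation.toSubmodule hc, Submodule.mem_bot] at h1
    exact congrArg Subtype.val h1
  refine { eq_bot_or_eq_top := fun U => ?_ }
  by_cases hU : U.toSubmodule = ⊥
  · exact Or.inl (Subrepresentation.toSubmodule_injective hU)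
  refine Or.inr (Subrepresentation.toSubmodule_injective ?_)
  have h1 := h.2 (U.toSubmodule.map σ.toSubmodule.subtype) (Submodule.map_subtype_le _ _) (by
    rintro w _ ⟨x, hx, rfl⟩
    exact ⟨σ.toRepresentation w x, U.apply_mem_toSubmodule w hx, rfl⟩) fun hc => hU (by
      refine (Submodule.eq_bot_iff _).2 fun x hx => Subtype.ext ?_
      have h2 : (x : M) ∈ U.toSubmodule.map σ.toSubmodule.subtype := ⟨x, hx, rfl⟩
      rwa [hc, Submodule.mem_bot] at h2)
  change U.toSubmodule = ⊤
  rw [eq_top_iff]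
  rintro ⟨x, hx⟩ -
  rw [← h1] at hx
  obtain ⟨y, hy, hxy⟩ := hx
  rwa [show (⟨x, _⟩ : σ.toSubmodule) = y from Subtype.ext hxy.symm]

lemma polyRep_spechtPoly_of_perm {w : W} {σ : Equiv.Perm (Fin 5)} (h : IsSigned w σ 1)
    (α β : YoungDiagram) (T : α.cells ⊕ β.cells ≃ Fin 5) :
    polyRep w (spechtPoly α β T) = spechtPoly α β (T.trans σ) := by
  have hX : ∀ i, polyAct w (MvPolynomial.X i) = MvPolynomial.X (σ i) := fun i => by
    have := h.polyRep_X i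
    simpa using! this
  change polyAct w _ = _
  simp only [spechtPoly, columnProduct, map_mul, map_prod, apply_ite (polyAct w), map_sub, map_pow,
    hX, map_one]
  rfl

lemma spechtPoly_ne_zero (α β : YoungDiagram) (T : α.cells ⊕ β.cells ≃ Fin 5) :
    spechtPoly α β T ≠ 0 := by
  have hX : ∀ i j : Fin 5, i ≠ j →
      (MvPolynomial.X i ^ 2 - MvPolynomial.X j ^ 2 : MvPolynomial (Fin 5) ℂ) ≠ 0 := by
    intro i j hij h
    have := congrArg (MvPolynomial.eval (Pi.single i (1 : ℂ))) h
    simp [hij.symm] at this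
  have hc : ∀ (μ : YoungDiagram) (f : μ.cells → Fin 5), Function.Injective f →
      columnProduct μ (fun c => MvPolynomial.X (f c)) ≠ 0 := by
    intro μ f hf
    refine Finset.prod_ne_zero_iff.2 fun c _ => Finset.prod_ne_zero_iff.2 fun d _ => ?_
    split_ifs with hcd
    · exact hX _ _ fun he => by
        rw [hf he] at hcd
        exact lt_irrefl _ hcd.2
    · exact one_ne_zero
  exact mul_ne_zero (mul_ne_zero (hc α _ (T.injective.comp Sum.inl_injective))
    (hc β _ (T.injective.comp Sum.inr_injective)))
    (Finset.prod_ne_zero_iff.2 fun c _ => MvPolynomial.X_ne_zero _)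

/-- A minimal subrepresentation with an equivariant map to the polynomials that hits a Specht
polynomial is the Specht module. -/
lemma IsMinimal.nonempty_equiv {σ : Subrepresentation τ} (h : IsMinimal τ σ.toSubmodule)
    {α β : YoungDiagram} (T : α.cells ⊕ β.cells ≃ Fin 5) (Ψ : M →ₗ[ℂ] MvPolynomial (Fin 5) ℂ)
    (hΨ : ∀ w, ∀ x ∈ σ.toSubmodule, Ψ (τ w x) = polyRep w (Ψ x)) {x₀ : M}
    (hx₀ : x₀ ∈ σ.toSubmodule) {c : ℂ} (hc : c ≠ 0) (h₀ : Ψ x₀ = c • spechtPoly α β T) :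
    Nonempty (σ.toRepresentation.Equiv (bipartRep α β)) := by
  have hne : Ψ x₀ ≠ 0 := h₀ ▸ smul_ne_zero hc (spechtPoly_ne_zero α β T)
  have hker : σ.toSubmodule ⊓ LinearMap.ker Ψ = ⊥ := by
    by_contra hk
    have := h.2 _ inf_le_left (fun w x hx => ⟨σ.apply_mem_toSubmodule w hx.1, by
      change Ψ (τ w x) = 0
      rw [hΨ w x hx.1, LinearMap.mem_ker.1 hx.2, map_zero]⟩) hk
    rw [← this] at hx₀
    exact hne hx₀.2
  have hmem₀ : Ψ x₀ ∈ (spechtSub α β).toSubmodule :=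
    h₀ ▸ Submodule.smul_mem _ _ (Submodule.subset_span ⟨T, rfl⟩)
  have hrange : ∀ x ∈ σ.toSubmodule, Ψ x ∈ (spechtSub α β).toSubmodule := by
    have := h.2 (σ.toSubmodule ⊓ (spechtSub α β).toSubmodule.comap Ψ) inf_le_left
      (fun w x hx => ⟨σ.apply_mem_toSubmodule w hx.1, by
        change Ψ (τ w x) ∈ (spechtSub α β).toSubmodule
        rw [hΨ w x hx.1]
        exact (spechtSub α β).apply_mem_toSubmodule w hx.2⟩)
      fun hb => hne (by
        have h1 : x₀ ∈ σ.toSubmodule ⊓ (spechtSub α β).toSubmodule.comap Ψ := ⟨hx₀, hmem₀⟩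
        rw [hb, Submodule.mem_bot] at h1
        rw [h1, map_zero])
    intro x hx
    rw [← this] at hx
    exact hx.2
  let f : σ.toSubmodule →ₗ[ℂ] (spechtSub α β).toSubmodule :=
    (Ψ ∘ₗ σ.toSubmodule.subtype).codRestrict _ fun x => hrange x x.2
  have hf : ∀ x, (f x : MvPolynomial (Fin 5) ℂ) = Ψ x := fun _ => rfl
  have hinj : Function.Injective f := by
    rw [injective_iff_map_eq_zero]
    intro x hx
    have h1 : (x : M) ∈ σ.toSubmodule ⊓ LinearMap.ker Ψ :=
      ⟨x.2, congrArg Subtype.val hx⟩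
    rw [hker, Submodule.mem_bot] at h1
    exact Subtype.ext h1
  have hsurj : Function.Surjective f := by
    rintro ⟨y, hy⟩
    suffices y ∈ σ.toSubmodule.map Ψ by
      obtain ⟨x, hx, rfl⟩ := this
      exact ⟨⟨x, hx⟩, rfl⟩
    refine Submodule.span_le.2 ?_ (show y ∈ Submodule.span ℂ (Set.range (spechtPoly α β)) from hy)
    rintro _ ⟨T', rfl⟩
    -- Permutations act transitively on bitableaux, so the orbit of a single Specht polynomial spans
    -- the module.
    obtain ⟨w, hw⟩ := exists_isSigned_perm (T.symm.trans T')
    refine ⟨c⁻¹ • τ w x₀, Submodule.smul_mem _ _ (σ.apply_mem_toSubmodule w hx₀), ?_⟩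
    rw [map_smul, hΨ w x₀ hx₀, h₀, map_smul, smul_smul, inv_mul_cancel₀ hc, one_smul,
      polyRep_spechtPoly_of_perm hw]
    congr 1
    ext x
    simp
  exact ⟨Representation.Equiv.mk (LinearEquiv.ofBijective f ⟨hinj, hsurj⟩) fun w =>
    LinearMap.ext fun x => Subtype.ext (hΨ w x x.2)⟩

end Minimal

/-! ### From functions on the symmetric group to representations -/

/-- The subspace is stable under the action of the signed permutations, twisted by the signs at the
positions `p` and `q`. -/
def IsStable (p q : Fin 5) (U : Submodule ℂ (Equiv.Perm (Fin 5) → ℂ)) : Prop :=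
  ∀ (w : W) (σ : Equiv.Perm (Fin 5)) (s : Fin 5 → ℤˣ), IsSigned w σ s → ∀ u ∈ U, ∃ v ∈ U,
    ∀ θ, v (σ * θ) = (((s (θ p) * s (θ q) : ℤˣ) : ℤ) : ℂ) * u θ

lemma IsStable.translate {p q : Fin 5} {U : Submodule ℂ (Equiv.Perm (Fin 5) → ℂ)}
    (h : IsStable p q U) (u : Equiv.Perm (Fin 5) → ℂ) (hu : u ∈ U) (g : Equiv.Perm (Fin 5)) :
    (fun θ => u (g * θ)) ∈ U := by
  obtain ⟨w, hw⟩ := exists_isSigned_perm g⁻¹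
  obtain ⟨v, hv, hvu⟩ := h w _ _ hw u hu
  convert hv using 1
  funext θ
  have := hvu (g * θ)
  simpa using this.symm

lemma IsStable.flip {p q : Fin 5} {U : Submodule ℂ (Equiv.Perm (Fin 5) → ℂ)}
    (h : IsStable p q U) {i j : Fin 5} (hij : i ≠ j) (u : Equiv.Perm (Fin 5) → ℂ) (hu : u ∈ U) :
    (fun θ => (((DP4.flip i j (θ p) * DP4.flip i j (θ q) : ℤˣ) : ℤ) : ℂ) * u θ) ∈ U := by
  obtain ⟨w, hw⟩ := exists_isSigned_flip hij
  obtain ⟨v, hv, hvu⟩ := h w _ _ hw u hu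
  convert hv using 1
  funext θ
  rw [← hvu θ, one_mul]

/-- Averaging over two sign changes restricts a function to the permutations with two prescribed
values. -/
lemma IsStable.restrict {p q : Fin 5} {U : Submodule ℂ (Equiv.Perm (Fin 5) → ℂ)}
    (h : IsStable p q U) {i j k l : Fin 5} (hij : i ≠ j) (hkl : k ≠ l)
    {A : Equiv.Perm (Fin 5) → Prop}
    (hA : ∀ θ : Equiv.Perm (Fin 5), (A θ → DP4.flip i j (θ p) * DP4.flip i j (θ q) = 1 ∧
      DP4.flip k l (θ p) * DP4.flip k l (θ q) = 1) ∧
      (¬ A θ → DP4.flip i j (θ p) * DP4.flip i j (θ q) = -1 ∨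
        DP4.flip k l (θ p) * DP4.flip k l (θ q) = -1))
    (u : Equiv.Perm (Fin 5) → ℂ) (hu : u ∈ U) :
    ∃ v ∈ U, ∀ θ, (A θ → v θ = u θ) ∧ (¬ A θ → v θ = 0) := by
  have h1 := add_mem hu (h.flip hij u hu)
  have h2 := add_mem h1 (h.flip hkl _ h1)
  refine ⟨_, Submodule.smul_mem _ (1 / 4 : ℂ) h2, fun θ => ⟨fun hθ => ?_, fun hθ => ?_⟩⟩
  · simp only [Pi.smul_apply, Pi.add_apply, smul_eq_mul, ((hA θ).1 hθ).1, ((hA θ).1 hθ).2]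
    push_cast
    ring
  · rcases (hA θ).2 hθ with h3 | h3 <;>
    · simp only [Pi.smul_apply, Pi.add_apply, smul_eq_mul, h3]
      push_cast
      ring

lemma edgeSpace_minimal {U : Submodule ℂ (Equiv.Perm (Fin 5) → ℂ)} (hU : U ≤ edgeSpace)
    (hne : U ≠ ⊥) (h : IsStable 1 2 U) : U = edgeSpace :=
  isKernel_edge.eq_of_stable hU hne h.translate
    (h.restrict (i := 0) (j := 3) (k := 3) (l := 4) (by decide) (by decide) (by decide +kernel))

lemma wedgeSpace_minimal {U : Submodule ℂ (Equiv.Perm (Fin 5) → ℂ)} (hU : U ≤ wedgeSpace)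
    (hne : U ≠ ⊥) (h : IsStable 2 3 U) : U = wedgeSpace :=
  isKernel_wedge.eq_of_stable hU hne h.translate
    (h.restrict (i := 0) (j := 1) (k := 1) (l := 4) (by decide) (by decide) (by decide +kernel))

lemma doubleEdgeSpace_minimal {U : Submodule ℂ (Equiv.Perm (Fin 5) → ℂ)}
    (hU : U ≤ doubleEdgeSpace) (hne : U ≠ ⊥) (h : IsStable 0 0 U) : U = doubleEdgeSpace :=
  isKernel_doubleEdge.eq_of_stable hU hne h.translate
    fun u hu => ⟨u, hu, fun _ => ⟨fun _ => rfl, fun hc => (hc trivial).elim⟩⟩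

section Model

variable {M : Type*} [AddCommGroup M] [Module ℂ M] {τ : Representation ℂ W M}
  {σ : Subrepresentation τ} {S : Submodule ℂ (Equiv.Perm (Fin 5) → ℂ)} {p q : Fin 5}

/-- The map `m` embeds the subrepresentation `σ` in the function space `S`, equivariantly. -/
structure IsModel (σ : Subrepresentation τ) (S : Submodule ℂ (Equiv.Perm (Fin 5) → ℂ))
    (p q : Fin 5) (m : M →ₗ[ℂ] Equiv.Perm (Fin 5) → ℂ) : Prop where
  equivariant : ∀ (w : W) (ρ : Equiv.Perm (Fin 5)) (s : Fin 5 → ℤˣ), IsSigned w ρ s →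
    ∀ x θ, m (τ w x) (ρ * θ) = (((s (θ p) * s (θ q) : ℤˣ) : ℤ) : ℂ) * m x θ
  mem : ∀ x ∈ σ.toSubmodule, m x ∈ S
  eq_zero : ∀ x ∈ σ.toSubmodule, m x = 0 → x = 0
  ne_bot : σ.toSubmodule ≠ ⊥
  minimal : ∀ U ≤ S, U ≠ ⊥ → IsStable p q U → U = S

variable {m : M →ₗ[ℂ] Equiv.Perm (Fin 5) → ℂ}

/-- The image of `U` is non-zero because `m` is injective on `σ`, and it is stable by equivariance;
minimality of `S` does the rest. Applied to `σ` itself this gives surjectivity without constructing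
further relations. -/
lemma IsModel.map_eq (h : IsModel σ S p q m) {U : Submodule ℂ M} (hU : U ≤ σ.toSubmodule)
    (hUτ : ∀ w, ∀ x ∈ U, τ w x ∈ U) (hne : U ≠ ⊥) : U.map m = S := by
  refine h.minimal _ ?_ ?_ ?_
  · rintro _ ⟨x, hx, rfl⟩
    exact h.mem x (hU hx)
  · intro hb
    refine hne ((Submodule.eq_bot_iff _).2 fun x hx => h.eq_zero x (hU hx) ?_)
    have : m x ∈ U.map m := ⟨x, hx, rfl⟩
    rwa [hb, Submodule.mem_bot] at this
  · rintro w ρ s hw _ ⟨x, hx, rfl⟩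
    exact ⟨_, ⟨τ w x, hUτ w x hx, rfl⟩, h.equivariant w ρ s hw x⟩

lemma IsModel.isMinimal (h : IsModel σ S p q m) : IsMinimal τ σ.toSubmodule := by
  refine ⟨h.ne_bot, fun U hU hUτ hne => le_antisymm hU fun x hx => ?_⟩
  have h1 : m x ∈ U.map m := h.map_eq hU hUτ hne ▸ h.mem x hx
  obtain ⟨y, hy, hxy⟩ := h1
  have := h.eq_zero (x - y) (sub_mem hx (hU hy)) (by rw [map_sub, hxy, sub_self])
  rwa [sub_eq_zero.1 this]

lemma IsModel.finrank_eq (h : IsModel σ S p q m) :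
    Module.finrank ℂ σ.toSubmodule = Module.finrank ℂ S := by
  have h1 := h.map_eq le_rfl (fun w x hx => σ.apply_mem_toSubmodule w hx) h.ne_bot
  have hinj : Function.Injective (m ∘ₗ σ.toSubmodule.subtype) := by
    rw [injective_iff_map_eq_zero]
    exact fun x hx => Subtype.ext (h.eq_zero x x.2 hx)
  rw [← h1, ← LinearMap.finrank_range_of_inj hinj, LinearMap.range_comp, Submodule.range_subtype]

/-! ### Equivariant passage from functions to polynomials. -/

/-- The polynomial `∑ u(θ) ∏ X_{θ i} ^ c_i` attached to a function on the symmetric group. -/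
def permPoly (c : Fin 5 → ℕ) : (Equiv.Perm (Fin 5) → ℂ) →ₗ[ℂ] MvPolynomial (Fin 5) ℂ :=
  ∑ θ, (LinearMap.proj θ).smulRight (∏ i, MvPolynomial.X (θ i) ^ c i)

lemma permPoly_apply (c : Fin 5 → ℕ) (u : Equiv.Perm (Fin 5) → ℂ) :
    permPoly c u = ∑ θ, u θ • ∏ i, MvPolynomial.X (θ i) ^ c i := by
  simp [permPoly]

/-- The parities of the exponents are chosen so that, for an even number of sign changes, the sign
acquired by each monomial is the twist at the positions `p` and `q`. -/
lemma polyRep_permPoly {w : W} {ρ : Equiv.Perm (Fin 5)} {s : Fin 5 → ℤˣ} (h : IsSigned w ρ s)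
    {c : Fin 5 → ℕ} (hc : ∀ s : Fin 5 → ℤˣ, ∏ i, s i = 1 → ∏ i, s i ^ c i = s p * s q)
    {u v : Equiv.Perm (Fin 5) → ℂ}
    (hv : ∀ θ, v (ρ * θ) = (((s (θ p) * s (θ q) : ℤˣ) : ℤ) : ℂ) * u θ) :
    polyRep w (permPoly c u) = permPoly c v := by
  rw [permPoly_apply, permPoly_apply, map_sum, ← Equiv.sum_comp (Equiv.mulLeft ρ)
    fun θ => v θ • _]
  refine Finset.sum_congr rfl fun θ _ => ?_
  rw [map_smul, Equiv.coe_mulLeft, hv, mul_comm, mul_smul]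
  congr 1
  have hX : ∀ i, polyAct w (MvPolynomial.X i) = (s i : ℤ) • MvPolynomial.X (ρ i) := h.polyRep_X
  change polyAct w _ = _
  simp only [map_prod, map_pow, hX, zsmul_eq_mul, mul_pow, Finset.prod_mul_distrib]
  rw [← hc (fun i => s (θ i)) (by rw [Equiv.prod_comp θ s, h.2])]
  simp [Algebra.smul_def]

lemma IsModel.isIrrep (h : IsModel σ S p q m) {n : ℕ} (hn : Module.finrank ℂ S = n)
    {α β : YoungDiagram} (T : α.cells ⊕ β.cells ≃ Fin 5) {c : Fin 5 → ℕ}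
    (hc : ∀ s : Fin 5 → ℤˣ, ∏ i, s i = 1 → ∏ i, s i ^ c i = s p * s q)
    {u : Equiv.Perm (Fin 5) → ℂ} (hu : u ∈ S) {t : ℂ} (ht : t ≠ 0)
    (hT : permPoly c u = t • spechtPoly α β T) : IsIrrep τ σ.toSubmodule n α β := by
  refine ⟨σ, rfl, h.isMinimal.isIrreducible, h.finrank_eq.trans hn, ?_⟩
  rw [← h.map_eq le_rfl (fun w x hx => σ.apply_mem_toSubmodule w hx) h.ne_bot] at hu
  obtain ⟨x, hx, rfl⟩ := hu
  refine h.isMinimal.nonempty_equiv T (permPoly c ∘ₗ m) (fun w y _ => ?_) hx ht hT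
  obtain ⟨ρ, s, hw⟩ := exists_isSigned w
  exact (polyRep_permPoly hw hc (h.equivariant w ρ s hw y)).symm

end Model

end DP4
end

noncomputable section

namespace DP4

/-! ### Explicit Specht polynomials -/

/-- A bitableau given by functions on the positions. -/
def bitableau {α β : YoungDiagram} (f g : ℕ × ℕ → Fin 5)
    (h : Function.Bijective (Sum.elim (fun c : α.cells => f c.1) fun c : β.cells => g c.1)) :
    α.cells ⊕ β.cells ≃ Fin 5 := Equiv.ofBijective _ h

lemma columnProduct_eq (μ : YoungDiagram) (y : ℕ × ℕ → MvPolynomial (Fin 5) ℂ) :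
    columnProduct μ (fun c => y c.1) =
      ∏ c ∈ μ.cells, ∏ d ∈ μ.cells, if c.2 = d.2 ∧ c.1 < d.1 then y c ^ 2 - y d ^ 2 else 1 := by
  rw [columnProduct, ← Finset.prod_coe_sort μ.cells]
  refine Finset.prod_congr rfl fun c _ => ?_
  rw [← Finset.prod_coe_sort μ.cells]

lemma spechtPoly_bitableau {α β : YoungDiagram} (f g : ℕ × ℕ → Fin 5)
    (h : Function.Bijective (Sum.elim (fun c : α.cells => f c.1) fun c : β.cells => g c.1)) :
    spechtPoly α β (bitableau f g h) =
      (∏ c ∈ α.cells, ∏ d ∈ α.cells, if c.2 = d.2 ∧ c.1 < d.1 then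
        (MvPolynomial.X (f c) ^ 2 - MvPolynomial.X (f d) ^ 2) else 1) *
      (∏ c ∈ β.cells, ∏ d ∈ β.cells, if c.2 = d.2 ∧ c.1 < d.1 then
        (MvPolynomial.X (g c) ^ 2 - MvPolynomial.X (g d) ^ 2) else 1) *
      ∏ c ∈ β.cells, MvPolynomial.X (g c) := by
  rw [← columnProduct_eq α fun c => MvPolynomial.X (f c),
    ← columnProduct_eq β fun c => MvPolynomial.X (g c), ← Finset.prod_coe_sort β.cells]
  rfl

/-- The exponent vector of the monomial `∏ X_{θ i} ^ c_i`, read as a decimal number. -/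
def expCode (c : Fin 5 → ℕ) (θ : Equiv.Perm (Fin 5)) : ℕ :=
  c 0 * 10 ^ (θ 0 : ℕ) + c 1 * 10 ^ (θ 1 : ℕ) + c 2 * 10 ^ (θ 2 : ℕ) + c 3 * 10 ^ (θ 3 : ℕ) +
    c 4 * 10 ^ (θ 4 : ℕ)

/-- The function on the symmetric group with value `t_j` at the permutations with exponent
code `E_j`. -/
def expFun {n : ℕ} (c : Fin 5 → ℕ) (E : Fin n → ℕ) (t : Fin n → ℤ) (θ : Equiv.Perm (Fin 5)) : ℤ :=
  ∑ j, if expCode c θ = E j then t j else 0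

/-- The decimal digits of the code give back the exponents, so permutations with equal code yield
the same monomial; each listed monomial arises `N` times. -/
lemma permPoly_expFun {n : ℕ} (c : Fin 5 → ℕ) (E : Fin n → ℕ) (t : Fin n → ℤ) (N : ℕ)
    (hc : ∀ θ i, expCode c θ / 10 ^ (θ i : ℕ) % 10 = c i)
    (hN : ∀ j, (Finset.univ.filter fun θ : Equiv.Perm (Fin 5) => expCode c θ = E j).card = N) :
    permPoly c (fun θ => (expFun c E t θ : ℂ)) =
      (N : ℂ) • ∑ j, t j • ∏ i : Fin 5, MvPolynomial.X i ^ (E j / 10 ^ (i : ℕ) % 10) := by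
  rw [permPoly_apply]
  simp only [expFun, Int.cast_sum, Int.cast_ite, Int.cast_zero, Finset.sum_smul, ite_smul,
    zero_smul]
  rw [Finset.sum_comm, Finset.smul_sum]
  refine Finset.sum_congr rfl fun j _ => ?_
  rw [← Finset.sum_filter, ← hN j, Nat.cast_smul_eq_nsmul, ← Finset.sum_const]
  refine Finset.sum_congr rfl fun θ hθ => ?_
  rw [Int.cast_smul_eq_zsmul, ← (Finset.mem_filter.1 hθ).2]
  congr 1
  rw [← Equiv.prod_comp θ fun i =>
    (MvPolynomial.X i : MvPolynomial (Fin 5) ℂ) ^ (expCode c θ / 10 ^ (i : ℕ) % 10)]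
  exact Finset.prod_congr rfl fun i _ => by rw [hc θ i]

/-- An element of `edgeSpace` that corresponds to a Specht polynomial. -/
def edgeSpecht : Equiv.Perm (Fin 5) → ℤ :=
  expFun ![3, 0, 0, 1, 1] ![11003, 13001] ![1, -1]

/-- The sign of a permutation of three of the indices, the third value being omitted. -/
def sign₃ (i j k x y : Fin 5) : ℤ :=
  if x = i ∧ y = j ∨ x = j ∧ y = k ∨ x = k ∧ y = i then 1
  else if x = j ∧ y = i ∨ x = k ∧ y = j ∨ x = i ∧ y = k then -1 else 0

/-- An element of `doubleEdgeSpace` that corresponds to a Specht polynomial. -/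
def doubleEdgeSpecht (θ : Equiv.Perm (Fin 5)) : ℤ :=
  if θ 1 = 2 then sign₃ 0 1 3 (θ 0) (θ 2) else if θ 1 = 4 then -sign₃ 0 1 3 (θ 0) (θ 2)
  else if θ 2 = 2 then sign₃ 0 1 3 (θ 0) (θ 1) else if θ 2 = 4 then -sign₃ 0 1 3 (θ 0) (θ 1)
  else 0

lemma wedgeKernel_eq : wedgeKernel = expFun ![1, 3, 0, 2, 5]
    ![52031, 52013, 12035, 32051, 32015, 12053, 50231, 50213, 10235, 30251, 30215, 10253]
    ![1, -1, -1, -1, 1, 1, -1, 1, 1, 1, -1, -1] :=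
  funext (by decide +kernel)

lemma doubleEdgeSpecht_eq : doubleEdgeSpecht = expFun ![5, 3, 3, 1, 1]
    ![11335, 11353, 15331, 13315, 13351, 15313, 31135, 31153, 35131, 33115, 33151, 35113]
    ![1, -1, -1, -1, 1, 1, -1, 1, 1, 1, -1, -1] :=
  funext (by decide +kernel)

lemma edgeSpecht_mem :
    (fun θ => (edgeSpecht θ : ℂ)) ∈ edgeSpace :=
  ⟨⟨by exact_mod_cast cast_mem_rightEigen 1 (by decide +kernel),
    by exact_mod_cast cast_mem_rightEigen 1 (by decide +kernel)⟩,
    cast_mem_rightSum (by decide +kernel)⟩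

lemma doubleEdgeSpecht_mem :
    (fun θ => (doubleEdgeSpecht θ : ℂ)) ∈ doubleEdgeSpace :=
  ⟨⟨⟨by exact_mod_cast cast_mem_rightEigen 1 (by decide +kernel),
    by exact_mod_cast cast_mem_rightEigen 1 (by decide +kernel)⟩,
    by exact_mod_cast cast_mem_rightEigen 1 (by decide +kernel)⟩,
    cast_mem_rightSum (by decide +kernel)⟩

/-- A bitableau of shape `(2, 21)`. -/
def edgeTableau : (yd [2]).cells ⊕ (yd [2, 1]).cells ≃ Fin 5 :=
  bitableau (fun c => if c = (0, 0) then 1 else 2)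
    (fun c => if c = (0, 0) then 0 else if c = (1, 0) then 3 else 4) (by decide +kernel)

/-- A bitableau of shape `(11, 111)`. -/
def wedgeTableau : (yd [1, 1]).cells ⊕ (yd [1, 1, 1]).cells ≃ Fin 5 :=
  bitableau (fun c => if c = (0, 0) then 2 else 3)
    (fun c => if c = (0, 0) then 0 else if c = (1, 0) then 1 else 4) (by decide +kernel)

/-- A bitableau of shape `(, 221)`. -/
def doubleEdgeTableau : (yd []).cells ⊕ (yd [2, 2, 1]).cells ≃ Fin 5 :=
  bitableau (fun _ => 0) (fun c => if c = (0, 0) then 0 else if c = (1, 0) then 1 else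
    if c = (2, 0) then 3 else if c = (0, 1) then 2 else 4) (by decide +kernel)

/-- A bitableau of shape `(, 11111)`. -/
def triangleTableau : (yd []).cells ⊕ (yd [1, 1, 1, 1, 1]).cells ≃ Fin 5 :=
  bitableau (fun _ => 0) (fun c => if c = (0, 0) then 0 else if c = (1, 0) then 1 else
    if c = (2, 0) then 2 else if c = (3, 0) then 3 else 4) (by decide +kernel)

lemma permPoly_edge : permPoly ![3, 0, 0, 1, 1] (fun θ => (edgeSpecht θ : ℂ)) =
    (4 : ℂ) • spechtPoly (yd [2]) (yd [2, 1]) edgeTableau := by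
  unfold edgeSpecht
  rw [permPoly_expFun _ _ _ 4 (by decide +kernel) (by decide +kernel), edgeTableau,
    spechtPoly_bitableau, show (yd [2]).cells = {(0, 0), (0, 1)} from rfl,
    show (yd [2, 1]).cells = {(0, 0), (0, 1), (1, 0)} from rfl, Nat.cast_ofNat]
  congr 1
  simp [Fin.sum_univ_succ, Fin.prod_univ_five, Finset.prod_insert]
  ring

lemma permPoly_wedge : permPoly ![1, 3, 0, 2, 5] (fun θ => (wedgeKernel θ : ℂ)) =
    (1 : ℂ) • spechtPoly (yd [1, 1]) (yd [1, 1, 1]) wedgeTableau := by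
  rw [wedgeKernel_eq, permPoly_expFun _ _ _ 1 (by decide +kernel) (by decide +kernel),
    wedgeTableau, spechtPoly_bitableau,
    show (yd [1, 1]).cells = {(0, 0), (1, 0)} from rfl,
    show (yd [1, 1, 1]).cells = {(0, 0), (1, 0), (2, 0)} from rfl, Nat.cast_one]
  congr 1
  simp [Fin.sum_univ_succ, Fin.prod_univ_five, Finset.prod_insert]
  ring

lemma permPoly_doubleEdge :
    permPoly ![5, 3, 3, 1, 1] (fun θ => (doubleEdgeSpecht θ : ℂ)) =
      (4 : ℂ) • spechtPoly (yd []) (yd [2, 2, 1]) doubleEdgeTableau := by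
  rw [doubleEdgeSpecht_eq, permPoly_expFun _ _ _ 4 (by decide +kernel) (by decide +kernel),
    doubleEdgeTableau, spechtPoly_bitableau, show (yd []).cells = ∅ from rfl,
    show (yd [2, 2, 1]).cells = {(0, 0), (1, 0), (2, 0), (0, 1), (1, 1)} by decide +kernel,
    Nat.cast_ofNat]
  congr 1
  simp [Fin.sum_univ_succ, Fin.prod_univ_five, Finset.prod_insert]
  ring

/-- The left side is the Leibniz expansion of the determinant with entries `X_i ^ (2 j + 1)`.
Extracting one factor `X_i` from each row leaves the Vandermonde determinant of the squares. -/
lemma permPoly_sign : permPoly ![1, 3, 5, 7, 9] (fun θ => ((Equiv.Perm.sign θ : ℤ) : ℂ)) =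
    (1 : ℂ) • spechtPoly (yd []) (yd [1, 1, 1, 1, 1]) triangleTableau := by
  have h1 := Matrix.det_mul_column (fun i : Fin 5 => (MvPolynomial.X i : MvPolynomial (Fin 5) ℂ))
    (Matrix.vandermonde fun i => MvPolynomial.X i ^ 2)
  have h2 : ∀ (x : MvPolynomial (Fin 5) ℂ) (i : Fin 5),
      x ^ (![1, 3, 5, 7, 9] : Fin 5 → ℕ) i = x * (x ^ 2) ^ (i : ℕ) := by
    intro x i
    rw [← pow_mul, ← pow_succ',
      (by decide : ∀ i : Fin 5, (![1, 3, 5, 7, 9] : Fin 5 → ℕ) i = 2 * i + 1) i]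
  have h3 : permPoly ![1, 3, 5, 7, 9] (fun θ => ((Equiv.Perm.sign θ : ℤ) : ℂ)) =
      (Matrix.of fun i j => (MvPolynomial.X i : MvPolynomial (Fin 5) ℂ) *
        Matrix.vandermonde (fun i => MvPolynomial.X i ^ 2) i j).det := by
    rw [permPoly_apply, Matrix.det_apply]
    refine Finset.sum_congr rfl fun θ _ => ?_
    rw [Int.cast_smul_eq_zsmul, Units.smul_def]
    simp only [h2, Matrix.of_apply, Matrix.vandermonde_apply]
  have h4 : ∀ f : Fin 5 → Fin 5 → MvPolynomial (Fin 5) ℂ, ∏ i, ∏ j ∈ Finset.Ioi i, f i j =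
      f 0 1 * f 0 2 * f 0 3 * f 0 4 * f 1 2 * f 1 3 * f 1 4 * f 2 3 * f 2 4 * f 3 4 := by
    intro f
    simp only [Fin.prod_univ_five, show Finset.Ioi (0 : Fin 5) = {1, 2, 3, 4} by decide,
      show Finset.Ioi (1 : Fin 5) = {2, 3, 4} by decide,
      show Finset.Ioi (2 : Fin 5) = {3, 4} by decide, show Finset.Ioi (3 : Fin 5) = {4} by decide,
      show Finset.Ioi (4 : Fin 5) = ∅ by decide]
    simp [Finset.prod_insert, mul_assoc]
  rw [h3, h1, Matrix.det_vandermonde, h4, one_smul, triangleTableau, spechtPoly_bitableau,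
    show (yd []).cells = ∅ from rfl,
    show (yd [1, 1, 1, 1, 1]).cells = {(0, 0), (1, 0), (2, 0), (3, 0), (4, 0)} by decide +kernel]
  simp [Finset.prod_insert, Fin.prod_univ_five]
  ring

end DP4
end

noncomputable section

namespace DP4

/-! ### Explicit abelian relations -/

/-- The residues of the forms `η` along the affine boundary curves. -/
def bdryFibRes (i : Fin 10) (s : Fin 3) (k : Fin 10) : ℤ := fibRes i s (bdryLine k)

/-- The tuple of symbols with given integral coefficients on the tensors of the forms `η`. -/
def tensorOf (a b : ℂ) {ν : ℕ} (A : Fin 10 → (Fin ν → Fin 3) → ℤ) : Symbols a b ν := fun i =>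
  ∑ f, (A i f : ℂ) • PiTensorProduct.tprod ℂ fun n => ηH a b i (f n)

/-- The coefficients of the abelian relation `dx / x - dy / y + d(y / x) / (y / x) = 0`. -/
def edgeCoeff (i : Fin 10) (f : Fin 1 → Fin 3) : ℤ := if i < 3 ∧ f 0 = 0 then 1 else 0

/-- The alternating symbol on three indices. -/
def altSymbol (p q r : Fin 3) : ℤ :=
  if q = p + 1 ∧ r = q + 1 then 1 else if p = q + 1 ∧ q = r + 1 then -1 else 0

/-- The coefficients of the contraction of `6 HLog³` with the residue along a boundary curve. -/
def wedgeCoeff (i : Fin 10) (f : Fin 2 → Fin 3) : ℤ :=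
  -- The boundary curve of index `3` is `x = 0`; contracting the first factor of a relation with a
  -- linear functional on `H` gives a relation of lower weight.
  ∑ p, bdryFibRes i p 3 * altSymbol p (f 0) (f 1)

/-- The coefficients of a symmetric abelian relation of weight two. -/
def doubleEdgeCoeff (i : Fin 10) (f : Fin 2 → Fin 3) : ℤ :=
  ∑ p, (![![0, 1, -1], ![0, 1, -1], ![0, 1, -1], ![0, 0, 0], ![0, 0, 0], ![-1, 0, 1], ![1, -1, 0],
    ![-1, 0, 1], ![0, 0, 0], ![0, 0, 0]] : Fin 10 → Fin 3 → ℤ) i p *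
      (if p = f 0 then -1 else 1) * (if p = f 1 then -1 else 1)

/-- The coefficients of `6 HLog³`. -/
def triangleCoeff (_ : Fin 10) (f : Fin 3 → Fin 3) : ℤ := altSymbol (f 0) (f 1) (f 2)

variable {a b : ℂ} (hab : a * b * (a - 1) * (b - 1) * (a - b) ≠ 0) {ν : ℕ}

/-- The residue along an affine boundary curve. -/
def bdryResid (k : Fin 10) : H a b →ₗ[ℂ] ℂ := LinearMap.proj (bdryLine k) ∘ₗ resid hab

lemma eq_zero_of_bdryResid (ω : H a b) (h : ∀ k, bdryResid hab k ω = 0) : ω = 0 := by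
  apply resid_injective hab
  rw [map_zero]
  have h0 : ∀ j, ∑ m : Fin 6, resid hab ω (Fin.castAdd 10 m) *
      (lineCls (Fin.castAdd 10 m) j : ℂ) = 0 := by
    intro j
    have h1 := sum_resid hab ω j
    have h2 : ∀ k : Fin 10, resid hab ω (Fin.natAdd 6 k) = 0 := h
    rw [Fin.sum_univ_add (a := 6) (b := 10)] at h1
    simpa only [h2, zero_mul, Finset.sum_const_zero, add_zero] using h1
  have h3 : ∀ m : Fin 6, resid hab ω (Fin.castAdd 10 m) = 0 := by
    have hcls : ∀ (m : Fin 6) (j : Fin 6), lineCls (Fin.castAdd 10 m) j =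
      ![![0, 1, 0, 0, 0, 0], ![0, 0, 1, 0, 0, 0], ![0, 0, 0, 1, 0, 0], ![0, 0, 0, 0, 1, 0],
        ![0, 0, 0, 0, 0, 1], ![1, -1, -1, 0, 0, 0]] m j := by decide +kernel
    simp only [hcls] at h0
    have e0 := h0 0
    have e1 := h0 1
    have e2 := h0 2
    have e3 := h0 3
    have e4 := h0 4
    have e5 := h0 5
    simp only [Fin.sum_univ_six] at e0 e1 e2 e3 e4 e5
    simp at e0 e1 e2 e3 e4 e5
    simp only [e0, add_zero, neg_zero] at e1 e2
    intro m
    fin_cases m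
    exacts [e1, e2, e3, e4, e5, e0]
  funext l
  refine Fin.addCases (m := 6) (n := 10) h3 h l

lemma bdryResid_η (i : Fin 10) (s : Fin 3) (k : Fin 10) :
    bdryResid hab k (formIncl a b i (ηH a b i s)) = bdryFibRes i s k :=
  resid_η hab i s (bdryLine k) _

lemma mem_HLogAR_of_bdryResid (Ω : Symbols a b ν) (h : ∀ g : Fin ν → Fin 10,
    ∑ i, tensorEval (fun n => bdryResid hab (g n) ∘ₗ formIncl a b i) (Ω i) = 0) :
    Ω ∈ HLogAR a b ν := by
  refine eq_zero_of_tensorEval (bdryResid hab) (eq_zero_of_bdryResid hab) _ fun g => ?_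
  rw [Φ_apply, map_sum, ← h g]
  exact Finset.sum_congr rfl fun i _ => tensorEval_map _ _ _

lemma tensorEval_tensorOf (A : Fin 10 → (Fin ν → Fin 3) → ℤ) (i : Fin 10)
    (φ : Fin ν → Hc a b i →ₗ[ℂ] ℂ) :
    tensorEval φ (tensorOf a b A i) = ∑ f, (A i f : ℂ) * ∏ n, φ n (ηH a b i (f n)) := by
  simp only [tensorOf, map_sum, map_smul, tensorEval_tprod, smul_eq_mul]

/-- The residues along the ten affine boundary curves separate `H`, so being a relation amounts to
finitely many identities between integers, independent of `a` and `b`. -/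
lemma tensorOf_mem_HLogAR (hab : a * b * (a - 1) * (b - 1) * (a - b) ≠ 0)
    {A : Fin 10 → (Fin ν → Fin 3) → ℤ} (h : ∀ g : Fin ν → Fin 10,
      ∑ i, ∑ f, A i f * ∏ n, bdryFibRes i (f n) (g n) = 0) : tensorOf a b A ∈ HLogAR a b ν := by
  refine mem_HLogAR_of_bdryResid hab _ fun g => ?_
  simp only [tensorEval_tensorOf, LinearMap.comp_apply, bdryResid_η]
  exact_mod_cast h g

lemma coef_tensorOf (A : Fin 10 → (Fin ν → Fin 3) → ℤ) (i : Fin 10)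
    (f : Fin ν → Fin 5 × Fin 5) : coef hab i f (tensorOf a b A) =
      ((∑ g, A i g * ∏ n, chiInt i (g n) (f n).1 (f n).2 : ℤ) : ℂ) := by
  rw [coef_apply, tensorEval_tensorOf]
  push_cast
  refine Finset.sum_congr rfl fun g _ => ?_
  congr 1
  exact Finset.prod_congr rfl fun n _ => chi_η hab i (g n) _ _ _

lemma tensorOf_ne_zero (hab : a * b * (a - 1) * (b - 1) * (a - b) ≠ 0)
    {A : Fin 10 → (Fin ν → Fin 3) → ℤ} (i : Fin 10) (f : Fin ν → Fin 5 × Fin 5)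
    (h : ∑ g, A i g * ∏ n, chiInt i (g n) (f n).1 (f n).2 ≠ 0) : tensorOf a b A ≠ 0 := by
  intro h0
  have := coef_tensorOf hab A i f
  rw [h0, map_zero] at this
  exact h (by exact_mod_cast this.symm)

lemma swap₂_tensorOf {A : Fin 10 → (Fin 2 → Fin 3) → ℤ} {c : ℤ}
    (h : ∀ i f, A i (f ∘ Equiv.swap 0 1) = c * A i f) (i : Fin 10) :
    swap₂ (Hc a b i) (tensorOf a b A i) = (c : ℂ) • tensorOf a b A i := by
  simp only [tensorOf, map_sum, map_smul, Finset.smul_sum, smul_smul]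
  rw [← Equiv.sum_comp (Equiv.arrowCongr (Equiv.swap (0 : Fin 2) 1) (Equiv.refl (Fin 3)))]
  refine Finset.sum_congr rfl fun f _ => ?_
  have h1 : Equiv.arrowCongr (Equiv.swap (0 : Fin 2) 1) (Equiv.refl (Fin 3)) f =
      f ∘ Equiv.swap 0 1 := rfl
  rw [h1, h, Int.cast_mul]
  congr 1
  change PiTensorProduct.reindex ℂ _ _ (PiTensorProduct.tprod ℂ _) = _
  rw [PiTensorProduct.reindex_tprod]
  congr 1
  funext n
  simp

lemma edge_mem (hab : a * b * (a - 1) * (b - 1) * (a - b) ≠ 0) :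
    tensorOf a b edgeCoeff ∈ HLogAR a b 1 :=
  tensorOf_mem_HLogAR hab (by decide +kernel)

lemma edge_ne_zero (hab : a * b * (a - 1) * (b - 1) * (a - b) ≠ 0) :
    tensorOf a b edgeCoeff ≠ 0 :=
  tensorOf_ne_zero hab 0 ![(2, 3)] (by decide +kernel)

lemma wedge_mem (hab : a * b * (a - 1) * (b - 1) * (a - b) ≠ 0) :
    tensorOf a b wedgeCoeff ∈ HLogARasym a b := by
  rw [mem_HLogARasym]
  refine ⟨tensorOf_mem_HLogAR hab (by decide +kernel), ?_⟩
  have h := swap₂_tensorOf (a := a) (b := b) (A := wedgeCoeff) (c := -1) (by decide +kernel)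
  intro i
  rw [h i, Int.cast_neg, Int.cast_one]

lemma wedge_ne_zero (hab : a * b * (a - 1) * (b - 1) * (a - b) ≠ 0) :
    tensorOf a b wedgeCoeff ≠ 0 :=
  tensorOf_ne_zero hab 0 ![(2, 3), (2, 4)] (by decide +kernel)

lemma doubleEdge_mem (hab : a * b * (a - 1) * (b - 1) * (a - b) ≠ 0) :
    tensorOf a b doubleEdgeCoeff ∈ HLogARsym a b := by
  rw [mem_HLogARsym]
  refine ⟨tensorOf_mem_HLogAR hab (by decide +kernel), ?_⟩
  have h := swap₂_tensorOf (a := a) (b := b) (A := doubleEdgeCoeff) (c := 1) (by decide +kernel)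
  intro i
  rw [h i, Int.cast_one]

lemma doubleEdge_ne_zero (hab : a * b * (a - 1) * (b - 1) * (a - b) ≠ 0) :
    tensorOf a b doubleEdgeCoeff ≠ 0 :=
  tensorOf_ne_zero hab 0 ![(2, 3), (2, 3)] (by decide +kernel)

lemma sum_triangleCoeff {M : Type*} [AddCommGroup M] (i : Fin 10) (F : (Fin 3 → Fin 3) → M) :
    ∑ f, triangleCoeff i f • F f = ∑ σ : Equiv.Perm (Fin 3), (Equiv.Perm.sign σ : ℤ) • F σ := by
  have h : ∀ f : Fin 3 → Fin 3, altSymbol (f 0) (f 1) (f 2) =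
    ∑ σ : Equiv.Perm (Fin 3), if f = σ then (Equiv.Perm.sign σ : ℤ) else 0 := by decide +kernel
  simp only [triangleCoeff, h, Finset.sum_smul]
  rw [Finset.sum_comm]
  refine Finset.sum_congr rfl fun σ _ => ?_
  rw [Finset.sum_eq_single (σ : Fin 3 → Fin 3)]
  · rw [if_pos rfl]
  · intro f _ hf
    rw [if_neg hf, zero_smul]
  · simp

lemma HLog3_eq : HLog3 a b = (1 / 6 : ℂ) • tensorOf a b triangleCoeff := by
  funext i
  rw [HLog3, Pi.smul_apply, tensorOf]
  congr 1
  refine Eq.trans (sum_triangleCoeff i fun f =>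
    PiTensorProduct.tprod ℂ fun n => ηH a b i (f n)).symm ?_
  exact Finset.sum_congr rfl fun f _ => (Int.cast_smul_eq_zsmul ℂ _ _).symm

lemma triangle_mem (hab : a * b * (a - 1) * (b - 1) * (a - b) ≠ 0) :
    tensorOf a b triangleCoeff ∈ HLogAR a b 3 := by
  refine tensorOf_mem_HLogAR hab fun g => ?_
  -- Against three residues the alternating tensor evaluates to a `3 × 3` determinant, which
  -- shortens the sum left to be checked.
  have h1 : ∀ i, ∑ f, triangleCoeff i f * ∏ n, bdryFibRes i (f n) (g n) =
      (Matrix.of fun s n => bdryFibRes i s (g n)).det := by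
    intro i
    simp only [← smul_eq_mul, sum_triangleCoeff]
    rw [Matrix.det_apply']
    rfl
  simp only [h1, Matrix.det_fin_three, Matrix.of_apply]
  have h2 : ∀ k₀ k₁ k₂ : Fin 10, ∑ i,
      (bdryFibRes i 0 k₀ * bdryFibRes i 1 k₁ * bdryFibRes i 2 k₂ -
        bdryFibRes i 0 k₀ * bdryFibRes i 1 k₂ * bdryFibRes i 2 k₁ -
        bdryFibRes i 0 k₁ * bdryFibRes i 1 k₀ * bdryFibRes i 2 k₂ +
        bdryFibRes i 0 k₁ * bdryFibRes i 1 k₂ * bdryFibRes i 2 k₀ +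
        bdryFibRes i 0 k₂ * bdryFibRes i 1 k₀ * bdryFibRes i 2 k₁ -
        bdryFibRes i 0 k₂ * bdryFibRes i 1 k₁ * bdryFibRes i 2 k₀) = 0 := by decide +kernel
  convert h2 (g 0) (g 1) (g 2) using 3

lemma triangle_ne_zero (hab : a * b * (a - 1) * (b - 1) * (a - b) ≠ 0) :
    tensorOf a b triangleCoeff ≠ 0 :=
  tensorOf_ne_zero hab 0 ![(2, 3), (2, 4), (3, 4)] (by decide +kernel)

end DP4
end

noncomputable section

namespace DP4

/-! ### The modules of abelian relations -/

lemma IsSigned.model_symbolRep_apply {a b : ℂ} (hab : a * b * (a - 1) * (b - 1) * (a - b) ≠ 0)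
    {ν : ℕ} {k : Fin ν → Fin 5 × Fin 5} {p q : Fin 5}
    (hk : ∀ s : Fin 5 → ℤˣ, ∏ n, s (k n).1 * s (k n).2 = s p * s q) {w : W}
    {σ : Equiv.Perm (Fin 5)} {s : Fin 5 → ℤˣ} (h : IsSigned w σ s) (Ω : Symbols a b ν)
    (θ : Equiv.Perm (Fin 5)) : model hab k (symbolRep hab ν w Ω) (σ * θ) =
      (((s (θ p) * s (θ q) : ℤˣ) : ℤ) : ℂ) * model hab k Ω θ := by
  rw [model_symbolRep hab h, ← hk fun i => s (θ i)]
  push_cast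
  rfl

/-- The sign character of the symmetric group, as a function. -/
def signFun (θ : Equiv.Perm (Fin 5)) : ℂ := ((Equiv.Perm.sign θ : ℤ) : ℂ)

lemma signFun_mul (θ π : Equiv.Perm (Fin 5)) : signFun (θ * π) = signFun θ * signFun π := by
  simp [signFun]

lemma signFun_one : signFun 1 = 1 := by simp [signFun]

lemma signFun_mul_self (θ : Equiv.Perm (Fin 5)) : signFun θ * signFun θ = 1 := by
  rw [signFun, ← Int.cast_mul, ← Units.val_mul, Int.units_mul_self, Units.val_one, Int.cast_one]

lemma eq_signFun_mul {θ : Equiv.Perm (Fin 5)} {z t : ℂ} (h : t = signFun θ * z) :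
    z = signFun θ * t := by
  rw [h, ← mul_assoc, signFun_mul_self, one_mul]

lemma signFun_mem : signFun ∈ triangleSpace := by
  have h : ∀ π : Equiv.Perm (Fin 5), signFun ∈ rightEigen π (signFun π) := by
    intro π θ
    rw [signFun_mul, mul_comm]
  have h0 : signFun (Equiv.swap 0 4) = -1 := by
    rw [signFun, Equiv.Perm.sign_swap (by decide)]; simp
  have h1 : ∀ i j k l : Fin 5, i ≠ j → k ≠ l →
      signFun (Equiv.swap i j * Equiv.swap k l) = 1 := by
    intro i j k l hij hkl
    rw [signFun, Equiv.Perm.sign_mul, Equiv.Perm.sign_swap hij, Equiv.Perm.sign_swap hkl]; simp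
  refine ⟨⟨?_, ?_⟩, ?_⟩
  · exact h0 ▸ h (Equiv.swap 0 4)
  · exact h1 1 4 2 3 (by decide) (by decide) ▸ h (Equiv.swap 1 4 * Equiv.swap 2 3)
  · exact h1 1 3 2 4 (by decide) (by decide) ▸ h (Equiv.swap 1 3 * Equiv.swap 2 4)

lemma eq_smul_signFun {u : Equiv.Perm (Fin 5) → ℂ} (hu : u ∈ triangleSpace) :
    u = u 1 • signFun := by
  funext θ
  rw [triangleSpace_apply hu, Pi.smul_apply, smul_eq_mul, mul_comm]
  rfl

lemma signFun_ne_zero : signFun ≠ 0 := fun h => by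
  simpa [signFun_one] using congrFun h 1

lemma finrank_triangleSpace : Module.finrank ℂ triangleSpace = 1 :=
  finrank_eq_one ⟨signFun, signFun_mem⟩ (fun h => signFun_ne_zero (congrArg Subtype.val h))
    fun u => ⟨u.1 1, Subtype.ext (eq_smul_signFun u.2).symm⟩

lemma triangleSpace_minimal {U : Submodule ℂ (Equiv.Perm (Fin 5) → ℂ)} (hU : U ≤ triangleSpace)
    (hne : U ≠ ⊥) : U = triangleSpace := by
  refine le_antisymm hU fun u hu => ?_
  obtain ⟨v, hv, hv0⟩ := Submodule.exists_mem_ne_zero_of_ne_bot hne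
  have h1 := eq_smul_signFun (hU hv)
  have h2 : v 1 ≠ 0 := fun h => hv0 (by rw [h1, h, zero_smul])
  have h3 : u 1 • signFun = (u 1 * (v 1)⁻¹) • v 1 • signFun := by
    rw [smul_smul, mul_assoc, inv_mul_cancel₀ h2, mul_one]
  rw [eq_smul_signFun hu, h3, ← h1]
  exact U.smul_mem _ hv

variable {a b : ℂ} (hab : a * b * (a - 1) * (b - 1) * (a - b) ≠ 0)

lemma isModel_edge : IsModel (subHLogAR hab 1) edgeSpace 1 2 (model hab edge) where
  equivariant _ _ _ h := h.model_symbolRep_apply hab fun s => by simp [edge]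
  mem _ := model_edge_mem hab
  eq_zero _ _ := eq_zero_of_model_edge hab _
  ne_bot h := edge_ne_zero hab ((Submodule.eq_bot_iff _).1 h _ (edge_mem hab))
  minimal _ hU hne h := edgeSpace_minimal hU hne h

lemma isModel_wedge : IsModel (subHLogARasym hab) wedgeSpace 2 3 (model hab wedge) where
  equivariant _ _ _ h := h.model_symbolRep_apply hab fun s => by
    -- The index shared by the two pairs contributes its sign twice, leaving the signs at positions
    -- `2` and `3`.
    have : ∀ x y z : ℤˣ, x * y * (x * z) = y * z := by decide
    simp [wedge, Fin.prod_univ_two, this]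
  mem _ := model_wedge_mem hab
  eq_zero Ω hΩ h := eq_zero_of_model_wedge hab ((mem_HLogARasym Ω).1 hΩ).1 h
    (model_doubleEdge_eq_zero hab hΩ)
  ne_bot h := wedge_ne_zero hab ((Submodule.eq_bot_iff _).1 h _ (wedge_mem hab))
  minimal _ hU hne h := wedgeSpace_minimal hU hne h

lemma isModel_doubleEdge :
    IsModel (subHLogARsym hab) doubleEdgeSpace 0 0 (model hab doubleEdge) where
  equivariant _ _ _ h := h.model_symbolRep_apply hab fun s => by
    simp [doubleEdge, Fin.prod_univ_two]
  mem Ω hΩ := model_doubleEdge_mem hab ((mem_HLogARsym Ω).1 hΩ).1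
  eq_zero Ω hΩ h := eq_zero_of_model_wedge hab ((mem_HLogARsym Ω).1 hΩ).1
    (model_wedge_eq_zero hab hΩ) h
  ne_bot h := doubleEdge_ne_zero hab ((Submodule.eq_bot_iff _).1 h _ (doubleEdge_mem hab))
  minimal _ hU hne h := doubleEdgeSpace_minimal hU hne h

lemma isModel_triangle : IsModel (subHLogAR hab 3) triangleSpace 0 0 (model hab triangle) where
  equivariant _ _ _ h := h.model_symbolRep_apply hab fun s => by
    -- In a triangle each index occurs twice, so all signs cancel and the twist is trivial.
    have : ∀ x y z t : ℤˣ, x * y * (x * z) * (y * z) = t * t := by decide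
    simp [triangle, Fin.prod_univ_three, this _ _ _ 1]
  mem _ := model_triangle_mem hab
  eq_zero _ := eq_zero_of_model_triangle hab
  ne_bot h := triangle_ne_zero hab ((Submodule.eq_bot_iff _).1 h _ (triangle_mem hab))
  minimal _ hU hne _ := triangleSpace_minimal hU hne

lemma isIrrep_HLogAR_one :
    IsIrrep (symbolRep hab 1) (HLogAR a b 1) 20 (yd [2]) (yd [2, 1]) :=
  (isModel_edge hab).isIrrep finrank_edgeSpace edgeTableau (by decide +kernel) edgeSpecht_mem
    (by norm_num) permPoly_edge

lemma isIrrep_HLogARasym :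
    IsIrrep (symbolRep hab 2) (HLogARasym a b) 10 (yd [1, 1]) (yd [1, 1, 1]) :=
  (isModel_wedge hab).isIrrep finrank_wedgeSpace wedgeTableau (by decide +kernel)
    isKernel_wedge.mem (by norm_num) permPoly_wedge

lemma isIrrep_HLogARsym :
    IsIrrep (symbolRep hab 2) (HLogARsym a b) 5 (yd []) (yd [2, 2, 1]) :=
  (isModel_doubleEdge hab).isIrrep finrank_doubleEdgeSpace doubleEdgeTableau (by decide +kernel)
    doubleEdgeSpecht_mem (by norm_num) permPoly_doubleEdge

lemma isIrrep_HLogAR_three :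
    IsIrrep (symbolRep hab 3) (HLogAR a b 3) 1 (yd []) (yd [1, 1, 1, 1, 1]) := by
  have hc : ∀ s : Fin 5 → ℤˣ, ∏ i, s i = 1 →
      ∏ i, s i ^ (![1, 3, 5, 7, 9] : Fin 5 → ℕ) i = s 0 * s 0 := by decide +kernel
  have hs : permPoly ![1, 3, 5, 7, 9] signFun =
      (1 : ℂ) • spechtPoly (yd []) (yd [1, 1, 1, 1, 1]) triangleTableau := by
    rw [show signFun = fun θ => ((Equiv.Perm.sign θ : ℤ) : ℂ) from rfl]
    exact permPoly_sign
  exact (isModel_triangle hab).isIrrep finrank_triangleSpace triangleTableau hc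
    signFun_mem one_ne_zero hs

/-! ### The weight three relation and the signature character. -/

/-- The value at the identity of the model of an abelian relation of weight three. -/
def triangleValue : (subHLogAR hab 3).toSubmodule →ₗ[ℂ] ℂ :=
  LinearMap.proj 1 ∘ₗ model hab triangle ∘ₗ (subHLogAR hab 3).toSubmodule.subtype

lemma model_triangle_apply (Ω : (subHLogAR hab 3).toSubmodule) (θ : Equiv.Perm (Fin 5)) :
    model hab triangle Ω θ = signFun θ * triangleValue hab Ω :=
  triangleSpace_apply (model_triangle_mem hab Ω.2) θ

lemma triangleValue_injective : Function.Injective (triangleValue hab) := by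
  rw [injective_iff_map_eq_zero]
  intro Ω h
  refine Subtype.ext (eq_zero_of_model_triangle hab Ω.2 (funext fun θ => ?_))
  rw [model_triangle_apply, h, mul_zero]
  rfl

/-- The value at the identity, as an isomorphism. -/
def triangleEquiv : (subHLogAR hab 3).toSubmodule ≃ₗ[ℂ] ℂ :=
  LinearEquiv.ofBijective (triangleValue hab) ⟨triangleValue_injective hab, by
    refine LinearMap.surjective fun h => triangle_ne_zero hab ?_
    have : (⟨_, triangle_mem hab⟩ : (subHLogAR hab 3).toSubmodule) = 0 :=
      triangleValue_injective hab (by rw [h]; rfl)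
    exact congrArg Subtype.val this⟩

lemma HLogAR_three_eq_span (hab : a * b * (a - 1) * (b - 1) * (a - b) ≠ 0) :
    HLogAR a b 3 = Submodule.span ℂ {HLog3 a b} := by
  have h0 : HLog3 a b ∈ HLogAR a b 3 := by
    rw [HLog3_eq]
    exact Submodule.smul_mem _ _ (triangle_mem hab)
  have h1 : HLog3 a b ≠ 0 := by
    rw [HLog3_eq]
    exact smul_ne_zero (by norm_num) (triangle_ne_zero hab)
  refine le_antisymm (fun Ω hΩ => ?_) ((Submodule.span_singleton_le_iff_mem _ _).2 h0)
  set Ω₀ : (subHLogAR hab 3).toSubmodule := ⟨_, h0⟩ with hΩ₀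
  set Ω₁ : (subHLogAR hab 3).toSubmodule := ⟨_, hΩ⟩ with hΩ₁
  have h2 : triangleEquiv hab Ω₀ ≠ 0 := fun h =>
    h1 (congrArg Subtype.val ((LinearEquiv.map_eq_zero_iff _).1 h))
  refine Submodule.mem_span_singleton.2 ⟨triangleEquiv hab Ω₁ / triangleEquiv hab Ω₀, ?_⟩
  have h3 : (triangleEquiv hab Ω₁ / triangleEquiv hab Ω₀) • Ω₀ = Ω₁ := by
    apply (triangleEquiv hab).injective
    rw [map_smul, smul_eq_mul, div_mul_cancel₀ _ h2]
  exact congrArg Subtype.val h3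

lemma det_simpleReflection (k : Fin 5) :
    LinearEquiv.det ((simpleReflection k : W) : Pic ≃ₗ[ℤ] Pic) = -1 := by
  ext1
  rw [LinearEquiv.coe_det, ← LinearMap.det_toMatrix']
  have h : LinearMap.toMatrix' (((simpleReflection k : W) : Pic ≃ₗ[ℤ] Pic) : Pic →ₗ[ℤ] Pic) =
      Matrix.of fun i j => (Pi.single j 1 : Pic) i + inter (Pi.single j 1) (root k) * root k i := by
    ext i j
    rw [LinearMap.toMatrix'_apply]
    rfl
  rw [h]
  revert k
  decide +kernel

/-- `W` fixes `K` and permutes the `ε_i` up to an even number of signs, so the determinant is the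
sign of the underlying permutation. Both are multiplicative and equal `-1` on the simple
reflections. -/
lemma exists_isSigned_det (w : W) :
    ∃ σ s, IsSigned w σ s ∧ LinearEquiv.det (w : Pic ≃ₗ[ℤ] Pic) = Equiv.Perm.sign σ := by
  induction w using W_induction with
  | one => exact ⟨1, 1, isSigned_one, by simp⟩
  | mul k w ih =>
    obtain ⟨σ, s, h, h'⟩ := ih
    refine ⟨_, _, (isSigned_simpleReflection k).mul h, ?_⟩
    have hk : ∀ k, Equiv.Perm.sign (simplePerm k) = -1 := by decide
    rw [Subgroup.coe_mul, map_mul, det_simpleReflection, h', Equiv.Perm.sign_mul, hk]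

/-- With trivial twist, the model of the transformed relation at `σ` is the model of the original
one at `1`. Both models are multiples of the sign function, which transfers the value at `σ` back to
`1`. -/
lemma IsSigned.triangleValue {w : W} {σ : Equiv.Perm (Fin 5)} {s : Fin 5 → ℤˣ}
    (h : IsSigned w σ s) (Ω : (subHLogAR hab 3).toSubmodule) :
    triangleValue hab ((subHLogAR hab 3).toRepresentation w Ω) =
      signFun σ * triangleValue hab Ω := by
  have h1 := (isModel_triangle hab).equivariant w σ s h Ω 1
  rw [Int.units_mul_self, Units.val_one, Int.cast_one, one_mul, mul_one] at h1
  exact eq_signFun_mul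
    (h1.symm.trans (model_triangle_apply hab ((subHLogAR hab 3).toRepresentation w Ω) σ))

lemma nonempty_equiv_signRep :
    Nonempty ((subHLogAR hab 3).toRepresentation.Equiv signRep) := by
  have key : ∀ w, (triangleEquiv hab : _ →ₗ[ℂ] ℂ) ∘ₗ (subHLogAR hab 3).toRepresentation w =
      signRep w ∘ₗ (triangleEquiv hab : _ →ₗ[ℂ] ℂ) := by
    intro w
    obtain ⟨σ, s, h, hdet⟩ := exists_isSigned_det w
    have hw : signRep w = signFun σ • LinearMap.id := by
      rw [signFun, ← hdet]
      rfl
    refine LinearMap.ext fun Ω => ?_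
    rw [hw]
    exact h.triangleValue hab Ω
  exact ⟨Representation.Equiv.mk (triangleEquiv hab) key⟩

end DP4
end

theorem mainTheorem2 (a b : ℂ) (hab : a * b * (a - 1) * (b - 1) * (a - b) ≠ 0) :
    -- every form of `H` has a well-defined residue along each of the sixteen lines
    (∀ (ω : DP4.H a b) (l : Fin 16), ∃! c : ℂ, DP4.IsResidue a b l ω c) ∧
    -- the action of the Weyl group on `H` exists and is unique
    ∃ ρ : Representation ℂ DP4.W (DP4.H a b),
      DP4.IsResidueAction a b ρ ∧ (∀ ρ', DP4.IsResidueAction a b ρ' → ρ' = ρ) ∧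
      -- so does its action on the tuples of symbols of every weight
      ∃ τ : (ν : ℕ) → Representation ℂ DP4.W (DP4.Symbols a b ν),
        (∀ ν, DP4.IsBulletAction a b ν ρ (τ ν) ∧
          ∀ τ', DP4.IsBulletAction a b ν ρ τ' → τ' = τ ν) ∧
        -- and the abelian relations form subrepresentations
        (∀ ν (w : DP4.W), ∀ Ω ∈ DP4.HLogAR a b ν, τ ν w Ω ∈ DP4.HLogAR a b ν) ∧
        DP4.IsIrrep (τ 1) (DP4.HLogAR a b 1) 20 (DP4.yd [2]) (DP4.yd [2, 1]) ∧
        DP4.IsIrrep (τ 2) (DP4.HLogARasym a b) 10 (DP4.yd [1, 1]) (DP4.yd [1, 1, 1]) ∧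
        DP4.IsIrrep (τ 2) (DP4.HLogARsym a b) 5 (DP4.yd []) (DP4.yd [2, 2, 1]) ∧
        DP4.IsIrrep (τ 3) (DP4.HLogAR a b 3) 1 (DP4.yd []) (DP4.yd [1, 1, 1, 1, 1]) ∧
        DP4.HLogAR a b 3 = Submodule.span ℂ {DP4.HLog3 a b} ∧
        (∃ σ : Subrepresentation (τ 3), σ.toSubmodule = DP4.HLogAR a b 3 ∧
          Nonempty (σ.toRepresentation.Equiv DP4.signRep)) := by
  refine ⟨DP4.existsUnique_isResidue hab, DP4.formRep hab, DP4.isResidueAction_formRep hab,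
    DP4.eq_formRep hab, DP4.symbolRep hab,
    fun ν => ⟨DP4.isBulletAction_symbolRep hab ν, DP4.eq_symbolRep hab ν⟩,
    DP4.symbolRep_mem_HLogAR hab, DP4.isIrrep_HLogAR_one hab, DP4.isIrrep_HLogARasym hab,
    DP4.isIrrep_HLogARsym hab, DP4.isIrrep_HLogAR_three hab, DP4.HLogAR_three_eq_span hab,
    DP4.subHLogAR hab 3, rfl, DP4.nonempty_equiv_signRep hab⟩
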